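/- Let $n\ge 1$, let $A\in\mathbb{R}^{n\times n}$, $C\in\mathbb{R}^{k\times n}$ be an observable pair, and let $\tilde n\in\mathbb{N}$ be the minimal number such that the matrix with block rows $C, CA,\dots,CA^{\tilde n-1}$ has rank $n$. Let $G_0\in\mathbb{R}^{n\times n}$, $Y_0\in\mathbb{R}^{n\times k}$ be any solution of $$AG_0-G_0A+Y_0C=A,\qquad CG_0=\mathbf 0,$$ and put $L_0=-(I_n+G_0)^{-1}Y_0$, $A_0=A+L_0C$. Let $\nu\ge-\frac1{\tilde n+1}$, $\gamma>0$, and $$G_{\mathbf d}=I_n+\nu(G_0+I_n),\quad \mathbf d(s)=e^{sG_{\mathbf d}},\quad \bar G=\begin{pmatrix} I_k&\mathbf 0\\ \mathbf 0&G_{\mathbf d}\end{pmatrix},\quad \bar A_0=\begin{pmatrix}\mathbf 0&C\\ \mathbf 0&A_0\end{pmatrix},\quad \bar C=(I_k\;\;\mathbf 0).$$ Then for every $\rho>0$ the linear matrix inequality $$\bar P\bar A_0+\bar A_0^\top\bar P+\bar Y\bar C+\bar C^\top\bar Y^\top+\rho(\bar P\bar G+\bar G^\top\bar P)\preceq 0,\qquad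 \bar P\bar G+\bar G^\top\bar P\succ0,\qquad \bar P=\bar P^\top\succ0 \tag{LMI}$$ has a solution $\bar P\in\mathbb{R}^{(k+n)\times(k+n)}$, $\bar Y\in\mathbb{R}^{(k+n)\times k}$. For gains $\tilde L\in\mathbb{R}^{k\times k}$, $L\in\mathbb{R}^{n\times k}$ consider the error equation of the filtering observer, with state $(\psi,\varepsilon,\xi)\in\mathbb{R}^k\times\mathbb{R}^n\times\mathbb{R}$: $$\dot\psi=C\varepsilon+\sigma^{\nu}\tilde L\psi,\qquad \dot\varepsilon=A_0\varepsilon+\sigma^{\nu-1}\mathbf d(\ln\sigma)L\psi,$$ $$\dot\xi=\left|\psi^\top(C\varepsilon+\sigma^\nu\tilde L\psi)\right|-\gamma\left\lfloor\xi-\tfrac{|\psi|^2}2\right\rceil^{\frac\nu2+1},\qquad \sigma=\sqrt{\max\{\xi,\tfrac{|\psi|^2}{2}\}},$$ where $\lfloor r\rceil^{a}=|r|^a\,\mathrm{sign}(r)$ and the terms with $\tilde L\psi$, $L\psi$ are read as $\mathbf 0$ when $\sigma=0$ (which forces $\psi=\mathbf 0$). Denote its right-hand side by $g$. 1) For all gains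 $\tilde L,L$, the family $\mathbf d_\sigma(s)=\mathrm{diag}(e^{s\bar G},e^{2s})$ is a dilation in $\mathbb{R}^{k+n+1}$ (a continuous one-parameter group of matrices with $\|\mathbf d_\sigma(s)x\|\to+\infty$ as $s\to+\infty$ and $\|\mathbf d_\sigma(s)x\|\to0$ as $s\to-\infty$ for each $x\ne\mathbf 0$), and $g$ is $\mathbf d_\sigma$-homogeneous of degree $\nu$: $g(\mathbf d_\sigma(s)x)=e^{\nu s}\mathbf d_\sigma(s)g(x)$ for all $s\in\mathbb{R}$, $x\in\mathbb{R}^{k+n+1}$. 2) For all gains $\tilde L,L$, $g$ is continuous on $\mathbb{R}^{k+n+1}$ if $\nu>-\frac1{\tilde n+1}$, and piecewise continuous if $\nu=-\frac1{\tilde n+1}$; the latter means that $g$ is bounded on bounded sets and that, up to a set of Lebesgue measure zero, $\mathbb{R}^{k+n+1}$ is the union of finitely many pairwise disjoint open connected sets on each of which $g$ is continuous. 3) Let $\nu\in[-\frac1{\tilde n+1},0)$ and $\begin{pmatrix}\tilde L\\ L\end{pmatrix}=\bar P^{-1}\bar Y$, where $(\bar P,\bar Y)$ is any solution of (LMI)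 with some $\rho>\frac\gamma2$. Then the error equation, with solutions understood in the sense of Filippov (classical ones where $g$ is continuous), is globally finite-time stable: a solution exists from every initial state, every solution is extendable to $[0,+\infty)$, the origin is Lyapunov stable, and there is a locally bounded function $T:\mathbb{R}^{k+n+1}\to\mathbb{R}$ such that every solution $x$ satisfies $x(t)=\mathbf 0$ for all $t\ge \max\{0,T(x(0))\}$. -/

import Mathlib

open MeasureTheory Filter Topology Matrix

noncomputable section

/-! ### Observability -/

/-- The block matrix with rows `C, C A, ..., C A ^ (N - 1)`. -/
def obsMatrix {n k : ℕ} (A : Matrix (Fin n) (Fin n) ℝ) (C : Matrix (Fin k) (Fin n) ℝ) (N : ℕ) :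
    Matrix (Fin N × Fin k) (Fin n) ℝ :=
  Matrix.of fun p j => (C * A ^ (p.1 : ℕ)) p.2 j

/-- Kalman observability of the pair `{A, C}`. -/
def IsObservablePair {n k : ℕ} (A : Matrix (Fin n) (Fin n) ℝ)
    (C : Matrix (Fin k) (Fin n) ℝ) : Prop :=
  (obsMatrix A C n).rank = n

/-! ### Linear dilations and homogeneous vector fields -/

/-- A continuous linear dilation: a continuous one-parameter group of matrices such that
`‖d s x‖ → +∞` as `s → +∞` and `‖d s x‖ → 0` as `s → -∞` for every `x ≠ 0`. -/
structure IsLinearDilation {ι : Type*} [Fintype ι] [DecidableEq ι]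
    (d : ℝ → Matrix ι ι ℝ) : Prop where
  zero : d 0 = 1
  add : ∀ s t : ℝ, d (s + t) = d s * d t
  continuous : ∀ x : ι → ℝ, Continuous fun s => d s *ᵥ x
  atTop : ∀ x : ι → ℝ, x ≠ 0 → Tendsto (fun s => ‖d s *ᵥ x‖) atTop atTop
  atBot : ∀ x : ι → ℝ, x ≠ 0 → Tendsto (fun s => ‖d s *ᵥ x‖) atBot (𝓝 0)

/-- `f` is `d`-homogeneous of degree `μ`. -/
def IsHomogeneousField {ι : Type*} [Fintype ι] (d : ℝ → Matrix ι ι ℝ) (μ : ℝ)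
    (f : (ι → ℝ) → (ι → ℝ)) : Prop :=
  ∀ (s : ℝ) (x : ι → ℝ), f (d s *ᵥ x) = Real.exp (μ * s) • (d s *ᵥ f x)

/-- The linear group `s ↦ exp (s G)` generated by the matrix `G`. -/
def linearGroup {ι : Type*} [Fintype ι] [DecidableEq ι] (G : Matrix ι ι ℝ) (s : ℝ) :
    Matrix ι ι ℝ :=
  NormedSpace.exp (s • G)

/-! ### Piecewise continuity -/

/-- `f` is bounded on bounded sets, and up to a set of Lebesgue measure zero the space is the union
of finitely many pairwise disjoint domains (open connected sets) on each of which `f` is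
continuous. -/
def IsPiecewiseContinuous {ι : Type*} [Fintype ι] (f : (ι → ℝ) → (ι → ℝ)) : Prop :=
  (∀ R : ℝ, ∃ M : ℝ, ∀ x : ι → ℝ, ‖x‖ ≤ R → ‖f x‖ ≤ M) ∧
  ∃ (m : ℕ) (D : Fin m → Set (ι → ℝ)),
    (∀ i, IsOpen (D i) ∧ IsConnected (D i)) ∧
    Pairwise (fun i j => Disjoint (D i) (D j)) ∧
    volume (⋃ i, D i)ᶜ = 0 ∧
    ∀ i, ContinuousOn f (D i)

/-! ### Filippov solutions and finite-time stability -/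

/-- Filippov's set-valued regularization of a vector field: the intersection over all radii
`δ > 0` and all Lebesgue null sets `N` of the closed convex hulls of `f (B(x, δ) \ N)`.
If `f` is continuous at `x`, it is the singleton `{f x}`. -/
def filippovSet {ι : Type*} [Fintype ι] (f : (ι → ℝ) → (ι → ℝ)) (x : ι → ℝ) : Set (ι → ℝ) :=
  ⋂ (δ : ℝ) (_ : 0 < δ) (N : Set (ι → ℝ)) (_ : volume N = 0),
    closure (convexHull ℝ (f '' (Metric.ball x δ \ N)))

/-- `x` is a Filippov solution of `x' = f x` on the time interval `I`: it is absolutely continuous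
on every compact subinterval of `I` and satisfies `x' ∈ filippovSet f x` almost everywhere. -/
def IsFilippovSolution {ι : Type*} [Fintype ι] (f : (ι → ℝ) → (ι → ℝ)) (I : Set ℝ)
    (x : ℝ → ι → ℝ) : Prop :=
  (∀ a ∈ I, ∀ b ∈ I, AbsolutelyContinuousOnInterval x a b) ∧
  ∀ᵐ t, t ∈ I → ∃ v ∈ filippovSet f (x t), HasDerivAt x v t

/-- Global (uniform) finite-time stability of the origin for `x' = f x`, solutions being understood
in the sense of Filippov: solutions exist from every initial state and all of them are extendable
to `[0, +∞)`, the origin is Lyapunov stable, and there is a locally bounded settling time. -/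
structure IsGloballyFiniteTimeStable {ι : Type*} [Fintype ι]
    (f : (ι → ℝ) → (ι → ℝ)) : Prop where
  exists_solution : ∀ x₀ : ι → ℝ, ∃ x : ℝ → ι → ℝ,
    IsFilippovSolution f (Set.Ici 0) x ∧ x 0 = x₀
  extendable : ∀ b : ℝ, 0 < b → ∀ x : ℝ → ι → ℝ, IsFilippovSolution f (Set.Ico 0 b) x →
    ∃ y : ℝ → ι → ℝ, IsFilippovSolution f (Set.Ici 0) y ∧ Set.EqOn y x (Set.Ico 0 b)
  stable : ∀ r : ℝ, 0 < r → ∃ δ : ℝ, 0 < δ ∧ ∀ x : ℝ → ι → ℝ,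
    IsFilippovSolution f (Set.Ici 0) x → ‖x 0‖ < δ → ∀ t : ℝ, 0 ≤ t → ‖x t‖ < r
  settling : ∃ T : (ι → ℝ) → ℝ,
    (∀ R : ℝ, ∃ M : ℝ, ∀ x₀ : ι → ℝ, ‖x₀‖ ≤ R → T x₀ ≤ M) ∧
    ∀ x : ℝ → ι → ℝ, IsFilippovSolution f (Set.Ici 0) x →
      ∀ t : ℝ, 0 ≤ t → T (x 0) ≤ t → x t = 0

/-! ### The augmented LMI -/

/-- `Ḡ = diag (I_k, G_d)`. -/
def barG {n k : ℕ} (Gd : Matrix (Fin n) (Fin n) ℝ) :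
    Matrix (Fin k ⊕ Fin n) (Fin k ⊕ Fin n) ℝ :=
  fromBlocks 1 0 0 Gd

/-- `Ā₀`, with block rows `(0, C)` and `(0, A₀)`. -/
def barA {n k : ℕ} (C : Matrix (Fin k) (Fin n) ℝ) (A₀ : Matrix (Fin n) (Fin n) ℝ) :
    Matrix (Fin k ⊕ Fin n) (Fin k ⊕ Fin n) ℝ :=
  fromBlocks 0 C 0 A₀

/-- `C̄ = (I_k, 0)`. -/
def barC {n k : ℕ} : Matrix (Fin k) (Fin k ⊕ Fin n) ℝ :=
  fromCols 1 0

/-- The pair `(P, Y)` solves the augmented linear matrix inequality with parameter `ρ`. -/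
def SolvesLMI {n k : ℕ} (C : Matrix (Fin k) (Fin n) ℝ) (A₀ Gd : Matrix (Fin n) (Fin n) ℝ) (ρ : ℝ)
    (P : Matrix (Fin k ⊕ Fin n) (Fin k ⊕ Fin n) ℝ) (Y : Matrix (Fin k ⊕ Fin n) (Fin k) ℝ) : Prop :=
  (-(P * barA C A₀ + (barA C A₀)ᵀ * P + Y * barC + barCᵀ * Yᵀ
      + ρ • (P * barG Gd + (barG Gd)ᵀ * P))).PosSemidef ∧
  (P * barG Gd + (barG Gd)ᵀ * P).PosDef ∧
  P.PosDef

/-! ### The error equation of the filtering observer -/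

/-- Index set of the error variable `(ψ, ε, ξ)`. -/
abbrev ErrIdx (n k : ℕ) : Type := (Fin k ⊕ Fin n) ⊕ Fin 1

/-- The signed power `⌊r⌉ ^ a = |r| ^ a * sign r`. -/
def signedPow (r a : ℝ) : ℝ := |r| ^ a * Real.sign r

/-- `σ = sqrt (max {ξ, |ψ|² / 2})`. -/
def sigmaOf {k : ℕ} (ψ : Fin k → ℝ) (ξ : ℝ) : ℝ :=
  Real.sqrt (max ξ ((ψ ⬝ᵥ ψ) / 2))

/-- The right-hand side `g` of the error equation. If `σ = 0` then `ψ = 0`, so the terms containing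
`L̃ ψ` and `L ψ` vanish there whatever value is given to the powers of `σ = 0`. -/
def errorField {n k : ℕ} (C : Matrix (Fin k) (Fin n) ℝ) (A₀ Gd : Matrix (Fin n) (Fin n) ℝ)
    (Lt : Matrix (Fin k) (Fin k) ℝ) (L : Matrix (Fin n) (Fin k) ℝ) (ν γ : ℝ)
    (x : ErrIdx n k → ℝ) : ErrIdx n k → ℝ :=
  let ψ : Fin k → ℝ := fun i => x (Sum.inl (Sum.inl i))
  let ε : Fin n → ℝ := fun i => x (Sum.inl (Sum.inr i))
  let ξ : ℝ := x (Sum.inr 0)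
  let σ : ℝ := sigmaOf ψ ξ
  let dψ : Fin k → ℝ := C *ᵥ ε + σ ^ ν • (Lt *ᵥ ψ)
  let dε : Fin n → ℝ :=
    A₀ *ᵥ ε + σ ^ (ν - 1) • (linearGroup Gd (Real.log σ) *ᵥ (L *ᵥ ψ))
  let dξ : ℝ := |ψ ⬝ᵥ dψ| - γ * signedPow (ξ - (ψ ⬝ᵥ ψ) / 2) (ν / 2 + 1)
  Sum.elim (Sum.elim dψ dε) (fun _ => dξ)

/-- `d_σ(s) = diag (exp (s Ḡ), exp (2 s))`. -/
def dSigma {n k : ℕ} (Gd : Matrix (Fin n) (Fin n) ℝ) (s : ℝ) :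
    Matrix (ErrIdx n k) (ErrIdx n k) ℝ :=
  fromBlocks (linearGroup (barG Gd) s) 0 0 (Real.exp (2 * s) • (1 : Matrix (Fin 1) (Fin 1) ℝ))

end

noncomputable section

/-! ### Absolutely continuous functions -/

/-! Grading. The equation for $G_0$ gives $A_0G_0=(G_0+I)A_0$ and $CA_0^mG_0=m\,CA_0^m$, so the rows
$(I,0),(0,C),(0,CA_0),\dots,(0,CA_0^{N-1})$ are left eigenrows of $\bar G$ with weights $1+\nu m$,
$0\le m\le N$, all positive. Observability makes these rows jointly injective, and $CA_0^N=0$. In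
these (possibly redundant) coordinates $(\psi,\varepsilon)$ is a family of integrator chains with
output injection. The dilation acts by scalars, and the injection into row $m$ has size at most
$\mathrm{const}\cdot\sigma^{1+\nu(m+1)}$ because $|\psi|\le 2\sigma$. Dilation, homogeneity and
(piecewise) continuity follow; only the last row can be discontinuous, and only where $\sigma=0$
(`isGradedPair_of_observable`, `augRow_errorField`). The matrix inequality is solved for one scalar
chain by induction on its length (`exists_chain_lmi`) and the solutions are summed over the output
channels.

Existence. Mollified fields have $C^1$ flows. The homogeneous gauge $Q$ of degree four grows along
velocities at most like $Q^{1+\nu/4}$, so $Q^{-\nu/4}$ grows at most linearly for $\nu<0$. This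
bounds the approximations, whose limits are Filippov solutions (`exists_isFilippovSolution`), and
rules out blow-up (`exists_gauge4_growth`).

Settling. Let $e=|\psi|^2/2-\xi$. The absolute value in $\dot\xi$ makes $\dot e\le-\gamma
e^{1+\nu/2}$ while $e>0$, so $e\le0$ after a finite time and forever (`exists_excess_nonpos`). There
$\sigma=\sqrt\xi$, and as long as $\xi>0$ the state scaled to $\xi=1$, called $u$, satisfies $\dot
u=\xi^{\nu/2}Mu-\frac{\dot\xi}{2\xi}\bar Gu$ with $M$ the closed-loop matrix. Since
$\dot\xi\ge-\gamma\xi^{1+\nu/2}$, the rescaling costs at most $\gamma/2$ of the margin $\rho$, and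
$W=u^\top\bar Pu$ obeys $\dot W\le-c\,\xi^{\nu/2}W$, while $\dot\xi\le\xi^{1+\nu/2}(KW-\gamma)$
(`exists_lyapunov`).

$W$ has degree zero and is not bounded on bounded sets. But $W\xi\le DQ^{1/2}$ turns its decay into
$\dot W\le-\mathrm{const}\cdot W^{1-\nu/2}$ while $Q$ is bounded, so $W$ falls below a universal
bound after a time proportional to the natural scale $q^{-\nu/4}$. Then $\xi e^{KW/c}$ dies in
finite time (`exists_not_pos`). When $\xi$ reaches zero so does the whole state, because $W$
controls the rows by powers of $\xi$. A solution cannot leave zero: the time for which $\xi$ can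
stay positive scales like $q^{-\nu/4}$, and $q$ may be taken arbitrarily small. Lyapunov stability
follows from the settling time and the linear growth of $Q^{-\nu/4}$. -/

theorem AbsolutelyContinuousOnInterval.comp_of_lipschitzOnWith {X Y : Type*} [PseudoMetricSpace X]
    [PseudoMetricSpace Y] {F : X → Y} {x : ℝ → X} {K : NNReal} {a b : ℝ}
    (hF : LipschitzOnWith K F (x '' Set.uIcc a b)) (hx : AbsolutelyContinuousOnInterval x a b) :
    AbsolutelyContinuousOnInterval (fun t => F (x t)) a b := by
  rw [absolutelyContinuousOnInterval_iff] at hx ⊢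
  intro ε hε
  obtain ⟨δ, hδ, h⟩ := hx (ε / (K + 1)) (by positivity)
  refine ⟨δ, hδ, fun E hE hs => ?_⟩
  have h1 := h E hE hs
  calc _ ≤ ∑ i ∈ Finset.range E.1, (K + 1 : ℝ) * dist (x (E.2 i).1) (x (E.2 i).2) := by
        refine Finset.sum_le_sum fun i hi => ?_
        have h2 := hF.dist_le_mul _ (Set.mem_image_of_mem x (hE.1 i hi).1) _
          (Set.mem_image_of_mem x (hE.1 i hi).2)
        nlinarith [dist_nonneg (x := x (E.2 i).1) (y := x (E.2 i).2)]
    _ = (K + 1 : ℝ) * ∑ i ∈ Finset.range E.1, dist (x (E.2 i).1) (x (E.2 i).2) := by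
        rw [Finset.mul_sum]
    _ < (K + 1 : ℝ) * (ε / (K + 1)) := by gcongr
    _ = ε := by field_simp

theorem AbsolutelyContinuousOnInterval.sub_le_of_ae_deriv_le {u : ℝ → ℝ} {a b k : ℝ} (hab : a ≤ b)
    (hu : AbsolutelyContinuousOnInterval u a b)
    (h : ∀ᵐ t, t ∈ Set.Ioo a b → deriv u t ≤ k) : u b - u a ≤ k * (b - a) := by
  rw [← hu.integral_deriv_eq_sub]
  have : k * (b - a) = ∫ _ in a..b, k := by simp [mul_comm]
  rw [this]
  refine intervalIntegral.integral_mono_ae_restrict hab hu.intervalIntegrable_deriv (by simp) ?_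
  rw [← Measure.restrict_congr_set Ioo_ae_eq_Icc]
  exact (ae_restrict_iff' measurableSet_Ioo).2 h

theorem LipschitzOnWith.Icc_union_Icc {X : Type*} [PseudoMetricSpace X] {x : ℝ → X} {K : NNReal}
    {a b c : ℝ} (h1 : LipschitzOnWith K x (Set.Icc a b)) (h2 : LipschitzOnWith K x (Set.Icc b c)) :
    LipschitzOnWith K x (Set.Icc a c) := by
  have key : ∀ s ∈ Set.Icc a c, ∀ t ∈ Set.Icc a c, s ≤ t → dist (x s) (x t) ≤ K * dist s t := by
    intro s hs t ht hst
    rcases le_total t b with htb | htb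
    · exact h1.dist_le_mul s ⟨hs.1, hst.trans htb⟩ t ⟨ht.1, htb⟩
    rcases le_total b s with hsb | hsb
    · exact h2.dist_le_mul s ⟨hsb, hs.2⟩ t ⟨htb, ht.2⟩
    have e1 := h1.dist_le_mul s ⟨hs.1, hsb⟩ b ⟨hs.1.trans hsb, le_rfl⟩
    have e2 := h2.dist_le_mul b ⟨le_rfl, htb.trans ht.2⟩ t ⟨htb, ht.2⟩
    have e3 := dist_triangle (x s) (x b) (x t)
    rw [Real.dist_eq, abs_of_nonpos (by linarith)] at e1 e2 ⊢
    nlinarith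
  refine LipschitzOnWith.of_dist_le_mul fun s hs t ht => ?_
  rcases le_total s t with h | h
  · exact key s hs t ht h
  · rw [dist_comm, dist_comm s t]
    exact key t ht s hs h

/-! ### Filippov's regularization -/

section Filippov
variable {ι : Type*} [Fintype ι] {f : (ι → ℝ) → (ι → ℝ)}

theorem filippovSet_subset {x : ι → ℝ} {K : Set (ι → ℝ)} (hK : Convex ℝ K) (hc : IsClosed K)
    (h : ∀ᶠ y in 𝓝 x, f y ∈ K) : filippovSet f x ⊆ K := by
  intro v hv
  obtain ⟨δ, hδ, hb⟩ := Metric.eventually_nhds_iff_ball.1 h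
  have h1 := Set.mem_iInter₂.1 (Set.mem_iInter₂.1 hv δ hδ) ∅ measure_empty
  refine closure_minimal (convexHull_min ?_ hK) hc h1
  rintro _ ⟨y, hy, rfl⟩
  exact hb y hy.1

/-- A half-space condition survives closed convex hulls, and near $x$ the continuous majorant
exceeds its value at $x$ by at most any given $\varepsilon$. This turns pointwise bounds on `f` into
bounds on admissible velocities. -/
theorem filippovSet_apply_le {x v : ι → ℝ} (l : (ι → ℝ) →L[ℝ] ℝ) {c : (ι → ℝ) → ℝ}
    (hc : ContinuousAt c x) (h : ∀ᶠ y in 𝓝 x, l (f y) ≤ c y) (hv : v ∈ filippovSet f x) :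
    l v ≤ c x := by
  refine le_of_forall_pos_le_add fun ε hε => ?_
  have h1 : ∀ᶠ y in 𝓝 x, c y < c x + ε := hc.eventually_lt_const (by linarith)
  refine filippovSet_subset (K := {w | l w ≤ c x + ε}) ?_ ?_ ?_ hv
  · exact convex_halfSpace_le l.isLinear _
  · exact isClosed_le l.continuous continuous_const
  · filter_upwards [h, h1] with y h2 h3
    exact h2.trans h3.le

/-- Regularization affects only discontinuous components. Hence $\psi$, $\xi$ and every row except
possibly the last can be handled classically even where the field jumps. -/
theorem filippovSet_apply_eq {x v : ι → ℝ} (l : (ι → ℝ) →L[ℝ] ℝ)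
    (hc : ContinuousAt (fun y => l (f y)) x) (hv : v ∈ filippovSet f x) : l v = l (f x) := by
  refine le_antisymm (filippovSet_apply_le l (c := fun y => l (f y)) hc (Eventually.of_forall fun y => le_rfl) hv) ?_
  have := filippovSet_apply_le (-l) (c := fun y => -l (f y)) hc.neg
    (Eventually.of_forall fun y => le_rfl) hv
  simpa using this

theorem filippovSet_norm_le {x v : ι → ℝ} {M : ℝ} (h : ∀ᶠ y in 𝓝 x, ‖f y‖ ≤ M)
    (hv : v ∈ filippovSet f x) : ‖v‖ ≤ M := by
  have := filippovSet_subset (K := Metric.closedBall 0 M) (convex_closedBall _ _)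
    Metric.isClosed_closedBall (by simpa using h) hv
  simpa using this

/-! ### Solutions -/

theorem IsFilippovSolution.mono {I J : Set ℝ} {x : ℝ → ι → ℝ} (hx : IsFilippovSolution f I x)
    (h : J ⊆ I) : IsFilippovSolution f J x :=
  ⟨fun a ha b hb => hx.1 a (h ha) b (h hb), hx.2.mono fun _ ht hJ => ht (h hJ)⟩

theorem IsFilippovSolution.continuousOn {x : ℝ → ι → ℝ} {a b : ℝ} (hab : a ≤ b)
    (hx : IsFilippovSolution f (Set.Icc a b) x) : ContinuousOn x (Set.Icc a b) := by
  have := (hx.1 a ⟨le_rfl, hab⟩ b ⟨hab, le_rfl⟩).continuousOn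
  rwa [Set.uIcc_of_le hab] at this

/-- On a ball containing the trajectory `F` is Lipschitz, so `F ∘ x` is absolutely continuous. The
chain rule holds almost everywhere and can be integrated. -/
theorem IsFilippovSolution.comp_sub_le {x : ℝ → ι → ℝ} {a b k : ℝ} (hab : a ≤ b)
    (hx : IsFilippovSolution f (Set.Icc a b) x) {F : (ι → ℝ) → ℝ} (hF : ContDiff ℝ 1 F)
    (h : ∀ t ∈ Set.Ioo a b, ∀ v ∈ filippovSet f (x t), fderiv ℝ F (x t) v ≤ k) :
    F (x b) - F (x a) ≤ k * (b - a) := by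
  have hac := hx.1 a ⟨le_rfl, hab⟩ b ⟨hab, le_rfl⟩
  obtain ⟨C, hC⟩ := hac.exists_bound
  obtain ⟨K, hK⟩ := (hF.contDiffOn (s := Metric.closedBall (0 : ι → ℝ) C)).exists_lipschitzOnWith
    (by decide) (convex_closedBall _ _) (isCompact_closedBall _ _)
  have hac' : AbsolutelyContinuousOnInterval (fun t => F (x t)) a b := by
    refine AbsolutelyContinuousOnInterval.comp_of_lipschitzOnWith (hK.mono ?_) hac
    rintro _ ⟨t, ht, rfl⟩
    simpa using hC t ht
  refine hac'.sub_le_of_ae_deriv_le hab ?_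
  filter_upwards [hx.2] with t ht htI
  obtain ⟨v, hv, hd⟩ := ht (Set.Ioo_subset_Icc_self htI)
  have := ((hF.differentiable (by decide)) (x t)).hasFDerivAt.comp_hasDerivAt t hd
  exact this.deriv.trans_le (h t htI v hv)

theorem IsFilippovSolution.lipschitzOnWith {x : ℝ → ι → ℝ} {a b : ℝ} {M : NNReal}
    (hx : IsFilippovSolution f (Set.Icc a b) x)
    (h : ∀ t ∈ Set.Icc a b, ∀ v ∈ filippovSet f (x t), ‖v‖ ≤ M) :
    LipschitzOnWith M x (Set.Icc a b) := by
  refine LipschitzOnWith.of_dist_le_mul fun s hs t ht => ?_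
  wlog hst : s ≤ t generalizing s t
  · rw [dist_comm, dist_comm s t]
    exact this t ht s hs (le_of_not_ge hst)
  have hsub : Set.Icc s t ⊆ Set.Icc a b := Set.Icc_subset_Icc hs.1 ht.2
  have key : ∀ (i : ι) (c : ℝ), |c| = 1 → c * x t i - c * x s i ≤ M * (t - s) := by
    intro i c hc
    have hl : (fun y : ι → ℝ => c * y i) =
      ⇑(c • ContinuousLinearMap.proj (R := ℝ) (φ := fun _ : ι => ℝ) i) := by ext; simp
    refine IsFilippovSolution.comp_sub_le (F := fun y => c * y i) hst (hx.mono hsub)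
      (by fun_prop) ?_
    intro r hr v hv
    rw [hl, ContinuousLinearMap.fderiv]
    have h1 := h r (hsub (Set.Ioo_subset_Icc_self hr)) v hv
    have h2 := (norm_le_pi_norm v i).trans h1
    have h3 : |c * v i| ≤ M := by rw [abs_mul, hc, one_mul]; exact h2
    simpa using (le_abs_self _).trans h3
  rw [Real.dist_eq, abs_of_nonpos (by linarith), dist_pi_le_iff (by
    have : 0 ≤ -(s - t) := by linarith
    positivity)]
  intro i
  rw [Real.dist_eq, abs_le]
  have h1 := key i 1 (by simp)
  have h2 := key i (-1) (by simp)
  constructor <;> linarith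

theorem IsFilippovSolution.exists_lipschitzOnWith {x : ℝ → ι → ℝ} {a b R : ℝ}
    (hbd : ∀ R : ℝ, ∃ M : ℝ, ∀ x : ι → ℝ, ‖x‖ ≤ R → ‖f x‖ ≤ M)
    (hx : IsFilippovSolution f (Set.Icc a b) x) (hR : ∀ t ∈ Set.Icc a b, ‖x t‖ ≤ R) :
    LipschitzOnWith ((hbd (R + 1)).choose.toNNReal) x (Set.Icc a b) := by
  refine hx.lipschitzOnWith fun t ht v hv => ?_
  refine filippovSet_norm_le ?_ hv
  filter_upwards [Metric.ball_mem_nhds (x t) one_pos] with y hy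
  refine ((hbd (R + 1)).choose_spec y ?_).trans (Real.le_coe_toNNReal _)
  have := norm_sub_le_of_le (le_refl ‖y - x t‖) (hR t ht)
  have h2 : ‖y‖ ≤ ‖y - x t‖ + ‖x t‖ := by simpa using norm_add_le (y - x t) (x t)
  have h3 : ‖y - x t‖ < 1 := by simpa [dist_eq_norm] using hy
  linarith [hR t ht]

/-- The almost everywhere derivative of `l ∘ x` agrees with a continuous function of time, so the
integral formula upgrades it to a derivative at every time. -/
theorem IsFilippovSolution.hasDerivAt_comp {x : ℝ → ι → ℝ} {a b : ℝ}
    (hx : IsFilippovSolution f (Set.Ioo a b) x) (l : (ι → ℝ) →L[ℝ] ℝ)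
    (hc : ∀ t ∈ Set.Ioo a b, ContinuousAt (fun y => l (f y)) (x t)) {t : ℝ}
    (ht : t ∈ Set.Ioo a b) : HasDerivAt (fun s => l (x s)) (l (f (x t))) t := by
  obtain ⟨a', ha', hat⟩ := exists_between ht.1
  obtain ⟨b', hbt, hb'⟩ := exists_between ht.2
  have hab : a' ≤ b' := (hat.trans hbt).le
  have hsub : Set.Icc a' b' ⊆ Set.Ioo a b := fun s hs => ⟨ha'.trans_le hs.1, hs.2.trans_lt hb'⟩
  have hx' := hx.mono hsub
  have hcont : ContinuousOn (fun s => l (f (x s))) (Set.Icc a' b') := by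
    intro s hs
    exact ContinuousAt.comp_continuousWithinAt (f := x) (g := fun y => l (f y))
      (hc s (hsub hs)) (hx'.continuousOn hab s hs)
  have hac : AbsolutelyContinuousOnInterval (fun s => l (x s)) a' b' :=
    AbsolutelyContinuousOnInterval.comp_of_lipschitzOnWith
      (l.lipschitz.lipschitzOnWith) (hx'.1 a' ⟨le_rfl, hab⟩ b' ⟨hab, le_rfl⟩)
  have hint : ∀ s ∈ Set.Icc a' b', l (x s) = l (x a') + ∫ r in a'..s, l (f (x r)) := by
    intro s hs
    have h1 := (hac.mono (c := a') (d := s) (by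
      rw [Set.uIcc_of_le hs.1, Set.uIcc_of_le hab]
      exact Set.Icc_subset_Icc_right hs.2)).integral_deriv_eq_sub
    have h2 : ∫ r in a'..s, deriv (fun s => l (x s)) r = ∫ r in a'..s, l (f (x r)) := by
      refine intervalIntegral.integral_congr_ae ?_
      filter_upwards [hx.2] with r hr hrI
      rw [Set.uIoc_of_le hs.1] at hrI
      have hrI' : r ∈ Set.Ioo a b := hsub ⟨hrI.1.le, hrI.2.trans hs.2⟩
      obtain ⟨v, hv, hd⟩ := hr hrI'
      have h3 := l.hasFDerivAt.comp_hasDerivAt r hd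
      have h4 : deriv (fun s => l (x s)) r = l v := h3.deriv
      rw [h4, filippovSet_apply_eq l (hc r hrI') hv]
    rw [← h2, h1]; ring
  have hcat : ContinuousAt (fun s => l (f (x s))) t := hcont.continuousAt (Icc_mem_nhds hat hbt)
  have hI : IntervalIntegrable (fun s => l (f (x s))) volume a' t :=
    (hcont.mono (by rw [Set.uIcc_of_le hat.le]; exact Set.Icc_subset_Icc_right hbt.le)).intervalIntegrable
  have hmeas : StronglyMeasurableAtFilter (fun s => l (f (x s))) (𝓝 t) volume :=
    (hcont.mono Set.Ioo_subset_Icc_self).stronglyMeasurableAtFilter isOpen_Ioo t ⟨hat, hbt⟩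
  have h5 := (intervalIntegral.integral_hasDerivAt_right hI hmeas hcat).const_add (l (x a'))
  refine h5.congr_of_eventuallyEq ?_
  filter_upwards [Icc_mem_nhds hat hbt] with s hs
  exact hint s hs

end Filippov

section Existence
variable {ι : Type*} [Fintype ι]

/-- Mollification: values of the smooth approximation are averages of nearby values. -/
theorem exists_contDiff_average {f : (ι → ℝ) → (ι → ℝ)} (hf : AEStronglyMeasurable f volume)
    {L ε : ℝ} (hL : ∀ x, ‖f x‖ ≤ L) (hε : 0 < ε) :
    ∃ g : (ι → ℝ) → (ι → ℝ), ContDiff ℝ 1 g ∧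
      ∀ (x : ι → ℝ) (K : Set (ι → ℝ)), Convex ℝ K → IsClosed K →
        (∀ᵐ y, dist y x < ε → f y ∈ K) → g x ∈ K := by
  let φ : ContDiffBump (0 : ι → ℝ) := ⟨ε / 2, ε, by linarith, by linarith⟩
  have hloc : LocallyIntegrable f volume := by
    refine (locallyIntegrable_iff).2 fun k hk => ?_
    exact Measure.integrableOn_of_bounded (M := L) hk.measure_lt_top.ne hf
      (ae_of_all _ fun x => hL x)
  refine ⟨convolution (φ.normed volume) f (ContinuousLinearMap.lsmul ℝ ℝ) volume, ?_, ?_⟩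
  · exact (φ.hasCompactSupport_normed).contDiff_convolution_left _ (n := 1) φ.contDiff_normed hloc
  intro x K hK hKc hae
  set ρ : (ι → ℝ) → NNReal := fun t => (φ.normed volume t).toNNReal with hρ
  have hρm : Measurable ρ := (φ.continuous_normed (μ := volume)).measurable.real_toNNReal
  set μ : Measure (ι → ℝ) := volume.withDensity (fun t => (ρ t : ENNReal)) with hμ
  have hprob : IsProbabilityMeasure μ := by
    constructor
    rw [hμ, withDensity_apply _ MeasurableSet.univ, Measure.restrict_univ]
    have h1 := φ.integral_normed (μ := volume)
    rw [integral_eq_lintegral_of_nonneg_ae (ae_of_all _ φ.nonneg_normed)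
      φ.continuous_normed.aestronglyMeasurable] at h1
    rwa [ENNReal.toReal_eq_one_iff] at h1
  have heq : convolution (φ.normed volume) f (ContinuousLinearMap.lsmul ℝ ℝ) volume x
      = ∫ t, f (x - t) ∂μ := by
    rw [hμ, integral_withDensity_eq_integral_smul hρm]
    refine integral_congr_ae (ae_of_all _ fun t => ?_)
    simp [hρ, NNReal.smul_def, φ.nonneg_normed t]
  have hmp : MeasurePreserving (fun t : ι → ℝ => x - t) volume volume :=
    Measure.measurePreserving_sub_left volume x
  rw [heq]
  refine hK.integral_mem hKc ?_ ?_
  · rw [hμ, ae_withDensity_iff (by fun_prop)]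
    filter_upwards [hmp.quasiMeasurePreserving.ae hae] with t ht h0
    apply ht
    have : t ∈ Function.support (φ.normed volume) := by
      intro h; apply h0; simp [hρ, h]
    rw [φ.support_normed_eq] at this
    simpa [φ] using this
  · refine Integrable.of_bound (C := L) ?_ (ae_of_all _ fun t => hL _)
    exact (hf.comp_measurePreserving hmp).mono_ac (withDensity_absolutelyContinuous _ _)

/-- A global bound `L` confines solutions to the ball of radius `L * T`, so Picard–Lindelöf on that
ball reaches time `T` in a single step. -/
theorem exists_solution_of_contDiff_of_bounded {g : (ι → ℝ) → (ι → ℝ)} (hg : ContDiff ℝ 1 g)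
    {L : ℝ} (hL : ∀ x, ‖g x‖ ≤ L) {T : ℝ} (hT : 0 ≤ T) (x₀ : ι → ℝ) :
    ∃ x : ℝ → ι → ℝ, x 0 = x₀ ∧
      ∀ t ∈ Set.Icc 0 T, HasDerivWithinAt x (g (x t)) (Set.Icc 0 T) t := by
  have hL0 : 0 ≤ L := (norm_nonneg _).trans (hL 0)
  let a : NNReal := (L * T).toNNReal
  obtain ⟨K, hK⟩ := (hg.contDiffOn (s := Metric.closedBall x₀ a)).exists_lipschitzOnWith
    (by decide) (convex_closedBall _ _) (isCompact_closedBall _ _)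
  have hp : IsPicardLindelof (fun _ => g) (tmin := 0) (tmax := T) ⟨0, le_rfl, hT⟩ x₀ a 0
      L.toNNReal K :=
    { lipschitzOnWith := fun t _ => hK
      continuousOn := fun x _ => continuousOn_const
      norm_le := fun t _ x _ => (hL x).trans (Real.le_coe_toNNReal _)
      mul_max_le := by simp [a, hT, hL0, mul_nonneg] }
  exact hp.exists_eq_forall_mem_Icc_hasDerivWithinAt₀

/-- The difference quotient is the mean of the velocity over the interval, and means stay in closed
convex sets. -/
theorem slope_mem_of_hasDerivAt {x : ℝ → ι → ℝ} {v : ℝ → ι → ℝ} {t h : ℝ} (hh : 0 < h)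
    {K : Set (ι → ℝ)} (hK : Convex ℝ K) (hKc : IsClosed K)
    (hx : ∀ s ∈ Set.Icc t (t + h), HasDerivAt x (v s) s)
    (hv : ContinuousOn v (Set.Icc t (t + h))) (hvK : ∀ s ∈ Set.Icc t (t + h), v s ∈ K) :
    h⁻¹ • (x (t + h) - x t) ∈ K := by
  have hle : t ≤ t + h := by linarith
  have h1 : ∫ s in t..(t + h), v s = x (t + h) - x t := by
    refine intervalIntegral.integral_eq_sub_of_hasDerivAt (fun s hs => hx s ?_) ?_
    · rwa [Set.uIcc_of_le hle] at hs
    · exact (by rwa [Set.uIcc_of_le hle] : ContinuousOn v (Set.uIcc t (t + h))).intervalIntegrable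
  have h2 := hK.set_average_mem (μ := volume) (t := Set.Ioc t (t + h)) (f := v) hKc
    (by simp [hh]) (by simp)
    ((ae_restrict_iff' measurableSet_Ioc).2
      (ae_of_all _ fun s hs => hvK s (Set.Ioc_subset_Icc_self hs)))
    (hv.integrableOn_Icc.mono_set Set.Ioc_subset_Icc_self)
  rw [setAverage_eq, ← intervalIntegral.integral_of_le hle, h1] at h2
  simpa [hh.le] using h2

/-- Truncate `f` to the ball of radius $n$, mollify at scale $1/(n+1)$, solve on $[0,n]$, and take
limits along an ultrafilter, which exist at all times at once. The proper function `F` keeps the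
approximations bounded. In `hFk` the field is taken at a nearby point `y` because the mollified
velocity at `x` is an average of values around `x`. -/
theorem exists_isFilippovSolution {f : (ι → ℝ) → (ι → ℝ)} (hf : AEStronglyMeasurable f volume)
    (hbd : ∀ R : ℝ, ∃ M : ℝ, ∀ x : ι → ℝ, ‖x‖ ≤ R → ‖f x‖ ≤ M)
    {F : (ι → ℝ) → ℝ} (hF : ContDiff ℝ 1 F) {k : ℝ} (hk : 0 ≤ k)
    (hFk : ∀ x y, dist y x < 1 → fderiv ℝ F x (f y) ≤ k)
    (hprop : ∀ c : ℝ, ∃ R : ℝ, ∀ x, F x ≤ c → ‖x‖ ≤ R) (x₀ : ι → ℝ) :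
    ∃ x : ℝ → ι → ℝ, IsFilippovSolution f (Set.Ici 0) x ∧ x 0 = x₀ := by
  have hbd' : ∀ R : ℝ, ∃ M : NNReal, ∀ x : ι → ℝ, ‖x‖ ≤ R → ‖f x‖ ≤ M := fun R => by
    obtain ⟨M, hM⟩ := hbd R
    exact ⟨M.toNNReal, fun x hx => (hM x hx).trans (Real.le_coe_toNNReal _)⟩
  choose M hM using hbd'
  choose R hR using hprop
  set f₀ : ℕ → (ι → ℝ) → (ι → ℝ) := fun n => (Metric.ball 0 (n : ℝ)).indicator f with hf₀
  have hf₀L : ∀ n x, ‖f₀ n x‖ ≤ M n := by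
    intro n x
    by_cases hx : x ∈ Metric.ball (0 : ι → ℝ) (n : ℝ)
    · simp only [hf₀, Set.indicator_of_mem hx]
      exact hM _ _ (by simpa using (Metric.mem_ball.1 hx).le)
    · simp [hf₀, Set.indicator_of_notMem hx]
  have hε : ∀ n : ℕ, (0 : ℝ) < 1 / (n + 1) := fun n => by positivity
  have hε1 : ∀ n : ℕ, (1 : ℝ) / (n + 1) ≤ 1 := fun n => by
    rw [div_le_one (by positivity)]; simp
  choose g hg hgK using fun n => exists_contDiff_average (hf.indicator measurableSet_ball)
    (hf₀L n) (hε n)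
  have hgL : ∀ n x, ‖g n x‖ ≤ M n := by
    intro n x
    have := hgK n x (Metric.closedBall 0 (M n)) (convex_closedBall _ _)
      Metric.isClosed_closedBall (ae_of_all _ fun y _ => by simpa using hf₀L n y)
    simpa using this
  choose x hx0 hxd using fun n : ℕ => exists_solution_of_contDiff_of_bounded (hg n) (hgL n)
    (Nat.cast_nonneg n) x₀
  have hxd' : ∀ (n : ℕ) (t : ℝ), 0 < t → t < n → HasDerivAt (x n) (g n (x n t)) t :=
    fun n t h0 h1 => (hxd n t ⟨h0.le, h1.le⟩).hasDerivAt (Icc_mem_nhds h0 h1)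
  have hxc : ∀ n : ℕ, ContinuousOn (x n) (Set.Icc 0 n) := fun n t ht =>
    (hxd n t ht).continuousWithinAt
  -- a priori bound
  have hFx : ∀ (n : ℕ) (t : ℝ), 0 ≤ t → t ≤ n → F (x n t) ≤ F x₀ + k * t := by
    intro n t h0 h1
    have hsub : Set.Icc 0 t ⊆ Set.Icc 0 (n : ℝ) := Set.Icc_subset_Icc_right h1
    have hd : ∀ s ∈ Set.Ioo 0 t, HasDerivAt (fun s => F (x n s))
        (fderiv ℝ F (x n s) (g n (x n s))) s := fun s hs =>
      ((hF.differentiable (by decide)) (x n s)).hasFDerivAt.comp_hasDerivAt s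
        (hxd' n s hs.1 (hs.2.trans_le h1))
    have := (convex_Icc (0 : ℝ) t).image_sub_le_mul_sub_of_deriv_le (f := fun s => F (x n s))
      (C := k) (hF.continuous.comp_continuousOn ((hxc n).mono hsub))
      (by
        rw [interior_Icc]
        exact fun s hs => (hd s hs).differentiableAt.differentiableWithinAt)
      (by
        rw [interior_Icc]
        intro s hs
        rw [(hd s hs).deriv]
        refine hgK n (x n s) {v | fderiv ℝ F (x n s) v ≤ k}
          (convex_halfSpace_le (fderiv ℝ F (x n s)).isLinear _)
          (isClosed_le (fderiv ℝ F (x n s)).continuous continuous_const) ?_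
        refine ae_of_all _ fun y hy => ?_
        by_cases hyb : y ∈ Metric.ball (0 : ι → ℝ) (n : ℝ)
        · rw [Set.indicator_of_mem hyb]
          exact hFk _ _ (hy.trans_le (hε1 n))
        · rw [Set.indicator_of_notMem hyb]
          simpa using hk)
      0 ⟨le_rfl, h0⟩ t ⟨h0, le_rfl⟩ h0
    simp only [hx0] at this
    linarith
  set B : ℝ → ℝ := fun T => R (F x₀ + k * T) with hB
  have hxB : ∀ (T : ℝ) (n : ℕ), T ≤ n → ∀ t ∈ Set.Icc 0 T, ‖x n t‖ ≤ B T := by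
    intro T n hn t ht
    refine hR _ _ ((hFx n t ht.1 (ht.2.trans hn)).trans ?_)
    have := mul_le_mul_of_nonneg_left ht.2 hk
    linarith
  have hxL : ∀ (T : ℝ) (n : ℕ), T ≤ n → LipschitzOnWith (M (B T + 1)) (x n) (Set.Icc 0 T) := by
    intro T n hn
    refine (convex_Icc (0 : ℝ) T).lipschitzOnWith_of_nnnorm_hasDerivWithin_le
      (f' := fun t => g n (x n t)) (fun t ht =>
        (hxd n t ⟨ht.1, ht.2.trans hn⟩).mono (Set.Icc_subset_Icc_right hn)) fun t ht => ?_
    have := hgK n (x n t) (Metric.closedBall 0 (M (B T + 1))) (convex_closedBall _ _)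
      Metric.isClosed_closedBall (ae_of_all _ fun y hy => ?_)
    · rw [← NNReal.coe_le_coe]
      simpa using this
    · by_cases hyb : y ∈ Metric.ball (0 : ι → ℝ) (n : ℝ)
      · rw [Set.indicator_of_mem hyb]
        have h1 := hM (B T + 1) y (by
          have h2 : ‖y‖ ≤ ‖y - x n t‖ + ‖x n t‖ := by simpa using norm_add_le (y - x n t) (x n t)
          have h3 : ‖y - x n t‖ < 1 := by
            rw [← dist_eq_norm]; exact hy.trans_le (hε1 n)
          linarith [hxB T n hn t ht])
        simpa using h1
      · rw [Set.indicator_of_notMem hyb]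
        simp
  -- the limit along an ultrafilter
  let U : Ultrafilter ℕ := hyperfilter ℕ
  have hU : (U : Filter ℕ) ≤ atTop := Nat.hyperfilter_le_atTop
  have hge : ∀ T : ℝ, ∀ᶠ n : ℕ in U, T ≤ n := fun T =>
    hU ((tendsto_natCast_atTop_atTop (R := ℝ)).eventually_ge_atTop T)
  have hlim : ∀ t : ℝ, ∃ p : ι → ℝ, 0 ≤ t → Tendsto (fun n => x n t) U (𝓝 p) := by
    intro t
    by_cases ht : 0 ≤ t
    · obtain ⟨p, -, hp⟩ := (isCompact_closedBall (0 : ι → ℝ) (B t)).ultrafilter_le_nhds'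
        (U.map fun n => x n t) (by
          refine Ultrafilter.mem_map.2 ?_
          filter_upwards [hge t] with n hn
          simpa using hxB t n hn t ⟨ht, le_rfl⟩)
      exact ⟨p, fun _ => hp⟩
    · exact ⟨0, fun h => absurd h ht⟩
  choose X hX using hlim
  have hXL : ∀ T, LipschitzOnWith (M (B T + 1)) X (Set.Icc 0 T) := by
    intro T
    refine LipschitzOnWith.of_dist_le_mul fun s hs t ht => ?_
    refine le_of_tendsto ((hX s hs.1).dist (hX t ht.1)) ?_
    filter_upwards [hge T] with n hn
    exact (hxL T n hn).dist_le_mul s hs t ht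
  have hac : ∀ a ∈ Set.Ici (0 : ℝ), ∀ b ∈ Set.Ici (0 : ℝ), AbsolutelyContinuousOnInterval X a b := by
    intro a ha b hb
    refine (LipschitzOnWith.mono (hXL (max a b)) ?_).absolutelyContinuousOnInterval
    exact Set.Icc_subset_Icc_left (le_min ha hb)
  have hdiff : ∀ᵐ t, t ∈ Set.Ici (0 : ℝ) → DifferentiableAt ℝ X t := by
    have h1 : ∀ (i : ι) (n : ℕ), ∀ᵐ t, t ∈ Set.uIcc 0 (n : ℝ) →
        DifferentiableAt ℝ (fun s => X s i) t := by
      intro i n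
      exact (AbsolutelyContinuousOnInterval.comp_of_lipschitzOnWith (F := fun y : ι → ℝ => y i)
        ((LipschitzWith.eval i).lipschitzOnWith) (hac 0 (by simp) n (by simp))).ae_differentiableAt
    have h2 := ae_all_iff.2 fun i => ae_all_iff.2 (h1 i)
    filter_upwards [h2] with t ht h0
    obtain ⟨n, hn⟩ := exists_nat_ge t
    exact differentiableAt_pi.2 fun i => ht i n (by
      rw [Set.uIcc_of_le (Nat.cast_nonneg n)]; exact ⟨h0, hn⟩)
  have hne0 : ∀ᵐ t : ℝ, t ≠ 0 := by
    simp [ae_iff]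
  refine ⟨X, ⟨hac, ?_⟩, ?_⟩
  swap
  · refine tendsto_nhds_unique (hX 0 le_rfl) ?_
    simp only [hx0]
    exact tendsto_const_nhds
  filter_upwards [hdiff, hne0] with t ht ht0 htI
  have ht' : 0 < t := lt_of_le_of_ne htI (Ne.symm ht0)
  refine ⟨deriv X t, ?_, (ht htI).hasDerivAt⟩
  simp only [filippovSet, Set.mem_iInter]
  intro δ hδ N hN
  set K : Set (ι → ℝ) := closure (convexHull ℝ (f '' (Metric.ball (X t) δ \ N))) with hKdef
  have hK : Convex ℝ K := (convex_convexHull ℝ _).closure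
  have hKc : IsClosed K := isClosed_closure
  set C : ℝ := (M (B (t + 1) + 1) : ℝ) with hC
  have hC0 : 0 ≤ C := NNReal.coe_nonneg _
  have hslope : Tendsto (fun h : ℝ => h⁻¹ • (X (t + h) - X t)) (𝓝[>] 0) (𝓝 (deriv X t)) :=
    (ht htI).hasDerivAt.tendsto_slope_zero_right
  refine hKc.mem_of_tendsto hslope ?_
  -- Three distances of at most $\delta/4$ must add up to less than $\delta$: the motion of $x_n$
  -- during time $h$, the gap between $x_n(t)$ and its limit, and the mollification radius. This
  -- choice handles the first one; `hcl` and `hsm` handle the others.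
  set η : ℝ := min 1 (δ / (4 * (C + 1))) with hη
  have hη0 : 0 < η := by positivity
  filter_upwards [Ioo_mem_nhdsGT hη0] with h hh
  have hh1 : h ≤ 1 := hh.2.le.trans (min_le_left _ _)
  have hCh : C * h ≤ δ / 4 := by
    have h1 : h ≤ δ / (4 * (C + 1)) := hh.2.le.trans (min_le_right _ _)
    have h2 : h * (4 * (C + 1)) ≤ δ := (le_div_iff₀ (by positivity)).1 h1
    nlinarith [hh.1]
  refine hKc.mem_of_tendsto (((hX (t + h) (by linarith [hh.1])).sub
    (hX t htI)).const_smul h⁻¹) ?_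
  have hcl : ∀ᶠ n in U, dist (x n t) (X t) < δ / 4 :=
    (hX t htI) (Metric.ball_mem_nhds _ (by positivity))
  have hsm : ∀ᶠ n : ℕ in U, 1 / ((n : ℝ) + 1) < δ / 4 :=
    hU (tendsto_one_div_add_atTop_nhds_zero_nat.eventually_lt_const (by positivity))
  filter_upwards [hcl, hsm, hge (t + 2), hge (B (t + 1) + 1)] with n hn1 hn2 hn3 hn4
  have hsI : ∀ s ∈ Set.Icc t (t + h), s ∈ Set.Icc 0 (t + 1) := fun s hs =>
    ⟨ht'.le.trans hs.1, by linarith [hs.2]⟩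
  have hder : ∀ s ∈ Set.Icc t (t + h), HasDerivAt (x n) (g n (x n s)) s := fun s hs =>
    hxd' n s (ht'.trans_le hs.1) (by linarith [hs.2])
  refine slope_mem_of_hasDerivAt hh.1 hK hKc hder ?_ ?_
  · exact (hg n).continuous.comp_continuousOn fun s hs => (hder s hs).continuousAt.continuousWithinAt
  intro s hs
  refine hgK n (x n s) K hK hKc ?_
  -- Averages do not see the null set `N`; this is why the limit velocity lies in the regularization
  -- with null sets removed.
  have hNae : ∀ᵐ y, y ∉ N := measure_eq_zero_iff_ae_notMem.1 hN
  filter_upwards [hNae] with y hyN hy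
  have hlip := (hxL (t + 1) n (by linarith)).dist_le_mul s (hsI s hs) t ⟨htI, by linarith⟩
  have hst : dist s t ≤ h := by
    rw [Real.dist_eq, abs_of_nonneg (by linarith [hs.1])]; linarith [hs.2]
  have hd1 : dist (x n s) (x n t) ≤ δ / 4 :=
    (hlip.trans (mul_le_mul_of_nonneg_left hst hC0)).trans hCh
  have hyX : dist y (X t) < δ := by
    have e1 := dist_triangle y (x n s) (X t)
    have e2 := dist_triangle (x n s) (x n t) (X t)
    linarith
  have hyb : y ∈ Metric.ball (0 : ι → ℝ) (n : ℝ) := by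
    rw [mem_ball_zero_iff]
    have h2 : ‖y‖ ≤ ‖y - x n s‖ + ‖x n s‖ := by simpa using norm_add_le (y - x n s) (x n s)
    have h3 : ‖y - x n s‖ < 1 := by rw [← dist_eq_norm]; exact hy.trans_le (hε1 n)
    linarith [hxB (t + 1) n (by linarith) s (hsI s hs)]
  rw [Set.indicator_of_mem hyb]
  exact subset_closure (subset_convexHull ℝ _ ⟨y, ⟨hyX, hyN⟩, rfl⟩)

/-- A bounded solution on `[0, b)` extends to `[0, ∞)`. -/
theorem IsFilippovSolution.exists_extension {f : (ι → ℝ) → (ι → ℝ)}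
    (hbd : ∀ R : ℝ, ∃ M : ℝ, ∀ x : ι → ℝ, ‖x‖ ≤ R → ‖f x‖ ≤ M)
    (hex : ∀ x₀ : ι → ℝ, ∃ x : ℝ → ι → ℝ, IsFilippovSolution f (Set.Ici 0) x ∧ x 0 = x₀)
    {b R : ℝ} {x : ℝ → ι → ℝ} (hx : IsFilippovSolution f (Set.Ico 0 b) x)
    (hR : ∀ t ∈ Set.Ico 0 b, ‖x t‖ ≤ R) :
    ∃ y : ℝ → ι → ℝ, IsFilippovSolution f (Set.Ici 0) y ∧ Set.EqOn y x (Set.Ico 0 b) := by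
  set L := (hbd (R + 1)).choose.toNNReal with hL
  have hlip : LipschitzOnWith L x (Set.Ico 0 b) := by
    refine LipschitzOnWith.of_dist_le_mul fun s hs t ht => ?_
    have hsub : Set.Icc 0 (max s t) ⊆ Set.Ico 0 b := fun r hr =>
      ⟨hr.1, hr.2.trans_lt (max_lt hs.2 ht.2)⟩
    exact ((hx.mono hsub).exists_lipschitzOnWith hbd fun r hr => hR r (hsub hr)).dist_le_mul s
      ⟨hs.1, le_max_left _ _⟩ t ⟨ht.1, le_max_right _ _⟩
  -- The Lipschitz extension supplies the missing end value at `b`, from which a new solution is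
  -- glued on.
  obtain ⟨g, hg, hgx⟩ := hlip.extend_pi
  obtain ⟨z, hz, hz0⟩ := hex (g b)
  set y : ℝ → ι → ℝ := fun t => if t < b then g t else z (t - b) with hy
  have hyg : Set.EqOn y g (Set.Icc 0 b) := by
    intro t ht
    rcases ht.2.lt_or_eq with h | h
    · simp [hy, h]
    · simp [hy, h, hz0]
  have hyx : Set.EqOn y x (Set.Ico 0 b) := fun t ht =>
    (hyg (Set.Ico_subset_Icc_self ht)).trans (hgx ht).symm
  have hyz : ∀ t, b ≤ t → y t = z (t - b) := fun t ht => by simp [hy, not_lt.2 ht]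
  refine ⟨y, ⟨?_, ?_⟩, hyx⟩
  · have hyL : ∀ c, b ≤ c → ∃ K, LipschitzOnWith K y (Set.Icc 0 c) := by
      intro c hc
      have hzc : IsFilippovSolution f (Set.Icc 0 (c - b)) z := hz.mono fun r hr => hr.1
      obtain ⟨Z, hZ⟩ := (hz.1 0 (by simp) (c - b) (by simpa using hc)).exists_bound
      rw [Set.uIcc_of_le (by linarith)] at hZ
      have h1 := hzc.exists_lipschitzOnWith hbd hZ
      set K' := (hbd (Z + 1)).choose.toNNReal
      refine ⟨max L K', LipschitzOnWith.Icc_union_Icc (b := b) ?_ ?_⟩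
      · refine LipschitzOnWith.of_dist_le_mul fun s hs t ht => ?_
        rw [hyg hs, hyg ht]
        refine (hg.dist_le_mul s t).trans ?_
        gcongr
        exact le_max_left _ _
      · refine LipschitzOnWith.of_dist_le_mul fun s hs t ht => ?_
        rw [hyz s hs.1, hyz t ht.1]
        refine (h1.dist_le_mul (s - b) ⟨by linarith [hs.1], by linarith [hs.2]⟩ (t - b)
          ⟨by linarith [ht.1], by linarith [ht.2]⟩).trans ?_
        rw [dist_sub_right]
        gcongr
        exact le_max_right _ _
    intro s hs t ht
    obtain ⟨K, hK⟩ := hyL (max b (max s t)) (le_max_left _ _)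
    refine (hK.mono ?_).absolutelyContinuousOnInterval
    exact Set.Icc_subset_Icc (le_min hs ht) (le_max_right _ _)
  · have h0 : ∀ᵐ t : ℝ, t ≠ 0 := by simp [ae_iff]
    have hb' : ∀ᵐ t : ℝ, t ≠ b := by simp [ae_iff]
    filter_upwards [hx.2, (measurePreserving_sub_right volume b).quasiMeasurePreserving.ae hz.2,
      h0, hb'] with t h1 h2 h3 h4 htI
    rcases lt_or_ge t b with h | h
    · obtain ⟨v, hv, hd⟩ := h1 ⟨htI, h⟩
      refine ⟨v, by rwa [hyx ⟨htI, h⟩], hd.congr_of_eventuallyEq ?_⟩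
      filter_upwards [Ioo_mem_nhds (lt_of_le_of_ne htI (Ne.symm h3)) h] with s hs
      exact hyx ⟨hs.1.le, hs.2⟩
    · obtain ⟨v, hv, hd⟩ := h2 (by simpa using h)
      refine ⟨v, by rwa [hyz t h], (hd.comp_sub_const t b).congr_of_eventuallyEq ?_⟩
      filter_upwards [Ioi_mem_nhds (lt_of_le_of_ne h (Ne.symm h4))] with s hs
      exact hyz s (le_of_lt hs)

end Existence

/-! ### Left eigenvectors and the matrix exponential -/

section Exp
variable {ι κ : Type*} [Fintype ι] [DecidableEq ι]

/-- On a left eigenrow the exponential series becomes scalar. Matrix identities involving $e^{sG}$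
are later checked on such rows, so no exponential has to be computed. -/
theorem mul_exp_of_mul_eq_smul {X : Matrix ι ι ℝ} {R : Matrix κ ι ℝ} {c : ℝ} (h : R * X = c • R) :
    R * NormedSpace.exp X = Real.exp c • R := by
  let _ : NormedRing (Matrix ι ι ℝ) := Matrix.linftyOpNormedRing
  let _ : NormedAlgebra ℝ (Matrix ι ι ℝ) := Matrix.linftyOpNormedAlgebra
  have hpow : ∀ m : ℕ, R * X ^ m = c ^ m • R := by
    intro m
    induction m with
    | zero => simp
    | succ m ih => rw [pow_succ, ← Matrix.mul_assoc, ih, Matrix.smul_mul, h, smul_smul, pow_succ]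
  let φ : Matrix ι ι ℝ →+ Matrix κ ι ℝ :=
    { toFun := fun Y => R * Y, map_zero' := by simp, map_add' := fun a b => Matrix.mul_add R a b }
  have h1 : HasSum (fun m : ℕ => R * ((m.factorial⁻¹ : ℝ) • X ^ m)) (R * NormedSpace.exp X) :=
    (NormedSpace.exp_series_hasSum_exp' (𝕂 := ℝ) X).map φ (continuous_const.matrix_mul continuous_id)
  have h2 : HasSum (fun m : ℕ => R * ((m.factorial⁻¹ : ℝ) • X ^ m)) (Real.exp c • R) := by
    have h3 := (NormedSpace.exp_series_hasSum_exp' (𝕂 := ℝ) c).smul_const R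
    rw [← Real.exp_eq_exp_ℝ] at h3
    simpa [hpow, smul_smul] using h3
  exact h1.unique h2

theorem mul_linearGroup {X : Matrix ι ι ℝ} {R : Matrix κ ι ℝ} {c : ℝ} (h : R * X = c • R) (s : ℝ) :
    R * linearGroup X s = Real.exp (s * c) • R :=
  mul_exp_of_mul_eq_smul (by rw [Matrix.mul_smul, h, smul_smul])

theorem linearGroup_zero (X : Matrix ι ι ℝ) : linearGroup X 0 = 1 := by
  simp [linearGroup]

theorem linearGroup_add (X : Matrix ι ι ℝ) (s t : ℝ) :
    linearGroup X (s + t) = linearGroup X s * linearGroup X t := by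
  rw [linearGroup, add_smul]
  exact Matrix.exp_add_of_commute _ _ (((Commute.refl X).smul_left s).smul_right t)

theorem hasDerivAt_linearGroup_mulVec (X : Matrix ι ι ℝ) (z : ι → ℝ) (s : ℝ) :
    HasDerivAt (fun s => linearGroup X s *ᵥ z) (X *ᵥ (linearGroup X s *ᵥ z)) s := by
  let _ : NormedRing (Matrix ι ι ℝ) := Matrix.linftyOpNormedRing
  let _ : NormedAlgebra ℝ (Matrix ι ι ℝ) := Matrix.linftyOpNormedAlgebra
  have h := hasDerivAt_exp_smul_const' (𝕂 := ℝ) X s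
  let l : Matrix ι ι ℝ →L[ℝ] (ι → ℝ) :=
    LinearMap.toContinuousLinearMap ((Matrix.mulVecBilin ℝ ℝ).flip z)
  have h1 := l.hasFDerivAt.comp_hasDerivAt s h
  rw [Matrix.mulVec_mulVec]
  exact h1

/-- Seen through the injective matrix `O`, the group is a diagonal scaling with positive weights,
and `B` pulls this back. `O` need not be square, so this is more general than diagonalization in a
basis. -/
theorem isLinearDilation_of_eigen {J : Type*} [Fintype J] [DecidableEq J]
    {d : ℝ → Matrix ι ι ℝ} {O : Matrix J ι ℝ} {B : Matrix ι J ℝ} (hB : B * O = 1) {w : J → ℝ}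
    (hw : ∀ j, 0 < w j)
    (hd : ∀ s, O * d s = Matrix.diagonal (fun j => Real.exp (s * w j)) * O) :
    IsLinearDilation d := by
  have hd' : ∀ s, d s = B * (Matrix.diagonal (fun j => Real.exp (s * w j)) * O) := fun s => by
    rw [← hd, ← Matrix.mul_assoc, hB, Matrix.one_mul]
  have hOd : ∀ s x j, (O *ᵥ (d s *ᵥ x)) j = Real.exp (s * w j) * (O *ᵥ x) j := by
    intro s x j
    rw [Matrix.mulVec_mulVec, hd, ← Matrix.mulVec_mulVec, Matrix.mulVec_diagonal]
  have hinj : ∀ x, O *ᵥ x = 0 → x = 0 := fun x hx => by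
    rw [← Matrix.one_mulVec x, ← hB, ← Matrix.mulVec_mulVec, hx, Matrix.mulVec_zero]
  have hdx : ∀ s x, d s *ᵥ x = B *ᵥ fun j => Real.exp (s * w j) * (O *ᵥ x) j := by
    intro s x
    rw [hd', ← Matrix.mulVec_mulVec, ← Matrix.mulVec_mulVec]
    congr 1; ext j; rw [Matrix.mulVec_diagonal]
  refine ⟨?_, ?_, ?_, ?_, ?_⟩
  · rw [hd']; simp [hB]
  · intro s t
    rw [hd' (s + t), hd' s, Matrix.mul_assoc, Matrix.mul_assoc, hd t, ← Matrix.mul_assoc (diagonal _),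
      Matrix.diagonal_mul_diagonal]
    simp only [add_mul, Real.exp_add]
  · intro x
    simp only [hdx]
    exact (Continuous.matrix_mulVec continuous_const (by fun_prop))
  · intro x hx
    obtain ⟨j, hj⟩ : ∃ j, (O *ᵥ x) j ≠ 0 := by
      by_contra h
      push Not at h
      exact hx (hinj x (funext h))
    let l : (ι → ℝ) →L[ℝ] (J → ℝ) := LinearMap.toContinuousLinearMap O.mulVecLin
    have hl : ∀ s, Real.exp (s * w j) * |(O *ᵥ x) j| ≤ (‖l‖ + 1) * ‖d s *ᵥ x‖ := by
      intro s
      have h1 := l.le_opNorm (d s *ᵥ x)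
      have h2 := norm_le_pi_norm (l (d s *ᵥ x)) j
      have h3 : l (d s *ᵥ x) j = Real.exp (s * w j) * (O *ᵥ x) j := hOd s x j
      rw [h3, Real.norm_eq_abs, abs_mul, abs_of_pos (Real.exp_pos _)] at h2
      nlinarith [norm_nonneg (d s *ᵥ x)]
    have h4 : Tendsto (fun s => (Real.exp (s * w j) * |(O *ᵥ x) j|) / (‖l‖ + 1)) atTop atTop := by
      refine Tendsto.atTop_div_const (by positivity) ?_
      refine Tendsto.atTop_mul_const (abs_pos.2 hj) ?_
      exact Real.tendsto_exp_atTop.comp (tendsto_id.atTop_mul_const (hw j))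
    refine tendsto_atTop_mono (fun s => ?_) h4
    rw [div_le_iff₀ (by positivity), mul_comm]
    simpa [mul_comm] using hl s
  · intro x _
    have h1 : Tendsto (fun s => d s *ᵥ x) atBot (𝓝 (B *ᵥ 0)) := by
      simp only [hdx]
      refine ((Continuous.matrix_mulVec continuous_const continuous_id).tendsto (0 : J → ℝ)).comp ?_
      refine tendsto_pi_nhds.2 fun j => ?_
      have : Tendsto (fun s => Real.exp (s * w j)) atBot (𝓝 0) :=
        Real.tendsto_exp_atBot.comp (tendsto_id.atBot_mul_const (hw j))
      simpa using this.mul_const ((O *ᵥ x) j)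
    simpa using h1.norm

end Exp

/-! ### Graded observable pairs -/

/-- The pair `(C, A₀)` is observable with index `N` and homogeneous for the generator `Gd`: the rows
of `C * A₀ ^ m` are left eigenvectors of `Gd` with eigenvalue `1 + ν * (m + 1)`. -/
structure IsGradedPair {n k : ℕ} (C : Matrix (Fin k) (Fin n) ℝ) (A₀ Gd : Matrix (Fin n) (Fin n) ℝ)
    (ν : ℝ) (N : ℕ) : Prop where
  output : C * Gd = (1 + ν) • C
  comm : A₀ * Gd = (Gd + ν • 1) * A₀
  inj : ∀ v : Fin n → ℝ, (∀ m < N, (C * A₀ ^ m) *ᵥ v = 0) → v = 0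
  nilp : C * A₀ ^ N = 0
  weight_pos : ∀ m ≤ N, 0 < 1 + ν * (m : ℝ)
  weight_nonneg : 0 ≤ 1 + ν * ((N : ℝ) + 1)
  index_pos : 1 ≤ N
  dim_pos : 0 < k

theorem mulVec_injective_of_rank_eq {m : Type*} [Fintype m] {n : ℕ} {M : Matrix m (Fin n) ℝ}
    (h : M.rank = n) {v : Fin n → ℝ} (hv : M *ᵥ v = 0) : v = 0 := by
  have h1 := LinearMap.finrank_range_add_finrank_ker M.mulVecLin
  have h2 : Module.finrank ℝ (LinearMap.range M.mulVecLin) = n := h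
  rw [h2] at h1
  simp only [Module.finrank_fintype_fun_eq_card, Fintype.card_fin, Nat.add_eq_left] at h1
  have h3 : LinearMap.ker M.mulVecLin = ⊥ := Submodule.finrank_eq_zero.1 h1
  have : v ∈ LinearMap.ker M.mulVecLin := by simpa using hv
  rw [h3] at this
  simpa using this

/-- Everything reduces to $A_0G_0=(G_0+I)A_0$ and $CG_0=0$, which make $CA_0^m$ a left eigenrow of
$G_0$ with eigenvalue $m$. The lower bound on $\nu$ is exactly nonnegativity of the weight
$1+\nu(N+1)$. -/
theorem isGradedPair_of_observable {n k : ℕ} (hn : 0 < n)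
    {A : Matrix (Fin n) (Fin n) ℝ} {C : Matrix (Fin k) (Fin n) ℝ} {N : ℕ}
    (hN : (obsMatrix A C N).rank = n)
    {G₀ : Matrix (Fin n) (Fin n) ℝ} {Y₀ : Matrix (Fin n) (Fin k) ℝ}
    (hG₀ : A * G₀ - G₀ * A + Y₀ * C = A) (hCG₀ : C * G₀ = 0)
    {ν : ℝ} (hν : -(1 / ((N : ℝ) + 1)) ≤ ν) :
    IsGradedPair C (A + -((1 + G₀)⁻¹ * Y₀) * C) (1 + ν • (G₀ + 1)) ν N := by
  have hobs : ∀ v : Fin n → ℝ, (∀ m < N, (C * A ^ m) *ᵥ v = 0) → v = 0 := by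
    intro v hv
    refine mulVec_injective_of_rank_eq hN ?_
    ext ⟨m, i⟩
    exact congrFun (hv m m.2) i
  have hAG : A * G₀ = G₀ * A + A - Y₀ * C := by
    calc A * G₀ = G₀ * A + (A * G₀ - G₀ * A + Y₀ * C) - Y₀ * C := by abel
      _ = _ := by rw [hG₀]
  -- `1 + G₀` is invertible
  have hinv : IsUnit (1 + G₀).det := by
    rw [isUnit_iff_ne_zero]
    intro hdet
    obtain ⟨v, hv0, hv⟩ := Matrix.exists_mulVec_eq_zero_iff.2 hdet
    have hGv : G₀ *ᵥ v = -v := by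
      rw [Matrix.add_mulVec, Matrix.one_mulVec] at hv
      exact (eq_neg_of_add_eq_zero_right hv)
    apply hv0
    refine hobs v fun m _ => ?_
    induction m using Nat.strong_induction_on with
    | _ m ih =>
      -- As long as $CA^iv=0$ for $i<j$ the term $Y_0C$ drops out, so moving $G_0$ past $A^j$ costs
      -- $jA^j$. With $G_0v=-v$, applying $C$ at $j=m$ gives $-CA^mv=m\,CA^mv$, hence $CA^mv=0$.
      have key : ∀ j ≤ m, A ^ j *ᵥ (G₀ *ᵥ v) = G₀ *ᵥ (A ^ j *ᵥ v) + (j : ℝ) • (A ^ j *ᵥ v) := by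
        intro j
        induction j with
        | zero => simp
        | succ j ihj =>
          intro hj
          have h1 := ih j (by omega) (by omega)
          have h2 : C *ᵥ (A ^ j *ᵥ v) = 0 := by rwa [Matrix.mulVec_mulVec]
          have h3 := congrArg (fun X => X *ᵥ (A ^ j *ᵥ v)) hAG
          simp only [Matrix.sub_mulVec, Matrix.add_mulVec, ← Matrix.mulVec_mulVec, h2,
            Matrix.mulVec_zero, sub_zero] at h3
          rw [pow_succ', ← Matrix.mulVec_mulVec, ihj (by omega), Matrix.mulVec_add,
            Matrix.mulVec_smul, h3, ← Matrix.mulVec_mulVec]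
          push_cast
          rw [add_smul, one_smul]
          abel
      have h1 := congrArg (fun x => C *ᵥ x) (key m le_rfl)
      simp only [hGv, Matrix.mulVec_add, Matrix.mulVec_neg, Matrix.mulVec_smul] at h1
      rw [Matrix.mulVec_mulVec _ C G₀, hCG₀, Matrix.zero_mulVec, zero_add,
        Matrix.mulVec_mulVec] at h1
      have h2 : ((m : ℝ) + 1) • ((C * A ^ m) *ᵥ v) = 0 := by
        rw [add_smul, one_smul, ← h1]; abel
      exact (smul_eq_zero.1 h2).resolve_left (by positivity)
  set A₀ := A + -((1 + G₀)⁻¹ * Y₀) * C with hA₀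
  -- $(I+G_0)L_0=-Y_0$ absorbs the output term on the right, and $CG_0=0$ removes it on the left.
  have hA₀G : A₀ * G₀ = (G₀ + 1) * A₀ := by
    have h1 : A₀ * G₀ = A * G₀ := by
      rw [hA₀, Matrix.add_mul, Matrix.mul_assoc _ C, hCG₀]; simp
    have h2 : (G₀ + 1) * A₀ = (G₀ + 1) * A - Y₀ * C := by
      rw [hA₀, Matrix.mul_add, Matrix.neg_mul, Matrix.mul_neg, Matrix.mul_assoc, ← Matrix.mul_assoc,
        add_comm G₀ 1, Matrix.mul_nonsing_inv _ hinv, Matrix.one_mul, sub_eq_add_neg]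
    rw [h1, h2, hAG, Matrix.add_mul, Matrix.one_mul]
  have hrow : ∀ m : ℕ, C * A₀ ^ m * G₀ = (m : ℝ) • (C * A₀ ^ m) := by
    intro m
    induction m with
    | zero => simpa using hCG₀
    | succ m ih =>
      rw [pow_succ, Matrix.mul_assoc C, Matrix.mul_assoc (A₀ ^ m), hA₀G, Matrix.add_mul,
        Matrix.one_mul, Matrix.mul_add, Matrix.mul_add, ← Matrix.mul_assoc (A₀ ^ m),
        ← Matrix.mul_assoc C, ← Matrix.mul_assoc C, ih, Matrix.smul_mul, Matrix.mul_assoc]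
      push_cast
      rw [add_smul, one_smul]
  have hinj : ∀ v : Fin n → ℝ, (∀ m < N, (C * A₀ ^ m) *ᵥ v = 0) → v = 0 := by
    intro v hv
    refine hobs v ?_
    -- Output injection does not act along vectors with zero output, so observability passes from
    -- $A$ to $A_0$.
    have key : ∀ m ≤ N, A₀ ^ m *ᵥ v = A ^ m *ᵥ v := by
      intro m
      induction m with
      | zero => simp
      | succ m ih =>
        intro hm
        have h1 : C *ᵥ (A₀ ^ m *ᵥ v) = 0 := by rw [Matrix.mulVec_mulVec]; exact hv m (by omega)
        have h2 : A₀ *ᵥ (A₀ ^ m *ᵥ v) = A *ᵥ (A₀ ^ m *ᵥ v) := by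
          rw [hA₀, Matrix.add_mulVec, ← hA₀, ← Matrix.mulVec_mulVec, h1, Matrix.mulVec_zero,
            add_zero]
        rw [pow_succ', ← Matrix.mulVec_mulVec, h2, ih (by omega), Matrix.mulVec_mulVec, pow_succ']
    intro m hm
    rw [← Matrix.mulVec_mulVec, ← key m hm.le, Matrix.mulVec_mulVec]
    exact hv m hm
  have hpos : (0 : ℝ) < (N : ℝ) + 1 := by positivity
  have hν' : 0 ≤ 1 + ν * ((N : ℝ) + 1) := by
    have := mul_le_mul_of_nonneg_right hν hpos.le
    rw [neg_mul, one_div, inv_mul_cancel₀ hpos.ne'] at this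
    linarith
  refine ⟨?_, ?_, hinj, ?_, ?_, hν', ?_, ?_⟩
  · rw [Matrix.mul_add, Matrix.mul_one, Matrix.mul_smul, Matrix.mul_add, hCG₀, Matrix.mul_one,
      zero_add, add_smul, one_smul]
  · rw [Matrix.mul_add, Matrix.mul_one, Matrix.mul_smul, Matrix.mul_add, hA₀G]
    simp only [Matrix.add_mul, Matrix.smul_mul, Matrix.one_mul, Matrix.mul_one, smul_add]
    abel
  -- $CA_0^N(G_0-N)=0$, so it suffices that $N$ is not an eigenvalue of $G_0$. A kernel vector of
  -- $G_0-N$ would be annihilated by the rows $m<N$, whose eigenvalues $m$ differ from $N$, and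
  -- these rows are jointly injective.
  · have hdet : IsUnit (G₀ - (N : ℝ) • (1 : Matrix (Fin n) (Fin n) ℝ)).det := by
      rw [isUnit_iff_ne_zero]
      intro hdet
      obtain ⟨v, hv0, hv⟩ := Matrix.exists_mulVec_eq_zero_iff.2 hdet
      apply hv0
      refine hinj v fun m hm => ?_
      have h1 : (C * A₀ ^ m) *ᵥ ((G₀ - (N : ℝ) • (1 : Matrix (Fin n) (Fin n) ℝ)) *ᵥ v) = 0 := by
        rw [hv, Matrix.mulVec_zero]
      rw [Matrix.mulVec_mulVec, Matrix.mul_sub, hrow, Matrix.mul_smul, Matrix.mul_one, ← sub_smul,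
        Matrix.smul_mulVec] at h1
      refine (smul_eq_zero.1 h1).resolve_left ?_
      have : (m : ℝ) < N := by exact_mod_cast hm
      linarith
    have h0 : C * A₀ ^ N * (G₀ - (N : ℝ) • (1 : Matrix (Fin n) (Fin n) ℝ)) = 0 := by
      rw [Matrix.mul_sub, hrow, Matrix.mul_smul, Matrix.mul_one, sub_self]
    have h1 := congrArg (fun X => X * (G₀ - (N : ℝ) • (1 : Matrix (Fin n) (Fin n) ℝ))⁻¹) h0
    simp only [Matrix.mul_assoc _ _ (_)⁻¹, Matrix.zero_mul] at h1
    rwa [Matrix.mul_nonsing_inv _ hdet, Matrix.mul_one] at h1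
  · intro m hm
    have hm' : (m : ℝ) ≤ N := by exact_mod_cast hm
    rcases le_or_gt 0 ν with h | h
    · positivity
    · nlinarith
  · by_contra h0
    have := hobs (fun _ => 1) fun m hm => absurd hm (by omega)
    have h2 := congrFun this ⟨0, hn⟩
    simp at h2
  · rcases Nat.eq_zero_or_pos k with rfl | h
    · exfalso
      have := hobs (fun _ => 1) fun m _ => by ext i; exact i.elim0
      have h2 := congrFun this ⟨0, hn⟩
      simp at h2
    · exact h

/-! ### The augmented pair -/

section Aug
variable {n k : ℕ}

/-- The rows `(I, 0)`, `(0, C)`, `(0, C A₀)`, ..., which are `barC * barA ^ m`. -/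
def augRow (C : Matrix (Fin k) (Fin n) ℝ) (A₀ : Matrix (Fin n) (Fin n) ℝ) :
    ℕ → Matrix (Fin k) (Fin k ⊕ Fin n) ℝ
  | 0 => fromCols 1 0
  | m + 1 => fromCols 0 (C * A₀ ^ m)

variable {C : Matrix (Fin k) (Fin n) ℝ} {A₀ Gd : Matrix (Fin n) (Fin n) ℝ} {ν : ℝ} {N : ℕ}

theorem augRow_mul_barA (m : ℕ) : augRow C A₀ m * barA C A₀ = augRow C A₀ (m + 1) := by
  cases m with
  | zero => simp [augRow, barA, fromCols_mul_fromBlocks]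
  | succ m => simp [augRow, barA, fromCols_mul_fromBlocks, pow_succ, Matrix.mul_assoc]

namespace IsGradedPair
variable (h : IsGradedPair C A₀ Gd ν N)
include h

theorem row_mul (m : ℕ) : C * A₀ ^ m * Gd = (1 + ν * ((m : ℝ) + 1)) • (C * A₀ ^ m) := by
  induction m with
  | zero => simpa using h.output
  | succ m ih =>
    rw [pow_succ, Matrix.mul_assoc C, Matrix.mul_assoc (A₀ ^ m), h.comm, Matrix.add_mul,
      Matrix.mul_add, Matrix.mul_add, ← Matrix.mul_assoc (A₀ ^ m) Gd,
      ← Matrix.mul_assoc C (A₀ ^ m * Gd), ← Matrix.mul_assoc C (A₀ ^ m) Gd, ih, Matrix.smul_mul,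
      Matrix.smul_mul, Matrix.one_mul, Matrix.mul_smul, Matrix.mul_smul, Matrix.mul_assoc C,
      ← add_smul]
    congr 1
    push_cast; ring

theorem row_mul_linearGroup (m : ℕ) (s : ℝ) : C * A₀ ^ m * linearGroup Gd s =
    Real.exp (s * (1 + ν * ((m : ℝ) + 1))) • (C * A₀ ^ m) :=
  mul_linearGroup (h.row_mul m) s

/-- Observability allows matrix identities to be tested row by row, where $e^{sG_{\mathbf d}}$ acts
as a scalar. -/
theorem ext_of_rows {κ : Type*} [Fintype κ] {X Y : Matrix (Fin n) κ ℝ}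
    (hXY : ∀ m < N, C * A₀ ^ m * X = C * A₀ ^ m * Y) : X = Y := by
  classical
  have key : ∀ v : κ → ℝ, X *ᵥ v = Y *ᵥ v := by
    intro v
    rw [← sub_eq_zero]
    refine h.inj _ fun m hm => ?_
    rw [Matrix.mulVec_sub, Matrix.mulVec_mulVec, Matrix.mulVec_mulVec, hXY m hm, sub_self]
  exact Matrix.mulVec_injective (funext key)

theorem mul_linearGroup_comm (s : ℝ) :
    A₀ * linearGroup Gd s = Real.exp (ν * s) • (linearGroup Gd s * A₀) := by
  refine h.ext_of_rows fun m _ => ?_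
  rw [← Matrix.mul_assoc, Matrix.mul_assoc C, ← pow_succ, h.row_mul_linearGroup, Matrix.mul_smul,
    ← Matrix.mul_assoc, h.row_mul_linearGroup, Matrix.smul_mul, smul_smul, ← Real.exp_add,
    Matrix.mul_assoc, ← pow_succ]
  congr 2; push_cast; ring

theorem output_mul_linearGroup (s : ℝ) :
    C * linearGroup Gd s = Real.exp ((1 + ν) * s) • C := by
  have := h.row_mul_linearGroup 0 s
  simpa [mul_comm] using this

theorem augRow_mul_barG (m : ℕ) :
    augRow C A₀ m * barG (k := k) Gd = (1 + ν * (m : ℝ)) • augRow C A₀ m := by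
  cases m with
  | zero => simp [augRow, barG, fromCols_mul_fromBlocks]
  | succ m =>
    have h1 := h.row_mul m
    simp only [augRow, barG, fromCols_mul_fromBlocks, Matrix.zero_mul, Matrix.mul_zero, add_zero,
      zero_add, h1]
    ext i (j | j) <;> simp

theorem augRow_mul_linearGroup (m : ℕ) (s : ℝ) : augRow C A₀ m * linearGroup (barG (k := k) Gd) s =
    Real.exp (s * (1 + ν * (m : ℝ))) • augRow C A₀ m :=
  mul_linearGroup (h.augRow_mul_barG m) s

theorem augRow_nilp : augRow C A₀ (N + 1) = 0 := by
  simp only [augRow, h.nilp]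
  ext i (j | j) <;> simp

theorem augRow_inj {z : Fin k ⊕ Fin n → ℝ} (hz : ∀ m ≤ N, augRow C A₀ m *ᵥ z = 0) : z = 0 := by
  have h0 : (fun i => z (Sum.inl i)) = 0 := by
    have := hz 0 (Nat.zero_le _)
    simpa [augRow, Matrix.fromCols_mulVec, Function.comp_def] using this
  have h1 : (fun i => z (Sum.inr i)) = 0 := by
    refine h.inj _ fun m hm => ?_
    have := hz (m + 1) hm
    simpa [augRow, Matrix.fromCols_mulVec, Function.comp_def] using this
  ext (i | i)
  · exact congrFun h0 i
  · exact congrFun h1 i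

theorem ext_of_augRows {κ : Type*} [Fintype κ] {X Y : Matrix (Fin k ⊕ Fin n) κ ℝ}
    (hXY : ∀ m ≤ N, augRow C A₀ m * X = augRow C A₀ m * Y) : X = Y := by
  classical
  have key : ∀ v : κ → ℝ, X *ᵥ v = Y *ᵥ v := by
    intro v
    rw [← sub_eq_zero]
    refine h.augRow_inj fun m hm => ?_
    rw [Matrix.mulVec_sub, Matrix.mulVec_mulVec, Matrix.mulVec_mulVec, hXY m hm, sub_self]
  exact Matrix.mulVec_injective (funext key)

theorem linearGroup_barG (s : ℝ) : linearGroup (barG (k := k) Gd) s =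
    fromBlocks (Real.exp s • 1) 0 0 (linearGroup Gd s) := by
  refine h.ext_of_augRows fun m _ => ?_
  rw [h.augRow_mul_linearGroup]
  cases m with
  | zero =>
    simp only [augRow, fromCols_mul_fromBlocks]
    ext i (j | j) <;> simp
  | succ m =>
    have h1 := h.row_mul_linearGroup m s
    simp only [augRow, fromCols_mul_fromBlocks, h1]
    ext i (j | j) <;> simp

theorem barA_mul_linearGroup (s : ℝ) : barA C A₀ * linearGroup (barG (k := k) Gd) s =
    Real.exp (ν * s) • (linearGroup (barG (k := k) Gd) s * barA C A₀) := by
  refine h.ext_of_augRows fun m _ => ?_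
  rw [← Matrix.mul_assoc, augRow_mul_barA, h.augRow_mul_linearGroup, Matrix.mul_smul,
    ← Matrix.mul_assoc, h.augRow_mul_linearGroup, Matrix.smul_mul, augRow_mul_barA, smul_smul,
    ← Real.exp_add]
  congr 2; push_cast; ring

end IsGradedPair

/-! ### Components of the error state and homogeneity -/

/-- The component `ψ` of the error state. -/
def psiPart (x : ErrIdx n k → ℝ) : Fin k → ℝ := fun i => x (Sum.inl (Sum.inl i))

/-- The component `ε` of the error state. -/
def epsPart (x : ErrIdx n k → ℝ) : Fin n → ℝ := fun i => x (Sum.inl (Sum.inr i))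

/-- The component `ξ` of the error state. -/
def xiPart (x : ErrIdx n k → ℝ) : ℝ := x (Sum.inr 0)

/-- The component `(ψ, ε)` of the error state. -/
def zPart (x : ErrIdx n k → ℝ) : Fin k ⊕ Fin n → ℝ := fun i => x (Sum.inl i)

/-- The value of `σ` at an error state. -/
def sigmaAt (x : ErrIdx n k → ℝ) : ℝ := sigmaOf (psiPart x) (xiPart x)

theorem dotProduct_self_nonneg' {ι : Type*} [Fintype ι] (v : ι → ℝ) : 0 ≤ v ⬝ᵥ v :=
  Finset.sum_nonneg fun i _ => mul_self_nonneg (v i)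

theorem abs_le_sqrt_dotProduct {ι : Type*} [Fintype ι] (v : ι → ℝ) (i : ι) :
    |v i| ≤ Real.sqrt (v ⬝ᵥ v) := by
  refine Real.abs_le_sqrt ?_
  rw [sq]
  exact Finset.single_le_sum (f := fun i => v i * v i) (fun i _ => mul_self_nonneg (v i))
    (Finset.mem_univ i)

theorem sigmaOf_nonneg (ψ : Fin k → ℝ) (ξ : ℝ) : 0 ≤ sigmaOf ψ ξ := Real.sqrt_nonneg _

theorem sigmaOf_sq (ψ : Fin k → ℝ) (ξ : ℝ) : sigmaOf ψ ξ ^ 2 = max ξ ((ψ ⬝ᵥ ψ) / 2) :=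
  Real.sq_sqrt (le_max_of_le_right (by have := dotProduct_self_nonneg' ψ; linarith))

theorem norm_le_two_mul_sigmaOf (ψ : Fin k → ℝ) (ξ : ℝ) : ‖ψ‖ ≤ 2 * sigmaOf ψ ξ := by
  refine (pi_norm_le_iff_of_nonneg (by have := sigmaOf_nonneg ψ ξ; positivity)).2 fun i => ?_
  have h1 := abs_le_sqrt_dotProduct ψ i
  refine h1.trans (Real.sqrt_le_iff.2 ⟨by have := sigmaOf_nonneg ψ ξ; positivity, ?_⟩)
  have h2 := sigmaOf_sq ψ ξ
  have h3 := le_max_right ξ ((ψ ⬝ᵥ ψ) / 2)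
  have h4 := dotProduct_self_nonneg' ψ
  nlinarith

theorem eq_zero_of_sigmaOf_eq_zero {ψ : Fin k → ℝ} {ξ : ℝ} (h : sigmaOf ψ ξ = 0) : ψ = 0 := by
  have := norm_le_two_mul_sigmaOf ψ ξ
  rw [h, mul_zero] at this
  exact norm_le_zero_iff.1 this

theorem sigmaOf_smul (ψ : Fin k → ℝ) (ξ s : ℝ) :
    sigmaOf (Real.exp s • ψ) (Real.exp (2 * s) * ξ) = Real.exp s * sigmaOf ψ ξ := by
  have h2 : Real.exp (2 * s) = Real.exp s * Real.exp s := by rw [← Real.exp_add]; ring_nf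
  rw [sigmaOf, sigmaOf, smul_dotProduct, dotProduct_smul, smul_eq_mul, smul_eq_mul]
  rw [show Real.exp s * (Real.exp s * (ψ ⬝ᵥ ψ)) / 2 = Real.exp (2 * s) * ((ψ ⬝ᵥ ψ) / 2) by
    rw [h2]; ring, ← mul_max_of_nonneg _ _ (Real.exp_pos _).le, h2, Real.sqrt_mul
      (mul_self_nonneg _), Real.sqrt_mul_self (Real.exp_pos _).le]

theorem sign_mul_of_pos {c : ℝ} (hc : 0 < c) (r : ℝ) : Real.sign (c * r) = Real.sign r := by
  rcases lt_trichotomy r 0 with h | h | h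
  · rw [Real.sign_of_neg h, Real.sign_of_neg (by nlinarith)]
  · simp [h]
  · rw [Real.sign_of_pos h, Real.sign_of_pos (by positivity)]

theorem signedPow_smul (r a s : ℝ) :
    signedPow (Real.exp (2 * s) * r) (a / 2 + 1) = Real.exp ((a + 2) * s) * signedPow r (a / 2 + 1) := by
  rw [signedPow, signedPow, sign_mul_of_pos (Real.exp_pos _), abs_mul, abs_of_pos (Real.exp_pos _),
    Real.mul_rpow (Real.exp_pos _).le (abs_nonneg _), ← Real.exp_mul]
  rw [show 2 * s * (a / 2 + 1) = (a + 2) * s by ring]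
  ring

section Field
variable (C A₀ Gd) (Lt : Matrix (Fin k) (Fin k) ℝ) (L : Matrix (Fin n) (Fin k) ℝ) (ν γ : ℝ)
variable (x : ErrIdx n k → ℝ)

theorem psiPart_errorField : psiPart (errorField C A₀ Gd Lt L ν γ x) =
    C *ᵥ epsPart x + sigmaAt x ^ ν • (Lt *ᵥ psiPart x) := rfl

theorem epsPart_errorField : epsPart (errorField C A₀ Gd Lt L ν γ x) =
    A₀ *ᵥ epsPart x + sigmaAt x ^ (ν - 1) • (linearGroup Gd (Real.log (sigmaAt x)) *ᵥ
      (L *ᵥ psiPart x)) := rfl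

theorem xiPart_errorField : xiPart (errorField C A₀ Gd Lt L ν γ x) =
    |psiPart x ⬝ᵥ (C *ᵥ epsPart x + sigmaAt x ^ ν • (Lt *ᵥ psiPart x))| -
      γ * signedPow (xiPart x - (psiPart x ⬝ᵥ psiPart x) / 2) (ν / 2 + 1) := rfl

theorem err_ext {x y : ErrIdx n k → ℝ} (h1 : psiPart x = psiPart y) (h2 : epsPart x = epsPart y)
    (h3 : xiPart x = xiPart y) : x = y := by
  ext ((i | i) | i)
  · exact congrFun h1 i
  · exact congrFun h2 i
  · rw [Subsingleton.elim i 0]; exact h3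

end Field

theorem xiPart_dSigma (s : ℝ) (x : ErrIdx n k → ℝ) :
    xiPart (dSigma Gd s *ᵥ x) = Real.exp (2 * s) * xiPart x := by
  simp [xiPart, dSigma, Matrix.fromBlocks_mulVec, Matrix.smul_mulVec]

theorem zPart_dSigma (s : ℝ) (x : ErrIdx n k → ℝ) :
    zPart (dSigma Gd s *ᵥ x) = linearGroup (barG (k := k) Gd) s *ᵥ zPart x := by
  ext i
  simp only [zPart, dSigma, Matrix.fromBlocks_mulVec, Function.comp_def,
    Sum.elim_inl, Matrix.zero_mulVec, add_zero]
  rfl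

namespace IsGradedPair
variable (h : IsGradedPair C A₀ Gd ν N)
include h

theorem psiPart_dSigma (s : ℝ) (x : ErrIdx n k → ℝ) :
    psiPart (dSigma Gd s *ᵥ x) = Real.exp s • psiPart x := by
  ext i
  simp [psiPart, dSigma, h.linearGroup_barG, Matrix.fromBlocks_mulVec, Matrix.smul_mulVec]

theorem epsPart_dSigma (s : ℝ) (x : ErrIdx n k → ℝ) :
    epsPart (dSigma Gd s *ᵥ x) = linearGroup Gd s *ᵥ epsPart x := by
  ext i
  simp only [epsPart, dSigma, h.linearGroup_barG, Matrix.fromBlocks_mulVec, Function.comp_def,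
    Sum.elim_inl, Sum.elim_inr, Matrix.zero_mulVec, add_zero, zero_add]
  rfl

theorem sigmaAt_dSigma (s : ℝ) (x : ErrIdx n k → ℝ) :
    sigmaAt (dSigma Gd s *ᵥ x) = Real.exp s * sigmaAt x := by
  rw [sigmaAt, h.psiPart_dSigma, xiPart_dSigma, sigmaOf_smul]; rfl

theorem isHomogeneousField (Lt : Matrix (Fin k) (Fin k) ℝ) (L : Matrix (Fin n) (Fin k) ℝ) (γ : ℝ) :
    IsHomogeneousField (dSigma Gd) ν (errorField C A₀ Gd Lt L ν γ) := by
  intro s x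
  have hσ : 0 ≤ sigmaAt x := sigmaOf_nonneg _ _
  have hψ : C *ᵥ (linearGroup Gd s *ᵥ epsPart x) + (Real.exp s * sigmaAt x) ^ ν •
      (Lt *ᵥ (Real.exp s • psiPart x)) = Real.exp ((ν + 1) * s) •
      (C *ᵥ epsPart x + sigmaAt x ^ ν • (Lt *ᵥ psiPart x)) := by
    rw [Matrix.mulVec_mulVec, h.output_mul_linearGroup, Matrix.smul_mulVec, Matrix.mulVec_smul,
      Real.mul_rpow (Real.exp_pos _).le hσ, ← Real.exp_mul, smul_smul, smul_add, smul_smul,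
      show (ν + 1) * s = s * ν + s by ring, Real.exp_add, add_comm 1 ν, add_mul, one_mul,
      mul_comm ν s, Real.exp_add]
    congr 2; ring
  refine err_ext ?_ ?_ ?_
  · rw [psiPart_errorField, h.sigmaAt_dSigma, h.psiPart_dSigma, h.epsPart_dSigma, hψ]
    change _ = Real.exp (ν * s) • psiPart (dSigma Gd s *ᵥ _)
    rw [h.psiPart_dSigma, psiPart_errorField, smul_smul, ← Real.exp_add]
    congr 2; ring
  · rw [epsPart_errorField, h.sigmaAt_dSigma, h.psiPart_dSigma, h.epsPart_dSigma]
    change _ = Real.exp (ν * s) • epsPart (dSigma Gd s *ᵥ _)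
    rw [h.epsPart_dSigma, epsPart_errorField, Matrix.mulVec_mulVec, h.mul_linearGroup_comm,
      Matrix.mulVec_add, smul_add, Matrix.smul_mulVec, ← Matrix.mulVec_mulVec]
    congr 1
    -- At $\sigma=0$ the rule $\ln(e^s\sigma)=s+\ln\sigma$ fails for the default value $\log 0=0$,
    -- but there $\psi=0$ and the term vanishes.
    rcases hσ.eq_or_lt with h0 | h0
    · have : psiPart x = 0 := eq_zero_of_sigmaOf_eq_zero h0.symm
      simp [this]
    · rw [Real.log_mul (Real.exp_pos _).ne' h0.ne', Real.log_exp, linearGroup_add,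
        Real.mul_rpow (Real.exp_pos _).le hσ, ← Real.exp_mul, Matrix.mulVec_smul,
        Matrix.mulVec_smul, Matrix.mulVec_smul, smul_smul, smul_smul, ← Matrix.mulVec_mulVec]
      congr 1
      have e : Real.exp (ν * s) = Real.exp (s * (ν - 1)) * Real.exp s := by
        rw [← Real.exp_add]; congr 1; ring
      rw [e]; ring
  · rw [xiPart_errorField, h.sigmaAt_dSigma, h.psiPart_dSigma, h.epsPart_dSigma, xiPart_dSigma, hψ]
    change _ = Real.exp (ν * s) * xiPart (dSigma Gd s *ᵥ _)
    rw [xiPart_dSigma, xiPart_errorField, smul_dotProduct, dotProduct_smul, smul_dotProduct,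
      dotProduct_smul]
    simp only [smul_eq_mul]
    have e2 : Real.exp (2 * s) = Real.exp s * Real.exp s := by rw [← Real.exp_add]; ring_nf
    have e3 : Real.exp (ν * s) * Real.exp (2 * s) = Real.exp s * Real.exp ((ν + 1) * s) := by
      rw [← Real.exp_add, ← Real.exp_add]; ring_nf
    have e4 : Real.exp (ν * s) * Real.exp (2 * s) = Real.exp ((ν + 2) * s) := by
      rw [← Real.exp_add]; ring_nf
    rw [show Real.exp (2 * s) * xiPart x - Real.exp s * (Real.exp s * (psiPart x ⬝ᵥ psiPart x)) / 2
      = Real.exp (2 * s) * (xiPart x - (psiPart x ⬝ᵥ psiPart x) / 2) by rw [e2]; ring,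
      signedPow_smul, ← mul_assoc (Real.exp s), ← e3, abs_mul, abs_of_pos (by positivity),
      mul_sub, ← mul_assoc, ← e4]
    ring

/-- All the graded coordinates of the state `(ψ, ε, ξ)`. -/
theorem exists_coords : ∃ (O : Matrix ((Fin (N + 1) × Fin k) ⊕ Fin 1) (ErrIdx n k) ℝ)
    (B : Matrix (ErrIdx n k) ((Fin (N + 1) × Fin k) ⊕ Fin 1) ℝ), B * O = 1 ∧
    (∀ x p, (O *ᵥ x) (Sum.inl p) = (augRow C A₀ p.1 *ᵥ zPart x) p.2) ∧
    (∀ x i, (O *ᵥ x) (Sum.inr i) = xiPart x) := by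
  let M : Matrix (Fin (N + 1) × Fin k) (Fin k ⊕ Fin n) ℝ :=
    Matrix.of fun p j => augRow C A₀ p.1 p.2 j
  let O : Matrix ((Fin (N + 1) × Fin k) ⊕ Fin 1) (ErrIdx n k) ℝ := fromBlocks M 0 0 1
  have h1 : ∀ x p, (O *ᵥ x) (Sum.inl p) = (augRow C A₀ p.1 *ᵥ zPart x) p.2 := by
    intro x p
    simp only [O, Matrix.fromBlocks_mulVec, Sum.elim_inl, Matrix.zero_mulVec, add_zero]
    rfl
  have h2 : ∀ x i, (O *ᵥ x) (Sum.inr i) = xiPart x := by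
    intro x i
    rw [Subsingleton.elim i 0]
    simp [O, Matrix.fromBlocks_mulVec, xiPart]
  have hker : LinearMap.ker (Matrix.toLin' O) = ⊥ := by
    rw [LinearMap.ker_eq_bot']
    intro x hx
    rw [Matrix.toLin'_apply] at hx
    have hz : zPart x = 0 := by
      refine h.augRow_inj fun m hm => ?_
      ext i
      have := congrFun hx (Sum.inl (⟨m, by omega⟩, i))
      rw [h1] at this
      exact this
    have hξ : xiPart x = 0 := by rw [← h2 x 0, hx]; rfl
    ext (j | j)
    · exact congrFun hz j
    · rw [Subsingleton.elim j 0]; exact hξ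
  obtain ⟨g, hg⟩ := LinearMap.exists_leftInverse_of_injective _ hker
  refine ⟨O, LinearMap.toMatrix' g, ?_, h1, h2⟩
  have := congrArg LinearMap.toMatrix' hg
  rwa [LinearMap.toMatrix'_comp, LinearMap.toMatrix'_toLin', LinearMap.toMatrix'_id] at this

theorem isLinearDilation_dSigma : IsLinearDilation (dSigma (k := k) Gd) := by
  obtain ⟨O, B, hB, h1, h2⟩ := h.exists_coords
  refine isLinearDilation_of_eigen hB
    (w := Sum.elim (fun p : Fin (N + 1) × Fin k => 1 + ν * ((p.1 : ℕ) : ℝ)) (fun _ => 2)) ?_ ?_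
  · rintro (p | p)
    · exact h.weight_pos _ (by omega)
    · norm_num
  · intro s
    refine Matrix.mulVec_injective (funext fun x => ?_)
    rw [← Matrix.mulVec_mulVec, ← Matrix.mulVec_mulVec]
    ext (p | p)
    · rw [Matrix.mulVec_diagonal, h1, h1, zPart_dSigma, Matrix.mulVec_mulVec,
        h.augRow_mul_linearGroup, Matrix.smul_mulVec]
      rfl
    · rw [Matrix.mulVec_diagonal, h2, h2, xiPart_dSigma]
      simp [mul_comm]

end IsGradedPair
end Aug

/-! ### Linear matrix inequality for a chain of integrators -/

/-- The right-hand side of a chain of integrators: `(y₀, ..., y_M) ↦ (y₁, ..., y_M, 0)`. -/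
def chainShift {M : ℕ} (y : Fin (M + 1) → ℝ) : Fin (M + 1) → ℝ :=
  fun m => if h : (m : ℕ) + 1 < M + 1 then y ⟨m + 1, h⟩ else 0

theorem tail_chainShift {M : ℕ} (y : Fin (M + 2) → ℝ) :
    Fin.tail (chainShift y) = chainShift (Fin.tail y) := by
  ext m
  simp only [chainShift, Fin.tail, Fin.val_succ]
  by_cases h : (m : ℕ) + 1 < M + 1
  · rw [dif_pos h, dif_pos (by omega)]; rfl
  · rw [dif_neg h, dif_neg (by omega)]

theorem chainShift_zero {M : ℕ} (y : Fin (M + 2) → ℝ) : chainShift y 0 = Fin.tail y 0 := by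
  simp [chainShift, Fin.tail]

theorem dotProduct_chainShift_le {M : ℕ} (y : Fin (M + 1) → ℝ) : chainShift y 0 ^ 2 ≤ y ⬝ᵥ y := by
  have key : ∀ m, y m ^ 2 ≤ y ⬝ᵥ y := fun m => by
    rw [sq]
    exact Finset.single_le_sum (f := fun i => y i * y i) (fun i _ => mul_self_nonneg (y i))
      (Finset.mem_univ m)
  unfold chainShift
  split_ifs
  · exact key _
  · simpa using dotProduct_self_nonneg' y

/-- Enlarge the matrix of a quadratic form by a new first variable, coupled to the next one only. -/
def extendForm {M : ℕ} (c m : ℝ) (P : Matrix (Fin (M + 1)) (Fin (M + 1)) ℝ) :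
    Matrix (Fin (M + 2)) (Fin (M + 2)) ℝ :=
  Matrix.of (Fin.cons (Fin.cons c (fun j => if j = 0 then -m else 0))
    (fun i => Fin.cons (if i = 0 then -m else 0) (P i)))

theorem extendForm_isSymm {M : ℕ} (c m : ℝ) {P : Matrix (Fin (M + 1)) (Fin (M + 1)) ℝ}
    (hP : Pᵀ = P) : (extendForm c m P)ᵀ = extendForm c m P := by
  ext i j
  refine Fin.cases ?_ (fun i => ?_) i <;> refine Fin.cases ?_ (fun j => ?_) j
  · rfl
  · simp [extendForm]
  · simp [extendForm]
  · have := congrFun (congrFun hP i) j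
    simpa [extendForm] using this

theorem dotProduct_extendForm {M : ℕ} (c m : ℝ) (P : Matrix (Fin (M + 1)) (Fin (M + 1)) ℝ)
    (y u : Fin (M + 2) → ℝ) : y ⬝ᵥ (extendForm c m P *ᵥ u) =
    c * y 0 * u 0 - m * y 0 * Fin.tail u 0 - m * Fin.tail y 0 * u 0 +
      Fin.tail y ⬝ᵥ (P *ᵥ Fin.tail u) := by
  simp only [dotProduct, Matrix.mulVec, extendForm, Matrix.of_apply]
  rw [Fin.sum_univ_succ, Fin.sum_univ_succ]
  simp only [Fin.cons_zero, Fin.cons_succ, Fin.sum_univ_succ (n := M + 1) (fun j => _ * u j),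
    ite_mul, zero_mul, Finset.sum_ite_eq', Finset.mem_univ, if_true, mul_add, Finset.sum_add_distrib]
  rw [Finset.sum_eq_single (0 : Fin (M + 1)) (fun b _ hb => by simp [hb]) (by simp)]
  simp only [Fin.tail, if_true, mul_add, Finset.sum_add_distrib]
  ring_nf

theorem dotProduct_self_succ {M : ℕ} (y : Fin (M + 2) → ℝ) :
    y ⬝ᵥ y = y 0 ^ 2 + Fin.tail y ⬝ᵥ Fin.tail y := by
  simp [dotProduct, Fin.sum_univ_succ, Fin.tail, sq]

theorem mul_le_sq_div_add {p q κ S : ℝ} (hκ : 0 < κ) (h : q ^ 2 ≤ S) :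
    p * q ≤ p ^ 2 / κ + κ / 4 * S := by
  have h1 : p ^ 2 / κ + κ / 4 * q ^ 2 - p * q = (p - κ / 2 * q) ^ 2 / κ := by
    field_simp; ring
  have h2 : 0 ≤ (p - κ / 2 * q) ^ 2 / κ := by positivity
  nlinarith

/-- Induction on the length of the chain: a new first variable is coupled only to its successor. The
term $\beta y_0^2$ is the part that output injection can remove; a uniform margin $\kappa$ is
carried along to absorb the cross terms at the next stage. -/
theorem exists_chain_lmi (ρ : ℝ) (M : ℕ) : ∀ w : ℕ → ℝ, (∀ m ≤ M, 0 < w m) →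
    ∃ (P : Matrix (Fin (M + 1)) (Fin (M + 1)) ℝ) (β κ : ℝ), Pᵀ = P ∧ 0 < κ ∧
      ∀ y : Fin (M + 1) → ℝ, κ * (y ⬝ᵥ y) ≤ y ⬝ᵥ (P *ᵥ y) ∧
        κ * (y ⬝ᵥ y) ≤ y ⬝ᵥ (P *ᵥ fun m => w m * y m) ∧
        2 * (y ⬝ᵥ (P *ᵥ chainShift y)) + 2 * ρ * (y ⬝ᵥ (P *ᵥ fun m => w m * y m)) ≤
          β * y 0 ^ 2 - κ * (y ⬝ᵥ y) := by
  induction M with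
  | zero =>
    intro w hw
    have h0 := hw 0 le_rfl
    refine ⟨1, 2 * ρ * w 0 + min 1 (w 0), min 1 (w 0), by simp, by positivity, fun y => ?_⟩
    have e1 : y ⬝ᵥ y = y 0 ^ 2 := by simp [dotProduct, sq]
    have e2 : (y ⬝ᵥ fun m : Fin (0 + 1) => w m * y m) = w 0 * y 0 ^ 2 := by
      simp [dotProduct, sq]; ring
    have e3 : y ⬝ᵥ chainShift y = 0 := by simp [dotProduct, chainShift]
    simp only [Matrix.one_mulVec, e1, e2, e3]
    have h1 := min_le_left 1 (w 0)
    have h2 := min_le_right 1 (w 0)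
    refine ⟨?_, ?_, ?_⟩ <;> nlinarith [sq_nonneg (y 0)]
  | succ M ih =>
    intro w hw
    obtain ⟨P, β, κ, hP, hκ, hy⟩ := ih (fun m => w (m + 1)) fun m hm => hw (m + 1) (by omega)
    have hw0 := hw 0 (Nat.zero_le _)
    -- Along the shift the coupling $-2m\,y_0y_1$ produces $-2m\,y_1^2$, which cancels the surplus
    -- $\beta y_1^2$ of the shorter chain.
    set m : ℝ := β / 2 with hm
    -- Large enough for $c\,y_0^2$ to dominate the cross terms of the form and of its weighted
    -- version, after Young's inequality has put $\kappa/4$ on the tail.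
    set c : ℝ := max ((2 * m) ^ 2 / κ + κ / 2) (((m * (w 0 + w 1)) ^ 2 / κ + κ / 2) / w 0) with hc
    have hc1 : (2 * m) ^ 2 / κ + κ / 2 ≤ c := le_max_left _ _
    have hc2 : (m * (w 0 + w 1)) ^ 2 / κ + κ / 2 ≤ c * w 0 := by
      rw [← div_le_iff₀ hw0]; exact le_max_right _ _
    refine ⟨extendForm c m P, (2 * c - 2 * ρ * (m * (w 0 + w 1))) ^ 2 / κ + (2 * m) ^ 2 / κ +
      2 * ρ * (c * w 0) + κ / 2, κ / 2, extendForm_isSymm c m hP, by positivity, fun y => ?_⟩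
    obtain ⟨h1, h2, h3⟩ := hy (Fin.tail y)
    have hS0 := dotProduct_self_nonneg' (Fin.tail y)
    have hY0 : (Fin.tail y 0) ^ 2 ≤ Fin.tail y ⬝ᵥ Fin.tail y := by
      rw [sq]
      exact Finset.single_le_sum (f := fun i => Fin.tail y i * Fin.tail y i)
        (fun i _ => mul_self_nonneg _) (Finset.mem_univ 0)
    have hJ0 := dotProduct_chainShift_le (Fin.tail y)
    have htw : Fin.tail (fun j : Fin (M + 2) => w j * y j) = fun j : Fin (M + 1) =>
        w (j + 1) * Fin.tail y j := by
      ext j; simp [Fin.tail]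
    have htw0 : Fin.tail (fun j : Fin (M + 2) => w j * y j) 0 = w 1 * Fin.tail y 0 := by
      simp [Fin.tail]
    simp only [dotProduct_extendForm, dotProduct_self_succ, tail_chainShift, chainShift_zero, htw0]
    rw [htw]
    simp only [Fin.val_zero]
    set S := Fin.tail y ⬝ᵥ Fin.tail y
    set Y := Fin.tail y 0
    set Z := chainShift (Fin.tail y) 0
    set a := y 0
    have hs : ∀ p : ℝ, (p * a) ^ 2 / κ = p ^ 2 / κ * a ^ 2 := fun p => by ring
    refine ⟨?_, ?_, ?_⟩
    · have e := mul_le_sq_div_add (p := (2 * m) * a) hκ hY0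
      rw [hs] at e
      nlinarith [sq_nonneg a]
    · have e := mul_le_sq_div_add (p := (m * (w 0 + w 1)) * a) hκ hY0
      rw [hs] at e
      nlinarith [sq_nonneg a]
    · have e1 := mul_le_sq_div_add (p := (2 * c - 2 * ρ * (m * (w 0 + w 1))) * a) hκ hY0
      have e2 := mul_le_sq_div_add (p := -(2 * m) * a) hκ hJ0
      rw [hs] at e1 e2
      have e3 : (-(2 * m)) ^ 2 = (2 * m) ^ 2 := by ring
      rw [e3] at e2
      have hβ : β = 2 * m := by rw [hm]; ring
      rw [hβ] at h3
      nlinarith [sq_nonneg a]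

/-! ### Solvability of the augmented matrix inequality -/

section Aug
variable {n k : ℕ} {C : Matrix (Fin k) (Fin n) ℝ} {A₀ Gd : Matrix (Fin n) (Fin n) ℝ} {ν : ℝ}
  {N : ℕ}

theorem dotProduct_mulVec_transpose {ι : Type*} [Fintype ι] (z : ι → ℝ) (X : Matrix ι ι ℝ) :
    z ⬝ᵥ (Xᵀ *ᵥ z) = z ⬝ᵥ (X *ᵥ z) := by
  rw [Matrix.mulVec_transpose, dotProduct_comm, ← Matrix.dotProduct_mulVec]

theorem solvesLMI_iff {ρ : ℝ} {P : Matrix (Fin k ⊕ Fin n) (Fin k ⊕ Fin n) ℝ}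
    {Y : Matrix (Fin k ⊕ Fin n) (Fin k) ℝ} : SolvesLMI C A₀ Gd ρ P Y ↔
      (-(P * barA C A₀ + (barA C A₀)ᵀ * P + Y * (barC : Matrix (Fin k) (Fin k ⊕ Fin n) ℝ)
        + (barC : Matrix (Fin k) (Fin k ⊕ Fin n) ℝ)ᵀ * Yᵀ
        + ρ • (P * barG (k := k) Gd + (barG (k := k) Gd)ᵀ * P))).PosSemidef ∧
      (P * barG (k := k) Gd + (barG (k := k) Gd)ᵀ * P).PosDef ∧ P.PosDef :=
  Iff.rfl

/-- For each output channel $i$, the map $R_i$ conjugates $\bar A_0$ to the chain shift and $\bar G$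
to the diagonal of weights. The chain solution $Q$ therefore gives $\bar P=\sum_iR_i^\top QR_i$,
definite by joint injectivity of the rows, and $\bar Y=-\frac\beta2\bar C^\top$ cancels $\beta
y_0^2$ in every channel. -/
theorem IsGradedPair.exists_solvesLMI (h : IsGradedPair C A₀ Gd ν N) (ρ : ℝ) :
    ∃ (P : Matrix (Fin k ⊕ Fin n) (Fin k ⊕ Fin n) ℝ) (Y : Matrix (Fin k ⊕ Fin n) (Fin k) ℝ),
      SolvesLMI C A₀ Gd ρ P Y := by
  obtain ⟨Q, β, κ, hQ, hκ, hy⟩ := exists_chain_lmi ρ N (fun m => 1 + ν * (m : ℝ)) h.weight_pos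
  let R : Fin k → Matrix (Fin (N + 1)) (Fin k ⊕ Fin n) ℝ := fun i =>
    Matrix.of fun m j => augRow C A₀ m i j
  have hR : ∀ i z m, (R i *ᵥ z) m = (augRow C A₀ m *ᵥ z) i := fun i z m => rfl
  have hRG : ∀ i z, R i *ᵥ (barG (k := k) Gd *ᵥ z) =
      fun m : Fin (N + 1) => (1 + ν * ((m : ℕ) : ℝ)) * (R i *ᵥ z) m := by
    intro i z
    ext m
    rw [hR, hR, Matrix.mulVec_mulVec, h.augRow_mul_barG, Matrix.smul_mulVec]
    rfl
  have hRA : ∀ i z, R i *ᵥ (barA C A₀ *ᵥ z) = chainShift (R i *ᵥ z) := by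
    intro i z
    ext m
    rw [hR, Matrix.mulVec_mulVec, augRow_mul_barA, chainShift]
    split_ifs with hm
    · rw [hR]
    · have : (m : ℕ) = N := by omega
      rw [this, h.augRow_nilp]; simp
  have hR0 : ∀ i z, (R i *ᵥ z) 0 = (barC (n := n) (k := k) *ᵥ z) i := fun i z => rfl
  have hdot : ∀ (X : Matrix (Fin k ⊕ Fin n) (Fin k ⊕ Fin n) ℝ) z,
      z ⬝ᵥ (((∑ i, (R i)ᵀ * Q * R i) * X) *ᵥ z) = ∑ i, (R i *ᵥ z) ⬝ᵥ (Q *ᵥ (R i *ᵥ (X *ᵥ z))) := by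
    intro X z
    rw [← Matrix.mulVec_mulVec, Matrix.sum_mulVec, dotProduct_sum]
    refine Finset.sum_congr rfl fun i _ => ?_
    rw [Matrix.mul_assoc, ← Matrix.mulVec_mulVec, ← Matrix.mulVec_mulVec, Matrix.dotProduct_mulVec,
      Matrix.vecMul_transpose]
  set P : Matrix (Fin k ⊕ Fin n) (Fin k ⊕ Fin n) ℝ := ∑ i, (R i)ᵀ * Q * R i with hPdef
  have hP : Pᵀ = P := by
    rw [hPdef, Matrix.transpose_sum]
    refine Finset.sum_congr rfl fun i _ => ?_
    rw [Matrix.transpose_mul, Matrix.transpose_mul, Matrix.transpose_transpose, hQ, Matrix.mul_assoc]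
  have hpos : ∀ z : Fin k ⊕ Fin n → ℝ, z ≠ 0 → 0 < ∑ i, κ * ((R i *ᵥ z) ⬝ᵥ (R i *ᵥ z)) := by
    intro z hz
    have hnn : ∀ i, 0 ≤ κ * ((R i *ᵥ z) ⬝ᵥ (R i *ᵥ z)) := fun i =>
      mul_nonneg hκ.le (dotProduct_self_nonneg' _)
    refine lt_of_le_of_ne (Finset.sum_nonneg fun i _ => hnn i) fun h0 => hz ?_
    have h1 := (Finset.sum_eq_zero_iff_of_nonneg fun i _ => hnn i).1 h0.symm
    refine h.augRow_inj fun m hm => ?_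
    ext i
    have h2 : R i *ᵥ z = 0 := by
      have := h1 i (Finset.mem_univ i)
      exact dotProduct_self_eq_zero.1 ((mul_eq_zero.1 this).resolve_left hκ.ne')
    have := congrFun h2 ⟨m, by omega⟩
    rw [hR] at this
    exact this
  refine ⟨P, (-(β / 2)) • barCᵀ, solvesLMI_iff.2 ⟨?_, ?_, ?_⟩⟩
  · refine PosSemidef.of_dotProduct_mulVec_nonneg ?_ fun z => ?_
    · rw [Matrix.IsHermitian, Matrix.conjTranspose_eq_transpose_of_trivial]
      simp only [Matrix.transpose_neg, Matrix.transpose_add, Matrix.transpose_mul,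
        Matrix.transpose_smul, Matrix.transpose_transpose, hP]
      abel_nf
    · have e1 : z ⬝ᵥ (((barA C A₀)ᵀ * P) *ᵥ z) = z ⬝ᵥ ((P * barA C A₀) *ᵥ z) := by
        rw [← dotProduct_mulVec_transpose, Matrix.transpose_mul, hP, Matrix.transpose_transpose]
      have e2 : z ⬝ᵥ (((barG (k := k) Gd)ᵀ * P) *ᵥ z) = z ⬝ᵥ ((P * barG (k := k) Gd) *ᵥ z) := by
        rw [← dotProduct_mulVec_transpose, Matrix.transpose_mul, hP, Matrix.transpose_transpose]
      have e3 : z ⬝ᵥ (((barC : Matrix (Fin k) (Fin k ⊕ Fin n) ℝ)ᵀ *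
          (barC : Matrix (Fin k) (Fin k ⊕ Fin n) ℝ)) *ᵥ z) = ∑ i, (R i *ᵥ z) 0 ^ 2 := by
        rw [← Matrix.mulVec_mulVec, Matrix.dotProduct_mulVec, Matrix.vecMul_transpose]
        refine Finset.sum_congr rfl fun i _ => ?_
        rw [hR0, sq]
      simp only [star_trivial, Matrix.neg_mulVec, Matrix.add_mulVec, Matrix.smul_mul,
        Matrix.mul_smul, Matrix.transpose_smul, Matrix.transpose_transpose, Matrix.smul_mulVec,
        dotProduct_neg, dotProduct_add, dotProduct_smul, smul_eq_mul, e1, e2, e3, hdot, hRG, hRA]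
      have h1 : ∑ i, (2 * ((R i *ᵥ z) ⬝ᵥ (Q *ᵥ chainShift (R i *ᵥ z))) + 2 * ρ * ((R i *ᵥ z) ⬝ᵥ
          (Q *ᵥ fun m : Fin (N + 1) => (1 + ν * ((m : ℕ) : ℝ)) * (R i *ᵥ z) m))) ≤
          ∑ i, β * (R i *ᵥ z) 0 ^ 2 := by
        refine Finset.sum_le_sum fun i _ => ((hy (R i *ᵥ z)).2.2).trans ?_
        have := mul_nonneg hκ.le (dotProduct_self_nonneg' (R i *ᵥ z))
        linarith
      rw [Finset.sum_add_distrib, ← Finset.mul_sum, ← Finset.mul_sum, ← Finset.mul_sum] at h1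
      linarith
  · refine PosDef.of_dotProduct_mulVec_pos ?_ fun z hz => ?_
    · rw [Matrix.IsHermitian, Matrix.conjTranspose_eq_transpose_of_trivial]
      simp only [Matrix.transpose_add, Matrix.transpose_mul, Matrix.transpose_transpose, hP]
      abel
    · have e2 : z ⬝ᵥ (((barG (k := k) Gd)ᵀ * P) *ᵥ z) = z ⬝ᵥ ((P * barG (k := k) Gd) *ᵥ z) := by
        rw [← dotProduct_mulVec_transpose, Matrix.transpose_mul, hP, Matrix.transpose_transpose]
      simp only [star_trivial, Matrix.add_mulVec, dotProduct_add, e2, hdot, hRG]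
      have h1 : ∑ i, κ * ((R i *ᵥ z) ⬝ᵥ (R i *ᵥ z)) ≤ ∑ i, ((R i *ᵥ z) ⬝ᵥ
          (Q *ᵥ fun m : Fin (N + 1) => (1 + ν * ((m : ℕ) : ℝ)) * (R i *ᵥ z) m)) :=
        Finset.sum_le_sum fun i _ => (hy (R i *ᵥ z)).2.1
      have h2 := hpos z hz
      linarith
  · refine PosDef.of_dotProduct_mulVec_pos ?_ fun z hz => ?_
    · rw [Matrix.IsHermitian, Matrix.conjTranspose_eq_transpose_of_trivial, hP]
    · have e := hdot 1 z
      simp only [Matrix.mul_one, Matrix.one_mulVec] at e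
      rw [star_trivial, e]
      refine (hpos z hz).trans_le ?_
      exact Finset.sum_le_sum fun i _ => (hy (R i *ᵥ z)).1

end Aug

/-! ### Continuity of the error field -/

section Cont
variable {n k : ℕ} {C : Matrix (Fin k) (Fin n) ℝ} {A₀ Gd : Matrix (Fin n) (Fin n) ℝ} {ν : ℝ}
  {N : ℕ}

theorem continuous_psiPart : Continuous (psiPart (n := n) (k := k)) := by
  unfold psiPart; fun_prop

theorem continuous_zPart : Continuous (zPart (n := n) (k := k)) := by
  unfold zPart; fun_prop

theorem continuous_xiPart : Continuous (xiPart (n := n) (k := k)) := by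
  unfold xiPart; fun_prop

theorem continuous_sigmaAt : Continuous (sigmaAt (n := n) (k := k)) := by
  have h1 := continuous_psiPart (n := n) (k := k)
  have h2 := continuous_xiPart (n := n) (k := k)
  unfold sigmaAt sigmaOf
  exact (h2.max ((h1.dotProduct h1).div_const 2)).sqrt

theorem sigmaAt_nonneg (x : ErrIdx n k → ℝ) : 0 ≤ sigmaAt x := sigmaOf_nonneg _ _

/-- Since $|\psi|\le2\sigma$, the possibly singular factor $\sigma^{a-1}$ is compensated by $\psi$.
At $\sigma=0$ the left side vanishes with $\psi$. -/
theorem abs_sigma_rpow_mul_le (a : ℝ) (l : (Fin k → ℝ) →L[ℝ] ℝ) (x : ErrIdx n k → ℝ) :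
    |sigmaAt x ^ (a - 1) * l (psiPart x)| ≤ 2 * ‖l‖ * sigmaAt x ^ a := by
  have hb : ‖psiPart x‖ ≤ 2 * sigmaAt x := norm_le_two_mul_sigmaOf _ _
  rcases (sigmaAt_nonneg x).eq_or_lt with h0 | h0
  · have : psiPart x = 0 := eq_zero_of_sigmaOf_eq_zero h0.symm
    rw [this, map_zero, mul_zero, abs_zero]
    have := Real.rpow_nonneg (sigmaAt_nonneg x) a
    positivity
  · have hl := l.le_opNorm (psiPart x)
    rw [abs_mul, abs_of_nonneg (Real.rpow_nonneg h0.le _)]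
    have h2 : sigmaAt x ^ a = sigmaAt x ^ (a - 1) * sigmaAt x := by
      rw [Real.rpow_sub_one h0.ne']; field_simp
    rw [h2]
    calc _ ≤ sigmaAt x ^ (a - 1) * (‖l‖ * (2 * sigmaAt x)) := by
          refine mul_le_mul_of_nonneg_left (hl.trans ?_) (Real.rpow_nonneg h0.le _)
          exact mul_le_mul_of_nonneg_left hb (norm_nonneg l)
      _ = _ := by ring

theorem continuousAt_sigma_rpow_mul {a : ℝ} (l : (Fin k → ℝ) →L[ℝ] ℝ) {x : ErrIdx n k → ℝ}
    (ha : 0 < a ∨ sigmaAt x ≠ 0) :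
    ContinuousAt (fun x : ErrIdx n k → ℝ => sigmaAt x ^ (a - 1) * l (psiPart x)) x := by
  by_cases h0 : sigmaAt x = 0
  · have ha' := ha.resolve_right (not_not.2 h0)
    have hψ : psiPart x = 0 := eq_zero_of_sigmaOf_eq_zero h0
    have h1 : Tendsto (fun x : ErrIdx n k → ℝ => 2 * ‖l‖ * sigmaAt x ^ a) (𝓝 x) (𝓝 0) := by
      have : Continuous fun x : ErrIdx n k → ℝ => 2 * ‖l‖ * sigmaAt x ^ a :=
        continuous_const.mul (continuous_sigmaAt.rpow_const fun _ => Or.inr ha'.le)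
      have h2 := this.tendsto x
      rwa [h0, Real.zero_rpow ha'.ne', mul_zero] at h2
    rw [ContinuousAt, hψ, map_zero, mul_zero]
    exact squeeze_zero_norm (fun y => abs_sigma_rpow_mul_le a l y) h1
  · exact (continuous_sigmaAt.continuousAt.rpow_const (Or.inl h0)).mul
      (l.continuous.comp continuous_psiPart).continuousAt

namespace IsGradedPair
variable (h : IsGradedPair C A₀ Gd ν N) (Lt : Matrix (Fin k) (Fin k) ℝ)
  (L : Matrix (Fin n) (Fin k) ℝ) (γ : ℝ)
include h

/-- On the rows the matrix $\mathbf d(\ln\sigma)$ becomes a scalar power of $\sigma$, leaving a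
chain of integrators with injection $\sigma^{\nu(m+1)}$ times a linear function of $\psi$. -/
theorem augRow_errorField (m : ℕ) (x : ErrIdx n k → ℝ) :
    augRow C A₀ m *ᵥ zPart (errorField C A₀ Gd Lt L ν γ x) =
      augRow C A₀ (m + 1) *ᵥ zPart x + sigmaAt x ^ ((1 + ν * ((m : ℝ) + 1)) - 1) •
        ((augRow C A₀ m * fromRows Lt L) *ᵥ psiPart x) := by
  cases m with
  | zero =>
    have e : augRow C A₀ 0 *ᵥ zPart (errorField C A₀ Gd Lt L ν γ x) =
        psiPart (errorField C A₀ Gd Lt L ν γ x) := by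
      simp only [augRow, Matrix.fromCols_mulVec, Matrix.one_mulVec, Matrix.zero_mulVec, add_zero]
      rfl
    rw [e, psiPart_errorField]
    simp only [augRow, Matrix.fromCols_mulVec, Matrix.fromCols_mul_fromRows, Matrix.zero_mulVec,
      zero_add, Matrix.one_mul, Matrix.zero_mul, add_zero, pow_zero, Matrix.mul_one, Nat.cast_zero,
      mul_one, add_sub_cancel_left]
    rfl
  | succ m =>
    have e : ∀ y, augRow C A₀ (m + 1) *ᵥ zPart y = (C * A₀ ^ m) *ᵥ epsPart y := by
      intro y
      simp only [augRow, Matrix.fromCols_mulVec, Matrix.zero_mulVec, zero_add]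
      rfl
    have e2 : augRow C A₀ (m + 1 + 1) *ᵥ zPart x = (C * A₀ ^ (m + 1)) *ᵥ epsPart x := by
      simp only [augRow, Matrix.fromCols_mulVec, Matrix.zero_mulVec, zero_add]
      rfl
    rw [e, e2, epsPart_errorField, Matrix.mulVec_add, Matrix.mulVec_mulVec, Matrix.mul_assoc,
      ← pow_succ, Matrix.mulVec_smul, Matrix.mulVec_mulVec, h.row_mul_linearGroup,
      Matrix.smul_mulVec, smul_smul]
    congr 1
    simp only [augRow, Matrix.fromCols_mul_fromRows, Matrix.zero_mul, zero_add]
    rw [Matrix.mulVec_mulVec]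
    rcases (sigmaAt_nonneg x).eq_or_lt with h0 | h0
    · have : psiPart x = 0 := eq_zero_of_sigmaOf_eq_zero h0.symm
      simp [this]
    · congr 1
      rw [← Real.rpow_def_of_pos h0, ← Real.rpow_add h0]
      congr 1
      push_cast; ring

theorem one_add_pos : 0 < 1 + ν := by
  simpa using h.weight_pos 1 h.index_pos

theorem continuousAt_augRow {m : ℕ} (i : Fin k) {x : ErrIdx n k → ℝ}
    (hm : 0 < 1 + ν * ((m : ℝ) + 1) ∨ sigmaAt x ≠ 0) :
    ContinuousAt (fun x => (augRow C A₀ m *ᵥ zPart (errorField C A₀ Gd Lt L ν γ x)) i) x := by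
  let l : (Fin k → ℝ) →L[ℝ] ℝ := (ContinuousLinearMap.proj i).comp
    (LinearMap.toContinuousLinearMap (augRow C A₀ m * fromRows Lt L).mulVecLin)
  have h1 := continuousAt_sigma_rpow_mul l hm
  have h2 : Continuous fun x : ErrIdx n k → ℝ => (augRow C A₀ (m + 1) *ᵥ zPart x) i :=
    (continuous_apply i).comp (continuous_const.matrix_mulVec continuous_zPart)
  refine (h2.continuousAt.add h1).congr (Eventually.of_forall fun y => ?_)
  simp only [h.augRow_errorField]
  rfl

omit h in
theorem continuous_signedPow {a : ℝ} (ha : 0 < a) : Continuous fun r : ℝ => signedPow r a := by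
  rw [continuous_iff_continuousAt]
  intro r
  unfold signedPow
  rcases lt_trichotomy r 0 with hr | hr | hr
  · have h1 : ContinuousAt (fun r : ℝ => |r| ^ a * (-1)) r :=
      ((continuous_abs.rpow_const fun _ => Or.inr ha.le).mul continuous_const).continuousAt
    refine h1.congr ?_
    filter_upwards [Iio_mem_nhds hr] with y hy
    rw [Real.sign_of_neg hy]
  · subst hr
    rw [ContinuousAt, Real.sign_zero, mul_zero]
    have h1 : Tendsto (fun r : ℝ => |r| ^ a) (𝓝 0) (𝓝 0) := by
      have := (continuous_abs.rpow_const (p := a) fun _ => Or.inr ha.le).tendsto (0 : ℝ)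
      rwa [abs_zero, Real.zero_rpow ha.ne'] at this
    refine squeeze_zero_norm (fun y => ?_) h1
    rw [norm_mul, Real.norm_eq_abs, abs_of_nonneg (Real.rpow_nonneg (abs_nonneg y) a)]
    have : ‖Real.sign y‖ ≤ 1 := by
      rcases Real.sign_apply_eq y with e | e | e <;> simp [e]
    nlinarith [Real.rpow_nonneg (abs_nonneg y) a]
  · have h1 : ContinuousAt (fun r : ℝ => |r| ^ a * 1) r :=
      ((continuous_abs.rpow_const fun _ => Or.inr ha.le).mul continuous_const).continuousAt
    refine h1.congr ?_
    filter_upwards [Ioi_mem_nhds hr] with y hy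
    rw [Real.sign_of_pos hy]

theorem continuous_psiPart_errorField :
    Continuous fun x => psiPart (errorField C A₀ Gd Lt L ν γ x) := by
  refine continuous_pi fun i => continuous_iff_continuousAt.2 fun x => ?_
  refine (h.continuousAt_augRow Lt L γ (m := 0) i
    (Or.inl (by simpa using h.one_add_pos))).congr (Eventually.of_forall fun y => ?_)
  simp only [augRow, Matrix.fromCols_mulVec, Matrix.one_mulVec, Matrix.zero_mulVec, add_zero]
  rfl

theorem continuous_xiPart_errorField :
    Continuous fun x => xiPart (errorField C A₀ Gd Lt L ν γ x) := by
  have h1 := h.continuous_psiPart_errorField Lt L γ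
  have h2 := continuous_psiPart (n := n) (k := k)
  have h3 := continuous_signedPow (a := ν / 2 + 1) (by linarith [h.one_add_pos])
  exact ((h2.dotProduct h1).abs).sub (continuous_const.mul (h3.comp
    (continuous_xiPart.sub ((h2.dotProduct h2).div_const 2))))

/-- The velocity of row $m$ has degree $1+\nu(m+1)$, which is positive for $m<N$; only the row $m=N$
needs the stated alternative. -/
theorem continuousAt_errorField {x : ErrIdx n k → ℝ}
    (hx : 0 < 1 + ν * ((N : ℝ) + 1) ∨ sigmaAt x ≠ 0) :
    ContinuousAt (errorField C A₀ Gd Lt L ν γ) x := by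
  obtain ⟨O, B, hB, h1, h2⟩ := h.exists_coords
  have hg : ∀ y : ErrIdx n k → ℝ, y = B *ᵥ (O *ᵥ y) := fun y => by
    rw [Matrix.mulVec_mulVec, hB, Matrix.one_mulVec]
  have h3 : ContinuousAt (fun y => O *ᵥ errorField C A₀ Gd Lt L ν γ y) x := by
    refine continuousAt_pi.2 fun j => ?_
    rcases j with p | j
    · simp only [h1]
      refine h.continuousAt_augRow Lt L γ p.2 (hx.imp_left fun hN => ?_)
      rcases (Nat.lt_succ_iff.1 p.1.2).lt_or_eq with hp | hp
      · exact_mod_cast h.weight_pos (p.1 + 1) hp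
      · rw [hp]; exact hN
    · simp only [h2]
      exact (h.continuous_xiPart_errorField Lt L γ).continuousAt
  have h4 : Continuous fun v : (Fin (N + 1) × Fin k) ⊕ Fin 1 → ℝ => B *ᵥ v :=
    continuous_const.matrix_mulVec continuous_id
  exact (h4.continuousAt.comp h3).congr (Eventually.of_forall fun y => (hg _).symm)

theorem exists_norm_errorField_le (R : ℝ) :
    ∃ M : ℝ, ∀ x : ErrIdx n k → ℝ, ‖x‖ ≤ R → ‖errorField C A₀ Gd Lt L ν γ x‖ ≤ M := by
  obtain ⟨O, B, hB, h1, h2⟩ := h.exists_coords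
  have hcoord : ∀ j, ∃ M : ℝ, 0 ≤ M ∧ ∀ x : ErrIdx n k → ℝ, ‖x‖ ≤ R →
      |(O *ᵥ errorField C A₀ Gd Lt L ν γ x) j| ≤ M := by
    intro j
    have key : ∀ D : (ErrIdx n k → ℝ) → ℝ, Continuous D → (∀ x,
        |(O *ᵥ errorField C A₀ Gd Lt L ν γ x) j| ≤ D x) → ∃ M : ℝ, 0 ≤ M ∧
        ∀ x : ErrIdx n k → ℝ, ‖x‖ ≤ R → |(O *ᵥ errorField C A₀ Gd Lt L ν γ x) j| ≤ M := by
      intro D hD hle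
      obtain ⟨M, hM⟩ := (isCompact_closedBall (0 : ErrIdx n k → ℝ) R).exists_bound_of_continuousOn
        hD.continuousOn
      refine ⟨max M 0, le_max_right _ _, fun x hx => ?_⟩
      exact ((hle x).trans (le_abs_self _)).trans ((hM x (by simpa using hx)).trans
        (le_max_left _ _))
    rcases j with p | j
    · let l : (Fin k → ℝ) →L[ℝ] ℝ := (ContinuousLinearMap.proj p.2).comp
        (LinearMap.toContinuousLinearMap (augRow C A₀ p.1 * fromRows Lt L).mulVecLin)
      have ha : 0 ≤ 1 + ν * (((p.1 : ℕ) : ℝ) + 1) := by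
        rcases (Nat.lt_succ_iff.1 p.1.2).lt_or_eq with hp | hp
        · exact_mod_cast (h.weight_pos (p.1 + 1) hp).le
        · rw [hp]; exact h.weight_nonneg
      refine key (fun x => |(augRow C A₀ (p.1 + 1) *ᵥ zPart x) p.2| +
        2 * ‖l‖ * sigmaAt x ^ (1 + ν * (((p.1 : ℕ) : ℝ) + 1))) ?_ fun x => ?_
      · refine Continuous.add ?_ ?_
        · exact ((continuous_apply p.2).comp
            (continuous_const.matrix_mulVec continuous_zPart)).abs
        · exact continuous_const.mul (continuous_sigmaAt.rpow_const fun _ => Or.inr ha)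
      · rw [h1, h.augRow_errorField]
        refine (abs_add_le _ _).trans ?_
        gcongr
        exact abs_sigma_rpow_mul_le _ l x
    · refine key (fun x => |xiPart (errorField C A₀ Gd Lt L ν γ x)|)
        (h.continuous_xiPart_errorField Lt L γ).abs fun x => ?_
      rw [h2]
  choose M hM0 hM using hcoord
  let l : ((Fin (N + 1) × Fin k) ⊕ Fin 1 → ℝ) →L[ℝ] (ErrIdx n k → ℝ) :=
    LinearMap.toContinuousLinearMap B.mulVecLin
  refine ⟨‖l‖ * ∑ j, M j, fun x hx => ?_⟩
  have e : errorField C A₀ Gd Lt L ν γ x = l (O *ᵥ errorField C A₀ Gd Lt L ν γ x) := by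
    change _ = B *ᵥ _
    rw [Matrix.mulVec_mulVec, hB, Matrix.one_mulVec]
  rw [e]
  refine (l.le_opNorm _).trans (mul_le_mul_of_nonneg_left ?_ (norm_nonneg _))
  refine (pi_norm_le_iff_of_nonneg (Finset.sum_nonneg fun j _ => hM0 j)).2 fun j => ?_
  exact (hM j x hx).trans (Finset.single_le_sum (f := M) (fun j _ => hM0 j) (Finset.mem_univ j))

/-- $\sigma=0$ forces $\psi=0$, so the set lies in a coordinate hyperplane; there is at least one
output coordinate. -/
theorem volume_sigmaAt_eq_zero : volume {x : ErrIdx n k → ℝ | 0 < sigmaAt x}ᶜ = 0 := by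
  let i : Fin k := ⟨0, h.dim_pos⟩
  let l : (ErrIdx n k → ℝ) →ₗ[ℝ] ℝ := LinearMap.proj (Sum.inl (Sum.inl i))
  have hl : LinearMap.ker l ≠ ⊤ := by
    intro hk
    have : (fun _ => 1 : ErrIdx n k → ℝ) ∈ LinearMap.ker l := by rw [hk]; trivial
    simp [l] at this
  refine measure_mono_null (fun x hx => ?_) (Measure.addHaar_submodule volume _ hl)
  have h0 : sigmaAt x = 0 := le_antisymm (not_lt.1 hx) (sigmaAt_nonneg x)
  have hψ : psiPart x = 0 := eq_zero_of_sigmaOf_eq_zero h0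
  exact congrFun hψ i

omit h in
theorem isConnected_sigmaAt_pos : IsConnected {x : ErrIdx n k → ℝ | 0 < sigmaAt x} := by
  have hpos : ∀ x : ErrIdx n k → ℝ, 0 < sigmaAt x ↔ psiPart x ≠ 0 ∨ 0 < xiPart x := by
    intro x
    rw [sigmaAt, sigmaOf, Real.sqrt_pos, lt_max_iff, or_comm]
    have : 0 < psiPart x ⬝ᵥ psiPart x / 2 ↔ psiPart x ≠ 0 := by
      rw [← dotProduct_self_eq_zero.ne, lt_iff_le_and_ne]
      have := dotProduct_self_nonneg' (psiPart x)
      constructor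
      · rintro ⟨-, h2⟩ h3; apply h2; rw [h3]; simp
      · intro h2
        exact ⟨by linarith, fun h3 => h2 (by linarith)⟩
    rw [this]
  -- The point $\psi=0$, $\varepsilon=0$, $\xi=1$, about which the set where $\psi\ne0$ or $\xi>0$
  -- is star-shaped.
  let p : ErrIdx n k → ℝ := Sum.elim 0 1
  have hstar : StarConvex ℝ p {x : ErrIdx n k → ℝ | 0 < sigmaAt x} := by
    intro y hy a b ha hb hab
    change 0 < sigmaAt _
    rw [hpos]
    have e1 : psiPart (a • p + b • y) = b • psiPart y := by
      ext i; simp [psiPart, p]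
    have e2 : xiPart (a • p + b • y) = a + b * xiPart y := by
      simp [xiPart, p]
    rw [e1, e2]
    rcases hb.eq_or_lt with hb0 | hb0
    · right; rw [← hb0] at hab ⊢; linarith
    rcases (hpos y).1 hy with h1 | h1
    · left; exact smul_ne_zero hb0.ne' h1
    · right; positivity
  refine (hstar.isPathConnected ?_).isConnected
  change 0 < sigmaAt p
  rw [hpos]
  right
  simp [xiPart, p]

theorem isPiecewiseContinuous : IsPiecewiseContinuous (errorField C A₀ Gd Lt L ν γ) := by
  refine ⟨h.exists_norm_errorField_le Lt L γ, 1, fun _ => {x | 0 < sigmaAt x}, fun _ => ⟨?_, ?_⟩,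
    ?_, ?_, fun _ x hx => ?_⟩
  · exact isOpen_lt continuous_const continuous_sigmaAt
  · exact isConnected_sigmaAt_pos
  · intro i j hij
    exact absurd (Subsingleton.elim i j) hij
  · rw [Set.iUnion_const]
    exact h.volume_sigmaAt_eq_zero
  · exact (h.continuousAt_errorField Lt L γ (Or.inr (ne_of_gt hx))).continuousWithinAt

theorem aestronglyMeasurable_errorField :
    AEStronglyMeasurable (errorField C A₀ Gd Lt L ν γ) volume := by
  have h1 : ContinuousOn (errorField C A₀ Gd Lt L ν γ) {x | 0 < sigmaAt x} := fun x hx =>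
    (h.continuousAt_errorField Lt L γ (Or.inr (ne_of_gt hx))).continuousWithinAt
  have h2 := h1.aestronglyMeasurable (μ := volume)
    (isOpen_lt continuous_const continuous_sigmaAt).measurableSet
  rwa [Measure.restrict_eq_self_of_ae_mem] at h2
  exact measure_eq_zero_iff_ae_notMem.1 h.volume_sigmaAt_eq_zero |>.mono fun x hx => by
    simpa using hx

end IsGradedPair
end Cont

/-! ### A homogeneous gauge and the growth of solutions -/

section Gauge
variable {n k : ℕ}

/-- The graded coordinate `(m, i)` of the error state as a continuous linear functional. -/
def augCoord (C : Matrix (Fin k) (Fin n) ℝ) (A₀ : Matrix (Fin n) (Fin n) ℝ) (m : ℕ) (i : Fin k) :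
    (ErrIdx n k → ℝ) →L[ℝ] ℝ :=
  LinearMap.toContinuousLinearMap
    ((LinearMap.proj i ∘ₗ (augRow C A₀ m).mulVecLin) ∘ₗ LinearMap.funLeft ℝ ℝ Sum.inl)

/-- The coordinate `ξ` of the error state as a continuous linear functional. -/
def xiCoord : (ErrIdx n k → ℝ) →L[ℝ] ℝ := ContinuousLinearMap.proj (Sum.inr 0)

/-- A homogeneous positive definite function of degree four. -/
def gauge4 (C : Matrix (Fin k) (Fin n) ℝ) (A₀ : Matrix (Fin n) (Fin n) ℝ) (ν : ℝ) (N : ℕ)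
    (x : ErrIdx n k → ℝ) : ℝ :=
  ∑ p : Fin (N + 1) × Fin k, |augCoord C A₀ p.1 p.2 x| ^ (4 / (1 + ν * ((p.1 : ℕ) : ℝ))) +
    |xiCoord x| ^ (2 : ℝ)

variable {C : Matrix (Fin k) (Fin n) ℝ} {A₀ Gd : Matrix (Fin n) (Fin n) ℝ} {ν : ℝ} {N : ℕ}

theorem augCoord_apply (m : ℕ) (i : Fin k) (x : ErrIdx n k → ℝ) :
    augCoord C A₀ m i x = (augRow C A₀ m *ᵥ zPart x) i := rfl

theorem xiCoord_apply (x : ErrIdx n k → ℝ) : xiCoord x = xiPart x := rfl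

theorem gauge4_nonneg (x : ErrIdx n k → ℝ) : 0 ≤ gauge4 C A₀ ν N x := by
  unfold gauge4; positivity

theorem abs_augCoord_rpow_le (p : Fin (N + 1) × Fin k) (x : ErrIdx n k → ℝ) :
    |augCoord C A₀ p.1 p.2 x| ^ (4 / (1 + ν * ((p.1 : ℕ) : ℝ))) ≤ gauge4 C A₀ ν N x := by
  have h1 := Finset.single_le_sum
    (f := fun p : Fin (N + 1) × Fin k =>
      |augCoord C A₀ p.1 p.2 x| ^ (4 / (1 + ν * ((p.1 : ℕ) : ℝ))))
    (fun p _ => by positivity) (Finset.mem_univ p)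
  have h2 : 0 ≤ |xiCoord x| ^ (2 : ℝ) := by positivity
  unfold gauge4
  linarith

theorem abs_xiCoord_rpow_le (x : ErrIdx n k → ℝ) :
    |xiCoord x| ^ (2 : ℝ) ≤ gauge4 C A₀ ν N x := by
  unfold gauge4
  have : 0 ≤ ∑ p : Fin (N + 1) × Fin k,
      |augCoord C A₀ p.1 p.2 x| ^ (4 / (1 + ν * ((p.1 : ℕ) : ℝ))) :=
    Finset.sum_nonneg fun p _ => by positivity
  linarith

theorem abs_xiCoord_le {T : ℝ} {x : ErrIdx n k → ℝ} (hT : gauge4 C A₀ ν N x ≤ T) :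
    |xiCoord x| ≤ T ^ (1 / 2 : ℝ) := by
  have h1 := (abs_xiCoord_rpow_le x).trans hT
  have h2 := Real.rpow_le_rpow (by positivity) h1 (z := 1 / 2) (by norm_num)
  rwa [← Real.rpow_mul (abs_nonneg _), show (2 : ℝ) * (1 / 2) = 1 by norm_num, Real.rpow_one] at h2

namespace IsGradedPair
variable (h : IsGradedPair C A₀ Gd ν N)
include h

theorem weight_pos' (p : Fin (N + 1) × Fin k) : 0 < 1 + ν * ((p.1 : ℕ) : ℝ) :=
  h.weight_pos p.1 (by omega)

theorem weight_succ_nonneg (p : Fin (N + 1) × Fin k) : 0 ≤ 1 + ν * ((p.1 : ℕ) : ℝ) + ν := by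
  rcases (Nat.lt_succ_iff.1 p.1.2).lt_or_eq with hp | hp
  · have := h.weight_pos (p.1 + 1) hp
    push_cast at this
    linarith
  · have := h.weight_nonneg
    rw [hp]; linarith

theorem abs_augCoord_le {T : ℝ} (p : Fin (N + 1) × Fin k) {x : ErrIdx n k → ℝ}
    (hT : gauge4 C A₀ ν N x ≤ T) :
    |augCoord C A₀ p.1 p.2 x| ≤ T ^ ((1 + ν * ((p.1 : ℕ) : ℝ)) / 4) := by
  have hw := h.weight_pos' p
  have h1 := (abs_augCoord_rpow_le p x).trans hT
  have h2 := Real.rpow_le_rpow (by positivity) h1 (z := (1 + ν * ((p.1 : ℕ) : ℝ)) / 4)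
    (by positivity)
  rwa [← Real.rpow_mul (abs_nonneg _), div_mul_div_comm, mul_comm, div_self (by positivity),
    Real.rpow_one] at h2

theorem gauge4_dSigma (s : ℝ) (x : ErrIdx n k → ℝ) :
    gauge4 C A₀ ν N (dSigma Gd s *ᵥ x) = Real.exp (4 * s) * gauge4 C A₀ ν N x := by
  unfold gauge4
  rw [mul_add, Finset.mul_sum]
  congr 1
  · refine Finset.sum_congr rfl fun p _ => ?_
    have hw := h.weight_pos' p
    rw [augCoord_apply, augCoord_apply, zPart_dSigma, Matrix.mulVec_mulVec,
      h.augRow_mul_linearGroup, Matrix.smul_mulVec, Pi.smul_apply, smul_eq_mul, abs_mul,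
      abs_of_pos (Real.exp_pos _), Real.mul_rpow (Real.exp_pos _).le (abs_nonneg _), ← Real.exp_mul]
    congr 2
    field_simp
  · rw [xiCoord_apply, xiCoord_apply, xiPart_dSigma, abs_mul, abs_of_pos (Real.exp_pos _),
      Real.mul_rpow (Real.exp_pos _).le (abs_nonneg _), ← Real.exp_mul]
    congr 2
    ring

theorem exists_norm_le_of_gauge4_le (c : ℝ) :
    ∃ R : ℝ, ∀ x : ErrIdx n k → ℝ, gauge4 C A₀ ν N x ≤ c → ‖x‖ ≤ R := by
  obtain ⟨O, B, hB, h1, h2⟩ := h.exists_coords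
  let l : ((Fin (N + 1) × Fin k) ⊕ Fin 1 → ℝ) →L[ℝ] (ErrIdx n k → ℝ) :=
    LinearMap.toContinuousLinearMap B.mulVecLin
  let D : ((Fin (N + 1) × Fin k) ⊕ Fin 1) → ℝ :=
    Sum.elim (fun p => |c| ^ ((1 + ν * ((p.1 : ℕ) : ℝ)) / 4)) (fun _ => |c| ^ (1 / 2 : ℝ))
  have hD : ∀ j, 0 ≤ D j := by
    rintro (p | j) <;> simp only [D, Sum.elim_inl, Sum.elim_inr] <;> positivity
  refine ⟨‖l‖ * ∑ j, D j, fun x hx => ?_⟩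
  have hx' := hx.trans (le_abs_self c)
  have e : x = l (O *ᵥ x) := by
    change _ = B *ᵥ _
    rw [Matrix.mulVec_mulVec, hB, Matrix.one_mulVec]
  rw [e]
  refine (l.le_opNorm _).trans (mul_le_mul_of_nonneg_left ?_ (norm_nonneg _))
  refine (pi_norm_le_iff_of_nonneg (Finset.sum_nonneg fun j _ => hD j)).2 fun j => ?_
  refine le_trans ?_ (Finset.single_le_sum (f := D) (fun j _ => hD j) (Finset.mem_univ j))
  rcases j with p | j
  · rw [h1]; exact h.abs_augCoord_le p hx'
  · rw [h2]; exact abs_xiCoord_le hx'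

theorem eq_zero_of_gauge4_eq_zero {x : ErrIdx n k → ℝ} (hx : gauge4 C A₀ ν N x = 0) : x = 0 := by
  obtain ⟨O, B, hB, h1, h2⟩ := h.exists_coords
  have e : O *ᵥ x = 0 := by
    ext j
    rcases j with p | j
    · have := h.abs_augCoord_le p hx.le
      have hw := h.weight_pos' p
      rw [Real.zero_rpow (by positivity), augCoord_apply] at this
      rw [h1]
      exact abs_nonpos_iff.1 this
    · have := abs_xiCoord_le hx.le
      rw [Real.zero_rpow (by norm_num)] at this
      rw [h2]
      exact abs_nonpos_iff.1 this
  rw [← Matrix.one_mulVec x, ← hB, ← Matrix.mulVec_mulVec, e, Matrix.mulVec_zero]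

theorem gauge4_zero : gauge4 C A₀ ν N 0 = 0 := by
  unfold gauge4
  have : ∀ p : Fin (N + 1) × Fin k,
      |augCoord C A₀ p.1 p.2 0| ^ (4 / (1 + ν * ((p.1 : ℕ) : ℝ))) = 0 := by
    intro p
    have := h.weight_pos' p
    rw [map_zero, abs_zero, Real.zero_rpow (by positivity)]
  rw [Finset.sum_eq_zero fun p _ => this p]
  simp

variable (hν : ν < 0)
include hν

theorem exponent_gt_one (p : Fin (N + 1) × Fin k) : 1 < 4 / (1 + ν * ((p.1 : ℕ) : ℝ)) := by
  have hw := h.weight_pos' p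
  rw [lt_div_iff₀ hw]
  have : 0 ≤ -ν * ((p.1 : ℕ) : ℝ) := mul_nonneg (by linarith) (Nat.cast_nonneg _)
  linarith

/-- For $\nu<0$ the weights are at most one, so every exponent in the gauge exceeds one. -/
theorem contDiff_gauge4 : ContDiff ℝ 1 (gauge4 C A₀ ν N) := by
  unfold gauge4
  refine ContDiff.add (ContDiff.sum fun p _ => ?_) ?_
  · exact ((augCoord C A₀ p.1 p.2).contDiff).norm_rpow (h.exponent_gt_one hν p)
  · exact (xiCoord.contDiff).norm_rpow (by norm_num)

theorem fderiv_gauge4 (x v : ErrIdx n k → ℝ) : fderiv ℝ (gauge4 C A₀ ν N) x v =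
    ∑ p : Fin (N + 1) × Fin k, 4 / (1 + ν * ((p.1 : ℕ) : ℝ)) *
      |augCoord C A₀ p.1 p.2 x| ^ (4 / (1 + ν * ((p.1 : ℕ) : ℝ)) - 2) * augCoord C A₀ p.1 p.2 x *
        augCoord C A₀ p.1 p.2 v + 2 * xiCoord x * xiCoord v := by
  have h1 : ∀ p : Fin (N + 1) × Fin k, HasFDerivAt
      (fun x => |augCoord C A₀ p.1 p.2 x| ^ (4 / (1 + ν * ((p.1 : ℕ) : ℝ)))) _ x := fun p =>
    (hasDerivAt_abs_rpow (augCoord C A₀ p.1 p.2 x) (h.exponent_gt_one hν p)).comp_hasFDerivAt x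
      (augCoord C A₀ p.1 p.2).hasFDerivAt
  have h2 : HasFDerivAt (fun x : ErrIdx n k → ℝ => |xiCoord x| ^ (2 : ℝ)) _ x :=
    (hasDerivAt_abs_rpow (xiCoord x) (by norm_num)).comp_hasFDerivAt x xiCoord.hasFDerivAt
  have h3 := (HasFDerivAt.fun_sum (u := Finset.univ) fun p _ => h1 p).add h2
  have h4 : fderiv ℝ (gauge4 C A₀ ν N) x = _ := h3.fderiv
  rw [h4]
  simp

/-- A count of degrees: the partial derivative along a coordinate of weight $w$ has degree $4-w$ and
the velocity component $w+\nu$, in total $4+\nu$. One bound `T` serves both `x` and `v`, so `v` may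
also come from a nearby point. -/
theorem fderiv_gauge4_le {M T : ℝ} (hM : 0 ≤ M) {x v : ErrIdx n k → ℝ}
    (hT : gauge4 C A₀ ν N x ≤ T)
    (hv : ∀ p : Fin (N + 1) × Fin k,
      |augCoord C A₀ p.1 p.2 v| ≤ M * T ^ ((1 + ν * ((p.1 : ℕ) : ℝ) + ν) / 4))
    (hξ : |xiCoord v| ≤ M * T ^ ((2 + ν) / 4)) :
    fderiv ℝ (gauge4 C A₀ ν N) x v ≤
      ((∑ p : Fin (N + 1) × Fin k, 4 / (1 + ν * ((p.1 : ℕ) : ℝ))) + 2) * M * T ^ (1 + ν / 4) := by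
  have hT0 : 0 ≤ T := (gauge4_nonneg x).trans hT
  have hn := h.one_add_pos
  rw [h.fderiv_gauge4 hν, add_mul, add_mul, Finset.sum_mul, Finset.sum_mul]
  refine add_le_add (Finset.sum_le_sum fun p _ => ?_) ?_
  · have hw := h.weight_pos' p
    have hw1 := h.exponent_gt_one hν p
    have hw2 := h.weight_succ_nonneg p
    have hx := h.abs_augCoord_le p hT
    have hp := hv p
    set w := 1 + ν * ((p.1 : ℕ) : ℝ) with hwdef
    set a := augCoord C A₀ p.1 p.2 x
    set b := augCoord C A₀ p.1 p.2 v
    have e1 : |a| ^ (4 / w - 2) * |a| ≤ T ^ ((4 - w) / 4) := by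
      rcases eq_or_ne a 0 with ha | ha
      · rw [ha, abs_zero, mul_zero]; positivity
      · have e : |a| ^ (4 / w - 2) * |a| = |a| ^ (4 / w - 1) := by
          rw [← Real.rpow_add_one (abs_pos.2 ha).ne']; ring_nf
        rw [e]
        refine (Real.rpow_le_rpow (abs_nonneg _) hx (by linarith)).trans ?_
        rw [← Real.rpow_mul hT0]
        refine le_of_eq ?_
        congr 1
        field_simp
    calc _ ≤ |4 / w * |a| ^ (4 / w - 2) * a * b| := le_abs_self _
      _ = 4 / w * ((|a| ^ (4 / w - 2) * |a|) * |b|) := by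
          rw [abs_mul, abs_mul, abs_mul, abs_of_pos (by positivity : 0 < 4 / w),
            abs_of_nonneg (by positivity : 0 ≤ |a| ^ (4 / w - 2))]
          ring
      _ ≤ 4 / w * (T ^ ((4 - w) / 4) * (M * T ^ ((w + ν) / 4))) := by gcongr
      _ = 4 / w * M * (T ^ ((4 - w) / 4) * T ^ ((w + ν) / 4)) := by ring
      _ = 4 / w * M * T ^ (1 + ν / 4) := by
          rw [← Real.rpow_add_of_nonneg hT0 _ (by positivity)]
          · congr 2; ring
          · have := (lt_div_iff₀ hw).1 hw1
            linarith
  · have hx := abs_xiCoord_le hT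
    calc _ ≤ |2 * xiCoord x * xiCoord v| := le_abs_self _
      _ = 2 * (|xiCoord x| * |xiCoord v|) := by rw [abs_mul, abs_mul]; norm_num; ring
      _ ≤ 2 * (T ^ (1 / 2 : ℝ) * (M * T ^ ((2 + ν) / 4))) := by gcongr
      _ = 2 * M * (T ^ (1 / 2 : ℝ) * T ^ ((2 + ν) / 4)) := by ring
      _ = 2 * M * T ^ (1 + ν / 4) := by
          rw [← Real.rpow_add_of_nonneg hT0 (by norm_num) (by linarith)]
          congr 2; ring

omit hν in
theorem errorField_zero (Lt : Matrix (Fin k) (Fin k) ℝ) (L : Matrix (Fin n) (Fin k) ℝ) (γ : ℝ) :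
    errorField C A₀ Gd Lt L ν γ 0 = 0 := by
  have h0 : psiPart (0 : ErrIdx n k → ℝ) = 0 := rfl
  have h1 : epsPart (0 : ErrIdx n k → ℝ) = 0 := rfl
  have h2 : xiPart (0 : ErrIdx n k → ℝ) = 0 := rfl
  refine err_ext ?_ ?_ ?_
  · rw [psiPart_errorField, h0, h1]; simp
  · rw [epsPart_errorField, h0, h1]; simp
  · rw [xiPart_errorField, h0, h1, h2]; simp [signedPow]

omit hν in
/-- Homogeneous bounds for the error field. -/
theorem exists_abs_coord_errorField_le (Lt : Matrix (Fin k) (Fin k) ℝ) (L : Matrix (Fin n) (Fin k) ℝ)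
    (γ : ℝ) : ∃ M : ℝ, 0 ≤ M ∧ ∀ x : ErrIdx n k → ℝ, (∀ p : Fin (N + 1) × Fin k,
      |augCoord C A₀ p.1 p.2 (errorField C A₀ Gd Lt L ν γ x)| ≤
        M * gauge4 C A₀ ν N x ^ ((1 + ν * ((p.1 : ℕ) : ℝ) + ν) / 4)) ∧
      |xiCoord (errorField C A₀ Gd Lt L ν γ x)| ≤ M * gauge4 C A₀ ν N x ^ ((2 + ν) / 4) := by
  obtain ⟨R, hR⟩ := h.exists_norm_le_of_gauge4_le 1
  obtain ⟨M, hM⟩ := h.exists_norm_errorField_le Lt L γ R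
  set S : ℝ := ∑ p : Fin (N + 1) × Fin k, ‖augCoord C A₀ p.1 p.2‖ +
    ‖(xiCoord : (ErrIdx n k → ℝ) →L[ℝ] ℝ)‖ with hS
  have hS0 : 0 ≤ S := by positivity
  refine ⟨S * |M|, by positivity, fun x => ?_⟩
  rcases (gauge4_nonneg (C := C) (A₀ := A₀) (ν := ν) (N := N) x).eq_or_lt with h0 | h0
  · have hx : x = 0 := h.eq_zero_of_gauge4_eq_zero h0.symm
    subst hx
    rw [h.errorField_zero, ← h0]
    simp only [map_zero, abs_zero]
    exact ⟨fun p => by positivity, by positivity⟩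
  -- Rescale to the level set $Q=1$, which is bounded, use local boundedness of the field there, and
  -- transport the bound back by homogeneity.
  set s : ℝ := -(Real.log (gauge4 C A₀ ν N x) / 4) with hs
  have hy : gauge4 C A₀ ν N (dSigma Gd s *ᵥ x) = 1 := by
    rw [h.gauge4_dSigma, hs, show 4 * -(Real.log (gauge4 C A₀ ν N x) / 4)
      = -Real.log (gauge4 C A₀ ν N x) by ring, Real.exp_neg, Real.exp_log h0,
      inv_mul_cancel₀ h0.ne']
  have hgy := (hM _ (hR _ hy.le)).trans (le_abs_self M)
  rw [h.isHomogeneousField Lt L γ s x] at hgy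
  have key : ∀ (l : (ErrIdx n k → ℝ) →L[ℝ] ℝ) (w : ℝ), ‖l‖ ≤ S →
      (∀ y, l (dSigma Gd s *ᵥ y) = Real.exp (s * w) * l y) →
      |l (errorField C A₀ Gd Lt L ν γ x)| ≤ S * |M| * gauge4 C A₀ ν N x ^ ((w + ν) / 4) := by
    intro l w hl hlw
    have h1 := (l.le_opNorm _).trans (mul_le_mul hl hgy (norm_nonneg _) hS0)
    rw [map_smul, hlw, smul_eq_mul, Real.norm_eq_abs, abs_mul, abs_mul,
      abs_of_pos (Real.exp_pos _), abs_of_pos (Real.exp_pos _), ← mul_assoc, ← Real.exp_add] at h1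
    have h2 : gauge4 C A₀ ν N x ^ ((w + ν) / 4) = Real.exp (-(ν * s + s * w)) := by
      rw [Real.rpow_def_of_pos h0, hs]
      congr 1; ring
    rw [h2, Real.exp_neg, ← div_eq_mul_inv, le_div_iff₀ (Real.exp_pos _), mul_comm]
    exact h1
  refine ⟨fun p => key _ _ ?_ fun y => ?_, key _ _ ?_ fun y => ?_⟩
  · have := Finset.single_le_sum
      (f := fun p : Fin (N + 1) × Fin k => ‖augCoord C A₀ p.1 p.2‖)
      (fun p _ => norm_nonneg _) (Finset.mem_univ p)
    have h2 := norm_nonneg (xiCoord : (ErrIdx n k → ℝ) →L[ℝ] ℝ)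
    rw [hS]; linarith
  · rw [augCoord_apply, augCoord_apply, zPart_dSigma, Matrix.mulVec_mulVec,
      h.augRow_mul_linearGroup, Matrix.smul_mulVec]
    rfl
  · have : 0 ≤ ∑ p : Fin (N + 1) × Fin k, ‖augCoord C A₀ p.1 p.2‖ := by positivity
    rw [hS]; linarith
  · rw [xiCoord_apply, xiCoord_apply, xiPart_dSigma, mul_comm s 2]

/-- Needed for mollification, where the velocity at `x` is built from values of the field at points
within distance one. -/
theorem exists_gauge4_le_of_dist_lt_one : ∃ c : ℝ, 1 ≤ c ∧ ∀ x y : ErrIdx n k → ℝ, dist y x < 1 →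
    gauge4 C A₀ ν N y ≤ c * (1 + gauge4 C A₀ ν N x) := by
  have key : ∀ (l : (ErrIdx n k → ℝ) →L[ℝ] ℝ) (q : ℝ), 1 < q → ∃ c : ℝ, 0 ≤ c ∧
      ∀ x y : ErrIdx n k → ℝ, dist y x < 1 → |l y| ^ q ≤ c * (1 + |l x| ^ q) := by
    intro l q hq
    refine ⟨2 ^ q * (1 + ‖l‖ ^ q), by positivity, fun x y hxy => ?_⟩
    have h1 : |l y| ≤ |l x| + ‖l‖ := by
      have e : l y = l x + l (y - x) := by rw [map_sub]; ring
      rw [e]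
      refine (abs_add_le _ _).trans ?_
      have h2 := l.le_opNorm (y - x)
      rw [dist_eq_norm] at hxy
      rw [Real.norm_eq_abs] at h2
      nlinarith [norm_nonneg l]
    have h2 : |l y| ≤ 2 * max |l x| ‖l‖ := by
      linarith [le_max_left |l x| ‖l‖, le_max_right |l x| ‖l‖]
    have h3 : max |l x| ‖l‖ ^ q ≤ |l x| ^ q + ‖l‖ ^ q := by
      have e1 : 0 ≤ |l x| ^ q := by positivity
      have e2 : 0 ≤ ‖l‖ ^ q := by positivity
      rcases max_choice |l x| ‖l‖ with e | e <;> rw [e] <;> linarith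
    calc |l y| ^ q ≤ (2 * max |l x| ‖l‖) ^ q :=
          Real.rpow_le_rpow (abs_nonneg _) h2 (by linarith)
      _ = 2 ^ q * max |l x| ‖l‖ ^ q := Real.mul_rpow (by norm_num) (by positivity)
      _ ≤ 2 ^ q * (|l x| ^ q + ‖l‖ ^ q) := by gcongr
      _ ≤ 2 ^ q * ((1 + ‖l‖ ^ q) * (1 + |l x| ^ q)) := by
          gcongr
          have e1 : 0 ≤ |l x| ^ q := by positivity
          have e2 : 0 ≤ ‖l‖ ^ q := by positivity
          nlinarith [mul_nonneg e1 e2]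
      _ = _ := by ring
  choose c hc0 hc using fun p : Fin (N + 1) × Fin k =>
    key (augCoord C A₀ p.1 p.2) _ (h.exponent_gt_one hν p)
  obtain ⟨d, hd0, hd⟩ := key xiCoord 2 (by norm_num)
  refine ⟨(∑ p, c p) + d + 1, ?_, fun x y hxy => ?_⟩
  · have := Finset.sum_nonneg fun p (_ : p ∈ Finset.univ) => hc0 p
    linarith
  have hQ := gauge4_nonneg (C := C) (A₀ := A₀) (ν := ν) (N := N) x
  calc gauge4 C A₀ ν N y ≤ ∑ p, c p * (1 + gauge4 C A₀ ν N x) + d * (1 + gauge4 C A₀ ν N x) := by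
        conv_lhs => unfold gauge4
        refine add_le_add (Finset.sum_le_sum fun p _ => (hc p x y hxy).trans ?_)
          ((hd x y hxy).trans ?_)
        · have e := abs_augCoord_rpow_le (C := C) (A₀ := A₀) (ν := ν) p x
          exact mul_le_mul_of_nonneg_left (by linarith) (hc0 p)
        · have e := abs_xiCoord_rpow_le (C := C) (A₀ := A₀) (ν := ν) (N := N) x
          exact mul_le_mul_of_nonneg_left (by linarith) hd0
    _ ≤ _ := by
        rw [← Finset.sum_mul]
        linarith

theorem fderiv_add_gauge4_rpow {δ : ℝ} (hδ : 0 < δ) (a : ℝ) (x v : ErrIdx n k → ℝ) :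
    fderiv ℝ (fun x => (δ + gauge4 C A₀ ν N x) ^ a) x v =
      a * (δ + gauge4 C A₀ ν N x) ^ (a - 1) * fderiv ℝ (gauge4 C A₀ ν N) x v := by
  have hQ := gauge4_nonneg (C := C) (A₀ := A₀) (ν := ν) (N := N) x
  have h1 := (((h.contDiff_gauge4 hν).differentiable (by decide)) x).hasFDerivAt.const_add δ
  have h2 := h1.rpow_const (p := a) (Or.inl (by linarith))
  rw [h2.fderiv]
  simp

theorem contDiff_add_gauge4_rpow {δ : ℝ} (hδ : 0 < δ) (a : ℝ) :
    ContDiff ℝ 1 (fun x => (δ + gauge4 C A₀ ν N x) ^ a) := by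
  rw [contDiff_iff_contDiffAt]
  intro x
  have hQ := gauge4_nonneg (C := C) (A₀ := A₀) (ν := ν) (N := N) x
  exact (contDiff_const.add (h.contDiff_gauge4 hν)).contDiffAt.rpow_const_of_ne (by linarith)

/-- Growth of the gauge along solutions. -/
theorem exists_gauge4_growth (Lt : Matrix (Fin k) (Fin k) ℝ) (L : Matrix (Fin n) (Fin k) ℝ)
    (γ : ℝ) : ∃ K : ℝ, 0 < K ∧ ∀ (a b : ℝ), a ≤ b → ∀ x : ℝ → ErrIdx n k → ℝ,
      IsFilippovSolution (errorField C A₀ Gd Lt L ν γ) (Set.Icc a b) x →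
      gauge4 C A₀ ν N (x b) ^ (-ν / 4) ≤ gauge4 C A₀ ν N (x a) ^ (-ν / 4) + K * (b - a) := by
  obtain ⟨M, hM0, hM⟩ := h.exists_abs_coord_errorField_le Lt L γ
  have hn := h.one_add_pos
  have hcQ : Continuous (gauge4 C A₀ ν N) := (h.contDiff_gauge4 hν).continuous
  set S : ℝ := (∑ p : Fin (N + 1) × Fin k, 4 / (1 + ν * ((p.1 : ℕ) : ℝ))) + 2 with hS
  have hS0 : 0 < S := by
    have : 0 ≤ ∑ p : Fin (N + 1) × Fin k, 4 / (1 + ν * ((p.1 : ℕ) : ℝ)) :=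
      Finset.sum_nonneg fun p _ => by have := h.weight_pos' p; positivity
    linarith
  refine ⟨-ν / 4 * (S * M) + 1, ?_, fun a b hab x hx => ?_⟩
  · have : 0 ≤ -ν / 4 * (S * M) := mul_nonneg (by linarith) (by positivity)
    linarith
  have hfil : ∀ y v, v ∈ filippovSet (errorField C A₀ Gd Lt L ν γ) y →
      fderiv ℝ (gauge4 C A₀ ν N) y v ≤ S * M * gauge4 C A₀ ν N y ^ (1 + ν / 4) := by
    intro y v hv
    have key : ∀ (l : (ErrIdx n k → ℝ) →L[ℝ] ℝ) (e : ℝ), 0 ≤ e →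
        (∀ y, |l (errorField C A₀ Gd Lt L ν γ y)| ≤ M * gauge4 C A₀ ν N y ^ e) →
        |l v| ≤ M * gauge4 C A₀ ν N y ^ e := by
      intro l e he hl
      have hc : Continuous fun y => M * gauge4 C A₀ ν N y ^ e :=
        continuous_const.mul (hcQ.rpow_const fun _ => Or.inr he)
      refine abs_le'.2 ⟨?_, ?_⟩
      · exact filippovSet_apply_le l hc.continuousAt
          (Eventually.of_forall fun y => (le_abs_self _).trans (hl y)) hv
      · exact filippovSet_apply_le (-l) hc.continuousAt
          (Eventually.of_forall fun y => (neg_le_abs _).trans (hl y)) hv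
    refine h.fderiv_gauge4_le hν hM0 le_rfl (fun p => key _ _ ?_ fun y => (hM y).1 p)
      (key _ _ ?_ fun y => (hM y).2)
    · have := h.weight_succ_nonneg p
      positivity
    · linarith
  -- $Q^{-\nu/4}$ need not be differentiable at the origin, so the estimate is made for
  -- $(\delta+Q)^{-\nu/4}$ and then $\delta\to0$.
  have hδ : ∀ δ : ℝ, 0 < δ → gauge4 C A₀ ν N (x b) ^ (-ν / 4) ≤
      (δ + gauge4 C A₀ ν N (x a)) ^ (-ν / 4) + (-ν / 4 * (S * M) + 1) * (b - a) := by
    intro δ hδ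
    have h1 := hx.comp_sub_le (k := -ν / 4 * (S * M)) hab
      (h.contDiff_add_gauge4_rpow hν hδ (-ν / 4)) fun t _ v hv => by
        rw [h.fderiv_add_gauge4_rpow hν hδ]
        have hQ := gauge4_nonneg (C := C) (A₀ := A₀) (ν := ν) (N := N) (x t)
        have hpos : 0 < δ + gauge4 C A₀ ν N (x t) := by linarith
        have e1 : gauge4 C A₀ ν N (x t) ^ (1 + ν / 4) ≤ (δ + gauge4 C A₀ ν N (x t)) ^ (1 + ν / 4) :=
          Real.rpow_le_rpow hQ (by linarith) (by linarith)
        have e2 : (δ + gauge4 C A₀ ν N (x t)) ^ (-ν / 4 - 1) *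
            (δ + gauge4 C A₀ ν N (x t)) ^ (1 + ν / 4) = 1 := by
          rw [← Real.rpow_add hpos, show -ν / 4 - 1 + (1 + ν / 4) = 0 by ring, Real.rpow_zero]
        have e3 : 0 ≤ -ν / 4 * (δ + gauge4 C A₀ ν N (x t)) ^ (-ν / 4 - 1) :=
          mul_nonneg (by linarith) (by positivity)
        calc _ ≤ -ν / 4 * (δ + gauge4 C A₀ ν N (x t)) ^ (-ν / 4 - 1) *
              (S * M * (δ + gauge4 C A₀ ν N (x t)) ^ (1 + ν / 4)) := by
              refine mul_le_mul_of_nonneg_left ((hfil _ _ hv).trans ?_) e3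
              exact mul_le_mul_of_nonneg_left e1 (by positivity)
          _ = -ν / 4 * (S * M) * ((δ + gauge4 C A₀ ν N (x t)) ^ (-ν / 4 - 1) *
            (δ + gauge4 C A₀ ν N (x t)) ^ (1 + ν / 4)) := by ring
          _ = _ := by rw [e2, mul_one]
    have h2 : gauge4 C A₀ ν N (x b) ^ (-ν / 4) ≤ (δ + gauge4 C A₀ ν N (x b)) ^ (-ν / 4) :=
      Real.rpow_le_rpow (gauge4_nonneg _) (by linarith) (by linarith)
    have h3 : 0 ≤ b - a := by linarith
    nlinarith
  have hlim : Tendsto (fun δ : ℝ => (δ + gauge4 C A₀ ν N (x a)) ^ (-ν / 4) +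
      (-ν / 4 * (S * M) + 1) * (b - a)) (𝓝[>] 0)
      (𝓝 ((0 + gauge4 C A₀ ν N (x a)) ^ (-ν / 4) + (-ν / 4 * (S * M) + 1) * (b - a))) := by
    have : Continuous (fun δ : ℝ => (δ + gauge4 C A₀ ν N (x a)) ^ (-ν / 4) +
      (-ν / 4 * (S * M) + 1) * (b - a)) :=
      ((continuous_id.add continuous_const).rpow_const fun _ => Or.inr (by linarith)).add
        continuous_const
    exact (this.tendsto 0).mono_left nhdsWithin_le_nhds
  rw [zero_add] at hlim
  refine ge_of_tendsto hlim ?_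
  filter_upwards [self_mem_nhdsWithin] with δ hδ'
  exact hδ δ hδ'

/-- The proper function is $(1+Q)^{-\nu/4}$: in its derivative along the field the powers
$(1+Q)^{-\nu/4-1}$ and $(1+Q)^{1+\nu/4}$ cancel, leaving a constant. -/
theorem exists_solution (Lt : Matrix (Fin k) (Fin k) ℝ) (L : Matrix (Fin n) (Fin k) ℝ) (γ : ℝ)
    (x₀ : ErrIdx n k → ℝ) : ∃ x : ℝ → ErrIdx n k → ℝ,
      IsFilippovSolution (errorField C A₀ Gd Lt L ν γ) (Set.Ici 0) x ∧ x 0 = x₀ := by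
  obtain ⟨M, hM0, hM⟩ := h.exists_abs_coord_errorField_le Lt L γ
  obtain ⟨c, hc1, hc⟩ := h.exists_gauge4_le_of_dist_lt_one hν
  have hn := h.one_add_pos
  set S : ℝ := (∑ p : Fin (N + 1) × Fin k, 4 / (1 + ν * ((p.1 : ℕ) : ℝ))) + 2 with hS
  have hS0 : 0 < S := by
    have : 0 ≤ ∑ p : Fin (N + 1) × Fin k, 4 / (1 + ν * ((p.1 : ℕ) : ℝ)) :=
      Finset.sum_nonneg fun p _ => by have := h.weight_pos' p; positivity
    linarith
  have hk0 : 0 ≤ -ν / 4 * (S * M * c ^ (1 + ν / 4)) :=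
    mul_nonneg (by linarith) (by positivity)
  refine exists_isFilippovSolution (h.aestronglyMeasurable_errorField Lt L γ)
    (h.exists_norm_errorField_le Lt L γ) (h.contDiff_add_gauge4_rpow hν one_pos (-ν / 4))
    hk0 (fun x y hxy => ?_) (fun b => ?_) x₀
  · rw [h.fderiv_add_gauge4_rpow hν one_pos]
    have hQ := gauge4_nonneg (C := C) (A₀ := A₀) (ν := ν) (N := N) x
    have hpos : 0 < 1 + gauge4 C A₀ ν N x := by linarith
    have hQy := gauge4_nonneg (C := C) (A₀ := A₀) (ν := ν) (N := N) y
    have e1 := h.fderiv_gauge4_le hν (T := c * (1 + gauge4 C A₀ ν N x)) hM0 (x := x)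
      (v := errorField C A₀ Gd Lt L ν γ y) (by nlinarith)
      (fun p => ((hM y).1 p).trans (mul_le_mul_of_nonneg_left (Real.rpow_le_rpow hQy (hc x y hxy)
        (by have := h.weight_succ_nonneg p; positivity)) hM0))
      ((hM y).2.trans (mul_le_mul_of_nonneg_left (Real.rpow_le_rpow hQy (hc x y hxy)
        (by linarith)) hM0))
    rw [Real.mul_rpow (by linarith) hpos.le] at e1
    have e2 : (1 + gauge4 C A₀ ν N x) ^ (-ν / 4 - 1) *
        (1 + gauge4 C A₀ ν N x) ^ (1 + ν / 4) = 1 := by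
      rw [← Real.rpow_add hpos, show -ν / 4 - 1 + (1 + ν / 4) = 0 by ring, Real.rpow_zero]
    have e3 : 0 ≤ -ν / 4 * (1 + gauge4 C A₀ ν N x) ^ (-ν / 4 - 1) :=
      mul_nonneg (by linarith) (by positivity)
    calc _ ≤ -ν / 4 * (1 + gauge4 C A₀ ν N x) ^ (-ν / 4 - 1) *
          (S * M * (c ^ (1 + ν / 4) * (1 + gauge4 C A₀ ν N x) ^ (1 + ν / 4))) :=
          mul_le_mul_of_nonneg_left e1 e3
      _ = -ν / 4 * (S * M * c ^ (1 + ν / 4)) * ((1 + gauge4 C A₀ ν N x) ^ (-ν / 4 - 1) *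
        (1 + gauge4 C A₀ ν N x) ^ (1 + ν / 4)) := by ring
      _ = _ := by rw [e2, mul_one]
  · obtain ⟨R, hR⟩ := h.exists_norm_le_of_gauge4_le (|b| ^ (4 / -ν))
    refine ⟨R, fun x hx => hR x ?_⟩
    have hQ := gauge4_nonneg (C := C) (A₀ := A₀) (ν := ν) (N := N) x
    have hx' := Real.rpow_le_rpow (by positivity) (hx.trans (le_abs_self b)) (z := 4 / -ν)
      (div_nonneg (by norm_num) (by linarith))
    have h4 : -ν / 4 * (4 / -ν) = 1 := by
      have : ν ≠ 0 := hν.ne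
      field_simp
    rw [← Real.rpow_mul (by linarith), h4, Real.rpow_one] at hx'
    linarith

theorem exists_extension (Lt : Matrix (Fin k) (Fin k) ℝ) (L : Matrix (Fin n) (Fin k) ℝ) (γ : ℝ)
    {b : ℝ} {x : ℝ → ErrIdx n k → ℝ}
    (hx : IsFilippovSolution (errorField C A₀ Gd Lt L ν γ) (Set.Ico 0 b) x) :
    ∃ y : ℝ → ErrIdx n k → ℝ, IsFilippovSolution (errorField C A₀ Gd Lt L ν γ) (Set.Ici 0) y ∧
      Set.EqOn y x (Set.Ico 0 b) := by
  obtain ⟨K, hK0, hK⟩ := h.exists_gauge4_growth hν Lt L γ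
  obtain ⟨R, hR⟩ := h.exists_norm_le_of_gauge4_le
    ((gauge4 C A₀ ν N (x 0) ^ (-ν / 4) + K * b) ^ (4 / -ν))
  refine IsFilippovSolution.exists_extension (h.exists_norm_errorField_le Lt L γ)
    (h.exists_solution hν Lt L γ) hx (R := R) fun t ht => hR _ ?_
  have h1 := hK 0 t ht.1 x (hx.mono fun s hs => ⟨hs.1, hs.2.trans_lt ht.2⟩)
  have h2 : gauge4 C A₀ ν N (x t) ^ (-ν / 4) ≤ gauge4 C A₀ ν N (x 0) ^ (-ν / 4) + K * b := by
    have := ht.2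
    nlinarith
  have hQ := gauge4_nonneg (C := C) (A₀ := A₀) (ν := ν) (N := N) (x t)
  have h3 := Real.rpow_le_rpow (by positivity) h2 (z := 4 / -ν)
    (div_nonneg (by norm_num) (by linarith))
  have h4 : -ν / 4 * (4 / -ν) = 1 := by
    have : ν ≠ 0 := hν.ne
    field_simp
  rwa [← Real.rpow_mul hQ, h4, Real.rpow_one] at h3

end IsGradedPair
end Gauge

/-! ### Quadratic forms and scaled states -/

section Quadratic
variable {ι : Type*} [Fintype ι] [DecidableEq ι]

omit [DecidableEq ι] in
theorem Matrix.PosDef.dotProduct_mulVec_pos' {P : Matrix ι ι ℝ} (hP : P.PosDef) {z : ι → ℝ}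
    (hz : z ≠ 0) : 0 < z ⬝ᵥ (P *ᵥ z) := by
  simpa using hP.dotProduct_mulVec_pos hz

/-- A positive definite quadratic form dominates every continuous function that is homogeneous of
degree two. -/
theorem Matrix.PosDef.exists_abs_le {P : Matrix ι ι ℝ} (hP : P.PosDef) {F : (ι → ℝ) → ℝ}
    (hF : Continuous F) (hF2 : ∀ (c : ℝ) (z : ι → ℝ), F (c • z) = c ^ 2 * F z) :
    ∃ K : ℝ, 0 < K ∧ ∀ z, |F z| ≤ K * (z ⬝ᵥ (P *ᵥ z)) := by
  have hW : Continuous fun z : ι → ℝ => z ⬝ᵥ (P *ᵥ z) :=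
    continuous_id.dotProduct (continuous_const.matrix_mulVec continuous_id)
  have hS : IsCompact (Metric.sphere (0 : ι → ℝ) 1) := isCompact_sphere _ _
  have hne : ∀ z ∈ Metric.sphere (0 : ι → ℝ) 1, z ≠ 0 := fun z hz => by
    rintro rfl
    simp at hz
  have hpos : ∀ z ∈ Metric.sphere (0 : ι → ℝ) 1, 0 < z ⬝ᵥ (P *ᵥ z) := fun z hz =>
    hP.dotProduct_mulVec_pos' (hne z hz)
  obtain ⟨K, hK⟩ := hS.exists_bound_of_continuousOn (f := fun z => F z / (z ⬝ᵥ (P *ᵥ z)))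
    (hF.continuousOn.div hW.continuousOn fun z hz => (hpos z hz).ne')
  refine ⟨|K| + 1, by positivity, fun z => ?_⟩
  by_cases hz : z = 0
  · have h0 : F 0 = 0 := by simpa using hF2 0 0
    subst hz
    simp [h0]
  have hn : 0 < ‖z‖ := norm_pos_iff.2 hz
  have hy : ‖z‖⁻¹ • z ∈ Metric.sphere (0 : ι → ℝ) 1 := by
    simp [norm_smul, inv_mul_cancel₀ hn.ne']
  have h1 := hK _ hy
  have h2 := hpos _ hy
  rw [Real.norm_eq_abs, abs_div, abs_of_pos h2, div_le_iff₀ h2, hF2, Matrix.mulVec_smul,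
    smul_dotProduct, dotProduct_smul, smul_eq_mul, smul_eq_mul, abs_mul,
    abs_of_pos (by positivity)] at h1
  have h3 : |F z| ≤ K * (z ⬝ᵥ (P *ᵥ z)) := by
    have h4 : 0 < ‖z‖⁻¹ ^ 2 := by positivity
    nlinarith
  refine h3.trans (mul_le_mul_of_nonneg_right ((le_abs_self K).trans (by linarith)) ?_)
  exact (hP.dotProduct_mulVec_pos' hz).le

omit [DecidableEq ι] in
theorem HasDerivAt.dotProduct {u v : ℝ → ι → ℝ} {u' v' : ι → ℝ} {t : ℝ}
    (hu : HasDerivAt u u' t) (hv : HasDerivAt v v' t) :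
    HasDerivAt (fun t => u t ⬝ᵥ v t) (u' ⬝ᵥ v t + u t ⬝ᵥ v') t := by
  have h1 := HasDerivAt.fun_sum (u := Finset.univ) fun i (_ : i ∈ Finset.univ) =>
    (hasDerivAt_pi.1 hu i).mul (hasDerivAt_pi.1 hv i)
  rw [Finset.sum_add_distrib] at h1
  exact h1

omit [DecidableEq ι] in
theorem HasDerivAt.const_mulVec {κ : Type*} [Fintype κ] (M : Matrix κ ι ℝ) {u : ℝ → ι → ℝ}
    {u' : ι → ℝ} {t : ℝ} (hu : HasDerivAt u u' t) :
    HasDerivAt (fun t => M *ᵥ u t) (M *ᵥ u') t :=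
  (LinearMap.toContinuousLinearMap M.mulVecLin).hasFDerivAt.comp_hasDerivAt t hu

theorem mulVec_eq_sum_single (M : Matrix ι ι ℝ) (v : ι → ℝ) :
    M *ᵥ v = ∑ j, v j • (M *ᵥ Pi.single j 1) := by
  conv_lhs => rw [pi_eq_sum_univ' v]
  rw [Matrix.mulVec_sum]
  refine Finset.sum_congr rfl fun j _ => ?_
  rw [Matrix.mulVec_smul]

theorem HasDerivAt.linearGroup_mulVec (X : Matrix ι ι ℝ) {s : ℝ → ℝ} {u : ℝ → ι → ℝ} {s' : ℝ}
    {u' : ι → ℝ} {t : ℝ} (hs : HasDerivAt s s' t) (hu : HasDerivAt u u' t) :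
    HasDerivAt (fun t => linearGroup X (s t) *ᵥ u t)
      (s' • (X *ᵥ (linearGroup X (s t) *ᵥ u t)) + linearGroup X (s t) *ᵥ u') t := by
  have e := mulVec_eq_sum_single (ι := ι)
  have h1 := HasDerivAt.fun_sum (u := Finset.univ) fun j (_ : j ∈ Finset.univ) =>
    (hasDerivAt_pi.1 hu j).smul
      ((hasDerivAt_linearGroup_mulVec X (Pi.single j 1) (s t)).scomp t hs)
  have h2 : (fun t => linearGroup X (s t) *ᵥ u t) =
      fun t => ∑ j, u t j • (linearGroup X (s t) *ᵥ Pi.single j 1) := funext fun t => e _ _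
  rw [h2]
  refine h1.congr_deriv ?_
  rw [Finset.sum_add_distrib, e _ u', e (linearGroup X (s t)) (u t), Matrix.mulVec_sum,
    Finset.smul_sum]
  congr 1
  refine Finset.sum_congr rfl fun j _ => ?_
  rw [Matrix.mulVec_smul, smul_comm]

end Quadratic

section Scaled
variable {n k : ℕ}

/-- The state `(ψ, ε)` scaled to `ξ = 1`. -/
def scaledState (Gd : Matrix (Fin n) (Fin n) ℝ) (x : ErrIdx n k → ℝ) : Fin k ⊕ Fin n → ℝ :=
  linearGroup (barG (k := k) Gd) (-(Real.log (xiPart x) / 2)) *ᵥ zPart x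

variable {C : Matrix (Fin k) (Fin n) ℝ} {A₀ Gd : Matrix (Fin n) (Fin n) ℝ} {ν : ℝ} {N : ℕ}
  {Lt : Matrix (Fin k) (Fin k) ℝ} {L : Matrix (Fin n) (Fin k) ℝ} {γ : ℝ}

theorem sigmaAt_eq_sqrt {x : ErrIdx n k → ℝ} (he : (psiPart x ⬝ᵥ psiPart x) / 2 ≤ xiPart x) :
    sigmaAt x = Real.sqrt (xiPart x) := by
  rw [sigmaAt, sigmaOf, max_eq_left he]

theorem barC_mulVec_zPart (x : ErrIdx n k → ℝ) :
    (barC : Matrix (Fin k) (Fin k ⊕ Fin n) ℝ) *ᵥ zPart x = psiPart x := by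
  rw [barC, Matrix.fromCols_mulVec, Matrix.one_mulVec, Matrix.zero_mulVec, add_zero]
  rfl

theorem linearGroup_neg_mul {ι : Type*} [Fintype ι] [DecidableEq ι] (X : Matrix ι ι ℝ) (s : ℝ) :
    linearGroup X s * linearGroup X (-s) = 1 := by
  rw [← linearGroup_add, add_neg_cancel, linearGroup_zero]

theorem linearGroup_mulVec_scaledState (x : ErrIdx n k → ℝ) :
    linearGroup (barG (k := k) Gd) (Real.log (xiPart x) / 2) *ᵥ scaledState Gd x = zPart x := by
  rw [scaledState, Matrix.mulVec_mulVec, linearGroup_neg_mul, Matrix.one_mulVec]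

namespace IsGradedPair
variable (h : IsGradedPair C A₀ Gd ν N)
include h

theorem zPart_errorField {x : ErrIdx n k → ℝ} (hσ : 0 < sigmaAt x) :
    zPart (errorField C A₀ Gd Lt L ν γ x) = barA C A₀ *ᵥ zPart x + sigmaAt x ^ (ν - 1) •
      (linearGroup (barG (k := k) Gd) (Real.log (sigmaAt x)) *ᵥ
        (fromRows Lt L *ᵥ psiPart x)) := by
  have e1 : sigmaAt x ^ ν = sigmaAt x ^ (ν - 1) * sigmaAt x := by
    rw [← Real.rpow_add_one hσ.ne', sub_add_cancel]
  have e2 : zPart x = Sum.elim (psiPart x) (epsPart x) := by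
    ext (i | i) <;> rfl
  rw [h.linearGroup_barG, Real.exp_log hσ, Matrix.fromRows_mulVec, Matrix.fromBlocks_mulVec, e2,
    barA, Matrix.fromBlocks_mulVec]
  ext (i | i)
  · change psiPart (errorField C A₀ Gd Lt L ν γ x) i = _
    rw [psiPart_errorField, e1]
    simp [Matrix.smul_mulVec, mul_assoc]
  · change epsPart (errorField C A₀ Gd Lt L ν γ x) i = _
    rw [epsPart_errorField]
    simp

theorem barC_mul_linearGroup (s : ℝ) : (barC : Matrix (Fin k) (Fin k ⊕ Fin n) ℝ) *
    linearGroup (barG (k := k) Gd) s = Real.exp s • (barC : Matrix (Fin k) (Fin k ⊕ Fin n) ℝ) := by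
  have := h.augRow_mul_linearGroup 0 s
  simpa [augRow, barC] using this

theorem psiPart_eq_scaledState {x : ErrIdx n k → ℝ} (hξ : 0 < xiPart x) :
    psiPart x = Real.sqrt (xiPart x) •
      ((barC : Matrix (Fin k) (Fin k ⊕ Fin n) ℝ) *ᵥ scaledState Gd x) := by
  conv_lhs => rw [← barC_mulVec_zPart, ← linearGroup_mulVec_scaledState (Gd := Gd)]
  rw [Matrix.mulVec_mulVec, h.barC_mul_linearGroup, Matrix.smul_mulVec, ← Real.log_sqrt hξ.le,
    Real.exp_log (Real.sqrt_pos.2 hξ)]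

/-- For $|\psi|^2/2\le\xi$ one has $\sigma=\sqrt\xi$, so the scaling inside the injection is the one
that defines the scaled state. By homogeneity the scaled field is linear up to the factor
$\xi^{\nu/2}$. -/
theorem linearGroup_mulVec_zPart_errorField {x : ErrIdx n k → ℝ} (hξ : 0 < xiPart x)
    (he : (psiPart x ⬝ᵥ psiPart x) / 2 ≤ xiPart x) :
    linearGroup (barG (k := k) Gd) (-(Real.log (xiPart x) / 2)) *ᵥ
      zPart (errorField C A₀ Gd Lt L ν γ x) = xiPart x ^ (ν / 2) •
        ((barA C A₀ + fromRows Lt L * (barC : Matrix (Fin k) (Fin k ⊕ Fin n) ℝ)) *ᵥ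
          scaledState Gd x) := by
  have hσ := sigmaAt_eq_sqrt he
  have hs : 0 < Real.sqrt (xiPart x) := Real.sqrt_pos.2 hξ
  have hl : Real.log (sigmaAt x) = Real.log (xiPart x) / 2 := by rw [hσ, Real.log_sqrt hξ.le]
  have e1 : xiPart x ^ (ν / 2) = Real.exp (ν * (Real.log (xiPart x) / 2)) := by
    rw [Real.rpow_def_of_pos hξ]; ring_nf
  have e2 : Real.sqrt (xiPart x) ^ (ν - 1) * Real.sqrt (xiPart x) = xiPart x ^ (ν / 2) := by
    rw [← Real.rpow_add_one hs.ne', sub_add_cancel, Real.sqrt_eq_rpow, ← Real.rpow_mul hξ.le]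
    ring_nf
  have e3 : linearGroup (barG (k := k) Gd) (-(Real.log (xiPart x) / 2)) *
      linearGroup (barG (k := k) Gd) (Real.log (xiPart x) / 2) = 1 := by
    simpa using linearGroup_neg_mul (barG (k := k) Gd) (-(Real.log (xiPart x) / 2))
  rw [h.zPart_errorField (by rw [hσ]; exact hs), hl, Matrix.mulVec_add, Matrix.mulVec_smul,
    Matrix.mulVec_mulVec _ _ (linearGroup _ _), e3, Matrix.one_mulVec, hσ,
    h.psiPart_eq_scaledState hξ, Matrix.mulVec_smul, smul_smul, e2, Matrix.add_mulVec, smul_add,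
    ← Matrix.mulVec_mulVec]
  congr 1
  conv_lhs => rw [← linearGroup_mulVec_scaledState (Gd := Gd) x]
  rw [Matrix.mulVec_mulVec _ (barA C A₀), h.barA_mul_linearGroup, Matrix.smul_mulVec,
    Matrix.mulVec_smul, ← e1, Matrix.mulVec_mulVec, ← Matrix.mul_assoc, e3, Matrix.one_mul]

theorem psiPart_dotProduct_errorField {x : ErrIdx n k → ℝ} (hξ : 0 < xiPart x)
    (he : (psiPart x ⬝ᵥ psiPart x) / 2 ≤ xiPart x) :
    psiPart x ⬝ᵥ psiPart (errorField C A₀ Gd Lt L ν γ x) = xiPart x ^ (1 + ν / 2) *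
      (((barC : Matrix (Fin k) (Fin k ⊕ Fin n) ℝ) *ᵥ scaledState Gd x) ⬝ᵥ
        ((barC : Matrix (Fin k) (Fin k ⊕ Fin n) ℝ) *ᵥ
          ((barA C A₀ + fromRows Lt L * (barC : Matrix (Fin k) (Fin k ⊕ Fin n) ℝ)) *ᵥ
            scaledState Gd x))) := by
  have hs : 0 < Real.sqrt (xiPart x) := Real.sqrt_pos.2 hξ
  have e1 : psiPart (errorField C A₀ Gd Lt L ν γ x) = Real.sqrt (xiPart x) •
      ((barC : Matrix (Fin k) (Fin k ⊕ Fin n) ℝ) *ᵥ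
        (linearGroup (barG (k := k) Gd) (-(Real.log (xiPart x) / 2)) *ᵥ
          zPart (errorField C A₀ Gd Lt L ν γ x))) := by
    rw [Matrix.mulVec_mulVec, h.barC_mul_linearGroup, Matrix.smul_mulVec, barC_mulVec_zPart,
      smul_smul, ← Real.log_sqrt hξ.le, Real.exp_neg, Real.exp_log hs, mul_inv_cancel₀ hs.ne',
      one_smul]
  rw [e1, h.linearGroup_mulVec_zPart_errorField hξ he, h.psiPart_eq_scaledState hξ,
    Matrix.mulVec_smul, smul_dotProduct, dotProduct_smul, dotProduct_smul, Real.rpow_add hξ,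
    Real.rpow_one]
  simp only [smul_eq_mul]
  rw [← mul_assoc, ← mul_assoc, Real.mul_self_sqrt hξ.le]

theorem psiPart_dotProduct_self {x : ErrIdx n k → ℝ} (hξ : 0 < xiPart x) :
    psiPart x ⬝ᵥ psiPart x = xiPart x *
      (((barC : Matrix (Fin k) (Fin k ⊕ Fin n) ℝ) *ᵥ scaledState Gd x) ⬝ᵥ
        ((barC : Matrix (Fin k) (Fin k ⊕ Fin n) ℝ) *ᵥ scaledState Gd x)) := by
  rw [h.psiPart_eq_scaledState hξ, smul_dotProduct, dotProduct_smul]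
  simp only [smul_eq_mul]
  rw [← mul_assoc, Real.mul_self_sqrt hξ.le]

end IsGradedPair

theorem xiPart_errorField' (x : ErrIdx n k → ℝ) : xiPart (errorField C A₀ Gd Lt L ν γ x) =
    |psiPart x ⬝ᵥ psiPart (errorField C A₀ Gd Lt L ν γ x)| -
      γ * signedPow (xiPart x - (psiPart x ⬝ᵥ psiPart x) / 2) (ν / 2 + 1) := rfl

theorem signedPow_of_nonneg {r a : ℝ} (ha : a ≠ 0) (hr : 0 ≤ r) : signedPow r a = r ^ a := by
  rcases hr.eq_or_lt with h0 | h0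
  · rw [← h0, signedPow, Real.sign_zero, mul_zero, Real.zero_rpow ha]
  · rw [signedPow, Real.sign_of_pos h0, mul_one, abs_of_pos h0]

end Scaled

/-! ### The quadratic Lyapunov function of the scaled state -/

section Lyapunov
variable {n k : ℕ} {C : Matrix (Fin k) (Fin n) ℝ} {A₀ Gd : Matrix (Fin n) (Fin n) ℝ} {ν : ℝ}
  {N : ℕ} {Lt : Matrix (Fin k) (Fin k) ℝ} {L : Matrix (Fin n) (Fin k) ℝ} {γ : ℝ}

theorem quadratic_smul {ι κ : Type*} [Fintype ι] [Fintype κ] (M M' : Matrix κ ι ℝ) (c : ℝ)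
    (z : ι → ℝ) : (M *ᵥ (c • z)) ⬝ᵥ (M' *ᵥ (c • z)) = c ^ 2 * ((M *ᵥ z) ⬝ᵥ (M' *ᵥ z)) := by
  rw [Matrix.mulVec_smul, Matrix.mulVec_smul, smul_dotProduct, dotProduct_smul]
  simp only [smul_eq_mul]
  ring

theorem continuous_quadratic {ι κ : Type*} [Fintype ι] [Fintype κ] (M M' : Matrix κ ι ℝ) :
    Continuous fun z : ι → ℝ => (M *ᵥ z) ⬝ᵥ (M' *ᵥ z) :=
  (continuous_const.matrix_mulVec continuous_id).dotProduct
    (continuous_const.matrix_mulVec continuous_id)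

theorem continuousOn_scaledState :
    ContinuousOn (scaledState (k := k) Gd) {x | 0 < xiPart x} := by
  intro x hx
  have hx' : xiPart x ≠ 0 := ne_of_gt hx
  have e : ∀ (M : Matrix (Fin k ⊕ Fin n) (Fin k ⊕ Fin n) ℝ) (v : Fin k ⊕ Fin n → ℝ),
      M *ᵥ v = ∑ j, v j • (M *ᵥ Pi.single j 1) := fun M v => mulVec_eq_sum_single M v
  have h1 : ContinuousAt (fun x : ErrIdx n k → ℝ => -(Real.log (xiPart x) / 2)) x :=
    ((continuous_xiPart.continuousAt.log hx').div_const 2).neg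
  have h2 : scaledState (k := k) Gd = fun x => ∑ j, zPart x j •
      (linearGroup (barG (k := k) Gd) (-(Real.log (xiPart x) / 2)) *ᵥ Pi.single j 1) :=
    funext fun x => e _ _
  rw [h2]
  refine ContinuousAt.continuousWithinAt ?_
  refine tendsto_finsetSum _ fun j _ => ?_
  refine ContinuousAt.smul ((continuous_apply j).comp continuous_zPart).continuousAt ?_
  exact ContinuousAt.comp
    (g := fun s => linearGroup (barG (k := k) Gd) s *ᵥ Pi.single j 1)
    (hasDerivAt_linearGroup_mulVec _ _ _).continuousAt h1

/-- A function of the state that is homogeneous of degree zero, decays along solutions as long as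
`|ψ|² / 2 ≤ ξ` and `0 < ξ`, and controls the growth of `ξ`. -/
structure IsScaledLyapunov (C : Matrix (Fin k) (Fin n) ℝ) (A₀ Gd : Matrix (Fin n) (Fin n) ℝ)
    (ν : ℝ) (N : ℕ) (Lt : Matrix (Fin k) (Fin k) ℝ) (L : Matrix (Fin n) (Fin k) ℝ) (γ : ℝ)
    (W : (ErrIdx n k → ℝ) → ℝ) (c K D : ℝ) : Prop where
  rate_pos : 0 < c
  gain_pos : 0 < K
  bound_pos : 0 < D
  nonneg : ∀ x, 0 ≤ W x
  continuousOn : ContinuousOn W {x | 0 < xiPart x}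
  mul_le : ∀ x, 0 < xiPart x → W x * xiPart x ≤ D * gauge4 C A₀ ν N x ^ (1 / 2 : ℝ)
  sq_le : ∀ x, 0 < xiPart x → ∀ m ≤ N, ∀ i, augCoord C A₀ m i x ^ 2 ≤
    D * W x * xiPart x ^ (1 + ν * (m : ℝ))
  decay : ∀ (a b : ℝ) (x : ℝ → ErrIdx n k → ℝ),
    IsFilippovSolution (errorField C A₀ Gd Lt L ν γ) (Set.Ioo a b) x →
    (∀ t ∈ Set.Ioo a b, 0 < xiPart (x t) ∧
      (psiPart (x t) ⬝ᵥ psiPart (x t)) / 2 ≤ xiPart (x t)) →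
    ∀ t ∈ Set.Ioo a b, ∃ W' ξ' : ℝ, HasDerivAt (fun t => W (x t)) W' t ∧
      HasDerivAt (fun t => xiPart (x t)) ξ' t ∧
      W' ≤ -c * xiPart (x t) ^ (ν / 2) * W (x t) ∧
      ξ' ≤ xiPart (x t) ^ (1 + ν / 2) * (K * W (x t) - γ)

namespace IsGradedPair
variable (h : IsGradedPair C A₀ Gd ν N)
include h

/-- Where `|ψ|² / 2 ≤ ξ` and `0 < ξ` the field is continuous. -/
theorem hasDerivAt_solution {x : ℝ → ErrIdx n k → ℝ} {a b : ℝ}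
    (hx : IsFilippovSolution (errorField C A₀ Gd Lt L ν γ) (Set.Ioo a b) x)
    (hξ : ∀ t ∈ Set.Ioo a b, 0 < xiPart (x t)) {t : ℝ} (ht : t ∈ Set.Ioo a b) :
    HasDerivAt x (errorField C A₀ Gd Lt L ν γ (x t)) t := by
  refine hasDerivAt_pi.2 fun i => ?_
  refine hx.hasDerivAt_comp (ContinuousLinearMap.proj i) (fun s hs => ?_) ht
  refine ((ContinuousLinearMap.proj (R := ℝ) i).continuous.continuousAt).comp
    (h.continuousAt_errorField Lt L γ (Or.inr ?_))
  rw [sigmaAt, sigmaOf]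
  exact (Real.sqrt_pos.2 (lt_max_of_lt_left (hξ s hs))).ne'

theorem scaled_augRow {x : ErrIdx n k → ℝ} (hξ : 0 < xiPart x) (m : ℕ) (i : Fin k) :
    (augRow C A₀ m *ᵥ scaledState Gd x) i ^ 2 * xiPart x ^ (1 + ν * (m : ℝ)) =
      augCoord C A₀ m i x ^ 2 := by
  rw [augCoord_apply, ← linearGroup_mulVec_scaledState (Gd := Gd) x, Matrix.mulVec_mulVec,
    h.augRow_mul_linearGroup, Matrix.smul_mulVec, Pi.smul_apply, smul_eq_mul, mul_pow,
    Real.rpow_def_of_pos hξ, ← Real.exp_nat_mul, mul_comm]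
  congr 2
  push_cast
  ring

variable (hν : ν < 0) (hγ : 0 < γ)
include hν hγ

/-- The absolute value in $\dot\xi$ is nonnegative and $0\le\xi-|\psi|^2/2\le\xi$. This bounds the
speed of the rescaling and is the source of the threshold $\rho>\gamma/2$. -/
theorem neg_le_xiPart_errorField {x : ErrIdx n k → ℝ} (hξ : 0 < xiPart x)
    (he : (psiPart x ⬝ᵥ psiPart x) / 2 ≤ xiPart x) :
    -γ * xiPart x ^ (1 + ν / 2) ≤ xiPart (errorField C A₀ Gd Lt L ν γ x) := by
  have h1 := h.one_add_pos
  have h2 := dotProduct_self_nonneg' (psiPart x)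
  rw [xiPart_errorField', signedPow_of_nonneg (by linarith) (by linarith), add_comm (ν / 2)]
  have h3 : (xiPart x - (psiPart x ⬝ᵥ psiPart x) / 2) ^ (1 + ν / 2) ≤ xiPart x ^ (1 + ν / 2) :=
    Real.rpow_le_rpow (by linarith) (by linarith) (by linarith)
  have h4 := abs_nonneg (psiPart x ⬝ᵥ psiPart (errorField C A₀ Gd Lt L ν γ x))
  nlinarith

/-- The linear matrix inequality provides a quadratic Lyapunov function of the scaled state. -/
theorem exists_lyapunov {ρ : ℝ} (hρ : γ / 2 < ρ)
    {P : Matrix (Fin k ⊕ Fin n) (Fin k ⊕ Fin n) ℝ} {Y : Matrix (Fin k ⊕ Fin n) (Fin k) ℝ}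
    (hP : SolvesLMI C A₀ Gd ρ P Y) (hL : P * fromRows Lt L = Y) :
    ∃ (W : (ErrIdx n k → ℝ) → ℝ) (c K D : ℝ), IsScaledLyapunov C A₀ Gd ν N Lt L γ W c K D := by
  rw [solvesLMI_iff] at hP
  obtain ⟨hP1, hP2, hP3⟩ := hP
  set bC : Matrix (Fin k) (Fin k ⊕ Fin n) ℝ := barC with hbC
  set bG : Matrix (Fin k ⊕ Fin n) (Fin k ⊕ Fin n) ℝ := barG (k := k) Gd with hbG
  set bA : Matrix (Fin k ⊕ Fin n) (Fin k ⊕ Fin n) ℝ := barA C A₀ with hbA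
  set M : Matrix (Fin k ⊕ Fin n) (Fin k ⊕ Fin n) ℝ := bA + fromRows Lt L * bC with hM
  have hn := h.one_add_pos
  have hsymm : Pᵀ = P := by simpa using hP3.isHermitian.eq
  have hcomm : ∀ u v : Fin k ⊕ Fin n → ℝ, u ⬝ᵥ (P *ᵥ v) = v ⬝ᵥ (P *ᵥ u) := fun u v => by
    conv_lhs => rw [← hsymm, Matrix.mulVec_transpose, dotProduct_comm, ← Matrix.dotProduct_mulVec]
  have hWnn : ∀ z : Fin k ⊕ Fin n → ℝ, 0 ≤ z ⬝ᵥ (P *ᵥ z) := fun z => by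
    simpa using hP3.posSemidef.dotProduct_mulVec_nonneg z
  have hWc : Continuous fun z : Fin k ⊕ Fin n → ℝ => z ⬝ᵥ (P *ᵥ z) := by
    simpa using continuous_quadratic (1 : Matrix (Fin k ⊕ Fin n) (Fin k ⊕ Fin n) ℝ) P
  have hW2 : ∀ (c : ℝ) (z : Fin k ⊕ Fin n → ℝ),
      (c • z) ⬝ᵥ (P *ᵥ (c • z)) = c ^ 2 * (z ⬝ᵥ (P *ᵥ z)) := fun c z => by
    simpa using quadratic_smul (1 : Matrix (Fin k ⊕ Fin n) (Fin k ⊕ Fin n) ℝ) P c z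
  -- Comparison constants: `K₀` bounds $W$ by the form $\bar P\bar G+\bar G^\top\bar P$, `K₁` bounds
  -- the scaled $\psi^\top\dot\psi$ by $W$, and `K₂` bounds $|\psi|^2/\xi$ by $W$.
  obtain ⟨K₀, hK₀, hWG⟩ := hP2.exists_abs_le hWc hW2
  obtain ⟨K₁, hK₁, hCM⟩ := hP3.exists_abs_le (F := fun z => (bC *ᵥ z) ⬝ᵥ ((bC * M) *ᵥ z))
    (continuous_quadratic _ _) (quadratic_smul _ _)
  obtain ⟨K₂, hK₂, hCC⟩ := hP3.exists_abs_le (F := fun z => (bC *ᵥ z) ⬝ᵥ (bC *ᵥ z))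
    (continuous_quadratic _ _) (quadratic_smul _ _)
  have hrow : ∀ p : Fin (N + 1) × Fin k, ∃ D, 0 < D ∧ ∀ z : Fin k ⊕ Fin n → ℝ,
      |(augRow C A₀ p.1 *ᵥ z) p.2 ^ 2| ≤ D * (z ⬝ᵥ (P *ᵥ z)) := fun p =>
    hP3.exists_abs_le (F := fun z => (augRow C A₀ p.1 *ᵥ z) p.2 ^ 2)
      (((continuous_apply p.2).comp (continuous_const.matrix_mulVec continuous_id)).pow 2)
      fun c z => by simp only [Matrix.mulVec_smul, Pi.smul_apply, smul_eq_mul]; ring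
  choose D₁ hD₁ hrow using hrow
  have hWrow : ∃ D, 0 < D ∧ ∀ z : Fin k ⊕ Fin n → ℝ, z ⬝ᵥ (P *ᵥ z) ≤
      D * ∑ p : Fin (N + 1) × Fin k, (augRow C A₀ p.1 *ᵥ z) p.2 ^ 2 := by
    let R : Matrix (Fin (N + 1) × Fin k) (Fin k ⊕ Fin n) ℝ :=
      Matrix.of fun p j => augRow C A₀ p.1 p.2 j
    have hR : ∀ z, (R *ᵥ z) ⬝ᵥ (R *ᵥ z) =
        ∑ p : Fin (N + 1) × Fin k, (augRow C A₀ p.1 *ᵥ z) p.2 ^ 2 := fun z =>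
      Finset.sum_congr rfl fun p _ => (sq _).symm
    have hRT : ∀ z, z ⬝ᵥ ((Rᵀ * R) *ᵥ z) = (R *ᵥ z) ⬝ᵥ (R *ᵥ z) := fun z => by
      rw [← Matrix.mulVec_mulVec, Matrix.dotProduct_mulVec, Matrix.vecMul_transpose]
    have hRpos : (Rᵀ * R).PosDef := by
      refine Matrix.PosDef.of_dotProduct_mulVec_pos ?_ fun z hz => ?_
      · rw [Matrix.IsHermitian, Matrix.conjTranspose_eq_transpose_of_trivial,
          Matrix.transpose_mul, Matrix.transpose_transpose]
      · rw [star_trivial, hRT]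
        refine lt_of_le_of_ne (dotProduct_self_nonneg' _) fun h0 => hz (h.augRow_inj fun m hm => ?_)
        have := dotProduct_self_eq_zero.1 h0.symm
        ext i
        exact congrFun this (⟨m, by omega⟩, i)
    obtain ⟨D, hD, hDz⟩ := hRpos.exists_abs_le hWc hW2
    refine ⟨D, hD, fun z => (le_abs_self _).trans ((hDz z).trans (le_of_eq ?_))⟩
    rw [hRT, hR]
  obtain ⟨D₂, hD₂, hWrow⟩ := hWrow
  -- The matrix inequality in closed-loop form, through $\bar PM=\bar P\bar A_0+\bar Y\bar C$.
  have hΛ : ∀ z : Fin k ⊕ Fin n → ℝ, 2 * (z ⬝ᵥ (P *ᵥ (M *ᵥ z))) + ρ *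
      (z ⬝ᵥ ((P * bG + bGᵀ * P) *ᵥ z)) ≤ 0 := by
    intro z
    have h1 := hP1.dotProduct_mulVec_nonneg z
    have e1 : z ⬝ᵥ ((bAᵀ * P) *ᵥ z) = z ⬝ᵥ ((P * bA) *ᵥ z) := by
      rw [← dotProduct_mulVec_transpose, Matrix.transpose_mul, Matrix.transpose_transpose, hsymm]
    have e2 : z ⬝ᵥ ((bCᵀ * Yᵀ) *ᵥ z) = z ⬝ᵥ ((Y * bC) *ᵥ z) := by
      rw [← dotProduct_mulVec_transpose, Matrix.transpose_mul, Matrix.transpose_transpose,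
        Matrix.transpose_transpose]
    have e3 : P * M = P * bA + Y * bC := by
      rw [hM, Matrix.mul_add, ← Matrix.mul_assoc, hL]
    rw [star_trivial, Matrix.neg_mulVec, dotProduct_neg, Matrix.add_mulVec, Matrix.add_mulVec,
      Matrix.add_mulVec, Matrix.add_mulVec, Matrix.smul_mulVec, dotProduct_add, dotProduct_add,
      dotProduct_add, dotProduct_add, dotProduct_smul, e1, e2, smul_eq_mul] at h1
    rw [Matrix.mulVec_mulVec, e3, Matrix.add_mulVec, dotProduct_add]
    linarith
  have hGG : ∀ z : Fin k ⊕ Fin n → ℝ, z ⬝ᵥ ((P * bG + bGᵀ * P) *ᵥ z) =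
      2 * (z ⬝ᵥ (P *ᵥ (bG *ᵥ z))) := by
    intro z
    have e1 : z ⬝ᵥ ((bGᵀ * P) *ᵥ z) = z ⬝ᵥ ((P * bG) *ᵥ z) := by
      rw [← dotProduct_mulVec_transpose, Matrix.transpose_mul, Matrix.transpose_transpose, hsymm]
    rw [Matrix.add_mulVec, dotProduct_add, e1, Matrix.mulVec_mulVec]
    ring
  refine ⟨fun x => scaledState Gd x ⬝ᵥ (P *ᵥ scaledState Gd x), (ρ - γ / 2) / K₀,
    K₁ + γ * (K₂ / 2), D₂ * (((N : ℝ) + 1) * k + 1) + ∑ p, D₁ p, div_pos (by linarith) hK₀,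
    by positivity, ?_, fun x => hWnn _, hWc.comp_continuousOn continuousOn_scaledState,
    fun x hξ => ?_, fun x hξ m hm i => ?_, fun a b x hx hΩ t ht => ?_⟩
  · have := Finset.sum_nonneg fun p (_ : p ∈ Finset.univ) => (hD₁ p).le
    positivity
  · have hQ := gauge4_nonneg (C := C) (A₀ := A₀) (ν := ν) (N := N) x
    have hξQ : xiPart x ≤ gauge4 C A₀ ν N x ^ (1 / 2 : ℝ) := by
      have := abs_xiCoord_le (C := C) (A₀ := A₀) (ν := ν) (N := N) (x := x) le_rfl
      rw [xiCoord_apply, abs_of_pos hξ] at this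
      exact this
    have hterm : ∀ p : Fin (N + 1) × Fin k, (augRow C A₀ p.1 *ᵥ scaledState Gd x) p.2 ^ 2 *
        xiPart x ≤ gauge4 C A₀ ν N x ^ (1 / 2 : ℝ) := by
      intro p
      have hw := h.weight_pos' p
      have hw1 : 1 + ν * ((p.1 : ℕ) : ℝ) ≤ 1 := by
        have : 0 ≤ -ν * ((p.1 : ℕ) : ℝ) := mul_nonneg (by linarith) (Nat.cast_nonneg _)
        linarith
      set w := 1 + ν * ((p.1 : ℕ) : ℝ) with hw'
      have e1 := h.scaled_augRow hξ p.1 p.2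
      have e2 := h.abs_augCoord_le p (x := x) le_rfl
      rw [← hw'] at e1 e2
      have e3 : augCoord C A₀ p.1 p.2 x ^ 2 ≤ (gauge4 C A₀ ν N x ^ (1 / 2 : ℝ)) ^ w := by
        rw [← sq_abs]
        refine (pow_le_pow_left₀ (abs_nonneg _) e2 2).trans (le_of_eq ?_)
        rw [← Real.rpow_natCast, ← Real.rpow_mul hQ, ← Real.rpow_mul hQ]
        congr 1; push_cast; ring
      rw [← e1] at e3
      have hq0 : 0 < gauge4 C A₀ ν N x ^ (1 / 2 : ℝ) := hξ.trans_le hξQ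
      set Q := gauge4 C A₀ ν N x ^ (1 / 2 : ℝ)
      set y := (augRow C A₀ p.1 *ᵥ scaledState Gd x) p.2 ^ 2
      have e4 : xiPart x ^ (1 - w) ≤ Q ^ (1 - w) :=
        Real.rpow_le_rpow hξ.le hξQ (by linarith)
      have e5 : xiPart x ^ w * xiPart x ^ (1 - w) = xiPart x := by
        rw [← Real.rpow_add hξ]; simp
      have e6 : Q ^ w * Q ^ (1 - w) = Q := by
        rw [← Real.rpow_add hq0]; simp
      -- Here $w\le1$, so $\xi$ splits as $\xi^w\xi^{1-w}$: the first factor times `y` is the square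
      -- of a row of weight $w$, the second is at most $Q^{(1-w)/2}$ in terms of the gauge.
      calc y * xiPart x = y * xiPart x ^ w * xiPart x ^ (1 - w) := by rw [mul_assoc, e5]
        _ ≤ Q ^ w * Q ^ (1 - w) := by gcongr
        _ = Q := e6
    have hsum : (∑ p : Fin (N + 1) × Fin k, (augRow C A₀ p.1 *ᵥ scaledState Gd x) p.2 ^ 2) *
        xiPart x ≤ ((N : ℝ) + 1) * k * gauge4 C A₀ ν N x ^ (1 / 2 : ℝ) := by
      rw [Finset.sum_mul]
      refine (Finset.sum_le_sum fun p _ => hterm p).trans (le_of_eq ?_)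
      simp
    have hD : 0 ≤ ∑ p, D₁ p := Finset.sum_nonneg fun p _ => (hD₁ p).le
    have hQ' : 0 ≤ gauge4 C A₀ ν N x ^ (1 / 2 : ℝ) := by positivity
    have e1 := mul_le_mul_of_nonneg_right (hWrow (scaledState Gd x)) hξ.le
    rw [mul_assoc] at e1
    have e2 := mul_le_mul_of_nonneg_left hsum hD₂.le
    have e3 : 0 ≤ (D₂ + ∑ p, D₁ p) * gauge4 C A₀ ν N x ^ (1 / 2 : ℝ) := by positivity
    calc _ ≤ D₂ * (((N : ℝ) + 1) * k * gauge4 C A₀ ν N x ^ (1 / 2 : ℝ)) := e1.trans e2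
      _ ≤ _ := by linarith
  · have e1 := hrow (⟨m, by omega⟩, i) (scaledState Gd x)
    have e2 := Finset.single_le_sum (f := D₁) (fun p _ => (hD₁ p).le)
      (Finset.mem_univ ((⟨m, by omega⟩, i) : Fin (N + 1) × Fin k))
    have e3 : 0 ≤ D₂ * (((N : ℝ) + 1) * k + 1) := by positivity
    rw [← h.scaled_augRow hξ]
    refine mul_le_mul_of_nonneg_right ?_ (Real.rpow_nonneg hξ.le _)
    refine (le_abs_self _).trans (e1.trans (mul_le_mul_of_nonneg_right ?_ (hWnn _)))
    linarith
  · have hd := h.hasDerivAt_solution hx (fun s hs => (hΩ s hs).1) ht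
    obtain ⟨hξ, he⟩ := hΩ t ht
    have hdξ : HasDerivAt (fun t => xiPart (x t))
        (xiPart (errorField C A₀ Gd Lt L ν γ (x t))) t := hasDerivAt_pi.1 hd (Sum.inr 0)
    have hdz : HasDerivAt (fun t => zPart (x t))
        (zPart (errorField C A₀ Gd Lt L ν γ (x t))) t :=
      hasDerivAt_pi.2 fun i => hasDerivAt_pi.1 hd (Sum.inl i)
    have hds := ((hdξ.log hξ.ne').div_const 2).fun_neg
    have hdu := HasDerivAt.linearGroup_mulVec bG hds hdz
    rw [h.linearGroup_mulVec_zPart_errorField hξ he] at hdu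
    set u := scaledState Gd (x t) with hu
    set ξ := xiPart (x t) with hξdef
    set ξ' := xiPart (errorField C A₀ Gd Lt L ν γ (x t)) with hξ'
    set s' := -(ξ' / ξ / 2) with hs'
    have hdu' : HasDerivAt (fun t => scaledState Gd (x t))
      (s' • (bG *ᵥ u) + ξ ^ (ν / 2) • (M *ᵥ u)) t := hdu
    have hdW := hdu'.dotProduct (hdu'.const_mulVec P)
    have hpow : ξ ^ (1 + ν / 2) = ξ * ξ ^ (ν / 2) := by rw [Real.rpow_add hξ, Real.rpow_one]
    have hr : 0 < ξ ^ (ν / 2) := Real.rpow_pos_of_pos hξ _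
    refine ⟨_, _, hdW, hdξ, ?_, ?_⟩
    -- Upper bound on the coefficient of $\bar Gu$ in $\dot u$: at most $\gamma/2$ in units of
    -- $\xi^{\nu/2}$, to be set against $\rho$.
    · have hs : s' ≤ γ / 2 * ξ ^ (ν / 2) := by
        have e1 := h.neg_le_xiPart_errorField (Lt := Lt) (L := L) hν hγ hξ he
        rw [← hξ', ← hξdef, hpow] at e1
        have e2 : -γ * ξ ^ (ν / 2) ≤ ξ' / ξ := by
          rw [le_div_iff₀ hξ]; linarith
        rw [hs']; linarith
      have e1 := hΛ u
      have e2 := hWG u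
      rw [abs_of_nonneg (hWnn u)] at e2
      set G := u ⬝ᵥ ((P * bG + bGᵀ * P) *ᵥ u) with hG
      have e3 : (s' • (bG *ᵥ u) + ξ ^ (ν / 2) • (M *ᵥ u)) ⬝ᵥ (P *ᵥ u) +
          u ⬝ᵥ (P *ᵥ (s' • (bG *ᵥ u) + ξ ^ (ν / 2) • (M *ᵥ u))) =
          s' * G + ξ ^ (ν / 2) * (2 * (u ⬝ᵥ (P *ᵥ (M *ᵥ u)))) := by
        rw [hcomm, hG, hGG, Matrix.mulVec_add, Matrix.mulVec_smul, Matrix.mulVec_smul,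
          dotProduct_add, dotProduct_smul, dotProduct_smul]
        simp only [smul_eq_mul]
        ring
      refine e3.le.trans ?_
      have hG0 : 0 ≤ G := nonneg_of_mul_nonneg_right ((hWnn u).trans e2) hK₀
      have e4 : s' * G ≤ γ / 2 * ξ ^ (ν / 2) * G := mul_le_mul_of_nonneg_right hs hG0
      have e5 : ξ ^ (ν / 2) * (2 * (u ⬝ᵥ (P *ᵥ (M *ᵥ u)))) ≤ ξ ^ (ν / 2) * -(ρ * G) :=
        mul_le_mul_of_nonneg_left (by linarith) hr.le
      have e6 : (ρ - γ / 2) / K₀ * (u ⬝ᵥ (P *ᵥ u)) ≤ (ρ - γ / 2) * G := by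
        rw [div_mul_eq_mul_div, div_le_iff₀ hK₀, mul_assoc, mul_comm G]
        exact mul_le_mul_of_nonneg_left e2 (by linarith)
      have e7 := mul_le_mul_of_nonneg_left e6 hr.le
      linarith
    · have e1 := h.psiPart_dotProduct_errorField (Lt := Lt) (L := L) (γ := γ) hξ he
      have e2 := h.psiPart_dotProduct_self hξ
      have e3 := hCM u
      have e4 := (le_abs_self _).trans (hCC u)
      have e0 := dotProduct_self_nonneg' (bC *ᵥ u)
      set y := (bC *ᵥ u) ⬝ᵥ (bC *ᵥ u) with hy
      have e2' : psiPart (x t) ⬝ᵥ psiPart (x t) = ξ * y := e2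
      have e1' : psiPart (x t) ⬝ᵥ psiPart (errorField C A₀ Gd Lt L ν γ (x t)) =
          ξ ^ (1 + ν / 2) * ((bC *ᵥ u) ⬝ᵥ ((bC * M) *ᵥ u)) := by
        rw [e1, ← Matrix.mulVec_mulVec]
      have hr' : 0 < ξ ^ (1 + ν / 2) := Real.rpow_pos_of_pos hξ _
      have hy1 : y / 2 ≤ 1 := by
        rw [e2'] at he
        by_contra hcon
        push Not at hcon
        nlinarith
      have e5 : ξ - psiPart (x t) ⬝ᵥ psiPart (x t) / 2 = ξ * (1 - y / 2) := by rw [e2']; ring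
      -- On $[0,1]$ the power with exponent at most one dominates the identity, so the damping of
      -- $\xi$ is at least $\gamma(1-y/2)$, and the loss $\gamma y/2$ is absorbed into $KW$.
      have e6 : 1 - y / 2 ≤ (1 - y / 2) ^ (1 + ν / 2) := by
        conv_lhs => rw [← Real.rpow_one (1 - y / 2)]
        exact Real.rpow_le_rpow_of_exponent_ge_of_imp (by linarith) (by linarith) (by linarith)
          (fun _ hc => absurd hc (by linarith))
      have e7 : ξ' = ξ ^ (1 + ν / 2) * |(bC *ᵥ u) ⬝ᵥ ((bC * M) *ᵥ u)| -
          γ * (ξ ^ (1 + ν / 2) * (1 - y / 2) ^ (1 + ν / 2)) := by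
        rw [hξ', xiPart_errorField', e1', abs_mul, abs_of_pos hr', ← hξdef, e5,
          signedPow_of_nonneg (by linarith) (mul_nonneg hξ.le (by linarith)), add_comm (ν / 2),
          Real.mul_rpow hξ.le (by linarith)]
      have e8 : γ * (1 - y / 2) ≤ γ * (1 - y / 2) ^ (1 + ν / 2) :=
        mul_le_mul_of_nonneg_left e6 hγ.le
      have e9 : γ * y ≤ γ * (K₂ * (u ⬝ᵥ (P *ᵥ u))) := mul_le_mul_of_nonneg_left e4 hγ.le
      calc ξ' = ξ ^ (1 + ν / 2) * (|(bC *ᵥ u) ⬝ᵥ ((bC * M) *ᵥ u)| -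
            γ * (1 - y / 2) ^ (1 + ν / 2)) := by rw [e7]; ring
        _ ≤ ξ ^ (1 + ν / 2) * ((K₁ + γ * (K₂ / 2)) * (u ⬝ᵥ (P *ᵥ u)) - γ) :=
          mul_le_mul_of_nonneg_left (by linarith) hr'.le

end IsGradedPair
end Lyapunov

/-! ### Finite-time decay -/

section RealLemmas

theorem sub_le_of_hasDerivAt_le {f : ℝ → ℝ} {a b r : ℝ} (hab : a ≤ b)
    (hf : ContinuousOn f (Set.Icc a b))
    (hd : ∀ t ∈ Set.Ioo a b, ∃ f', HasDerivAt f f' t ∧ f' ≤ r) : f b - f a ≤ r * (b - a) := by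
  refine (convex_Icc a b).image_sub_le_mul_sub_of_deriv_le hf ?_ ?_ a ⟨le_rfl, hab⟩ b ⟨hab, le_rfl⟩
    hab
  · rw [interior_Icc]
    intro t ht
    obtain ⟨f', h1, -⟩ := hd t ht
    exact h1.differentiableAt.differentiableWithinAt
  · rw [interior_Icc]
    intro t ht
    obtain ⟨f', h1, h2⟩ := hd t ht
    rwa [h1.deriv]

theorem exists_last_nonpos {f : ℝ → ℝ} {a b : ℝ} (hf : ContinuousOn f (Set.Icc a b))
    (hs : ∃ s ∈ Set.Icc a b, f s ≤ 0) :
    ∃ s ∈ Set.Icc a b, f s ≤ 0 ∧ ∀ t ∈ Set.Ioc s b, 0 < f t := by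
  have hc : IsCompact (Set.Icc a b ∩ f ⁻¹' Set.Iic 0) :=
    isCompact_Icc.of_isClosed_subset (hf.preimage_isClosed_of_isClosed isClosed_Icc isClosed_Iic)
      Set.inter_subset_left
  obtain ⟨s, ⟨hs1, hs2⟩, hs3⟩ := hc.exists_isGreatest hs
  refine ⟨s, hs1, hs2, fun t ht => ?_⟩
  by_contra hcon
  exact absurd (hs3 ⟨⟨hs1.1.trans ht.1.le, ht.2⟩, not_lt.1 hcon⟩) (not_le.2 ht.1)

theorem exists_first_nonpos {f : ℝ → ℝ} {a b : ℝ} (hf : ContinuousOn f (Set.Icc a b))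
    (hs : ∃ s ∈ Set.Icc a b, f s ≤ 0) :
    ∃ s ∈ Set.Icc a b, f s ≤ 0 ∧ ∀ t ∈ Set.Ico a s, 0 < f t := by
  have hc : IsCompact (Set.Icc a b ∩ f ⁻¹' Set.Iic 0) :=
    isCompact_Icc.of_isClosed_subset (hf.preimage_isClosed_of_isClosed isClosed_Icc isClosed_Iic)
      Set.inter_subset_left
  obtain ⟨s, ⟨hs1, hs2⟩, hs3⟩ := hc.exists_isLeast hs
  refine ⟨s, hs1, hs2, fun t ht => ?_⟩
  by_contra hcon
  exact absurd (hs3 ⟨⟨ht.1, ht.2.le.trans hs1.2⟩, not_lt.1 hcon⟩) (not_le.2 ht.2)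

/-- If `u' ≤ -r u ^ (1 - β)`, then `u ^ β` decreases at least at the rate `r β`. -/
theorem rpow_le_of_hasDerivAt_le {u : ℝ → ℝ} {a b r β : ℝ} (hab : a ≤ b) (hβ : 0 ≤ β)
    (hu : ContinuousOn u (Set.Icc a b)) (hpos : ∀ t ∈ Set.Icc a b, 0 < u t)
    (hd : ∀ t ∈ Set.Ioo a b, ∃ u', HasDerivAt u u' t ∧ u' ≤ -r * u t ^ (1 - β)) :
    u b ^ β ≤ u a ^ β - r * β * (b - a) := by
  have := sub_le_of_hasDerivAt_le (f := fun t => u t ^ β) (r := -(r * β)) hab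
    (hu.rpow_const fun t ht => Or.inr hβ) fun t ht => ?_
  · linarith
  obtain ⟨u', h1, h2⟩ := hd t ht
  have hp := hpos t ⟨ht.1.le, ht.2.le⟩
  refine ⟨_, h1.rpow_const (p := β) (Or.inl hp.ne'), ?_⟩
  have e1 : u t ^ (1 - β) * u t ^ (β - 1) = 1 := by
    rw [← Real.rpow_add hp]; simp
  have e2 : 0 ≤ β * u t ^ (β - 1) := by positivity
  calc u' * β * u t ^ (β - 1) = u' * (β * u t ^ (β - 1)) := by ring
    _ ≤ -r * u t ^ (1 - β) * (β * u t ^ (β - 1)) := mul_le_mul_of_nonneg_right h2 e2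
    _ = -(r * β) * (u t ^ (1 - β) * u t ^ (β - 1)) := by ring
    _ = _ := by rw [e1, mul_one]

/-- If `u' ≤ -r u ^ (1 + α)`, then `u ^ (-α)` increases at least at the rate `r α`. -/
theorem rpow_mul_le_one_of_hasDerivAt_le {u : ℝ → ℝ} {a b r α : ℝ} (hab : a ≤ b) (hα : 0 < α)
    (hu : ContinuousOn u (Set.Icc a b)) (hpos : ∀ t ∈ Set.Icc a b, 0 ≤ u t) (hr : 0 ≤ r)
    (hd : ∀ t ∈ Set.Ioo a b, ∃ u', HasDerivAt u u' t ∧ u' ≤ -r * u t ^ (1 + α)) :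
    u b ^ α * (r * α * (b - a)) ≤ 1 := by
  have hb := hpos b ⟨hab, le_rfl⟩
  rcases hb.eq_or_lt with h0 | h0
  · rw [← h0, Real.zero_rpow hα.ne', zero_mul]; norm_num
  have hanti : ∀ t ∈ Set.Icc a b, u b ≤ u t := by
    intro t ht
    have := sub_le_of_hasDerivAt_le (f := u) (r := 0) ht.2
      (hu.mono (Set.Icc_subset_Icc_left ht.1)) fun s hs => by
        obtain ⟨u', h1, h2⟩ := hd s ⟨ht.1.trans_lt hs.1, hs.2⟩
        have := Real.rpow_nonneg (hpos s ⟨ht.1.trans hs.1.le, hs.2.le⟩) (1 + α)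
        exact ⟨u', h1, h2.trans (by nlinarith)⟩
    linarith
  have hpos' : ∀ t ∈ Set.Icc a b, 0 < u t := fun t ht => h0.trans_le (hanti t ht)
  have h1 := sub_le_of_hasDerivAt_le (f := fun t => -u t ^ (-α)) (r := -(r * α)) hab
    (hu.rpow_const fun t ht => Or.inl (hpos' t ht).ne').neg fun t ht => by
      obtain ⟨u', h1, h2⟩ := hd t ht
      have hp := hpos' t ⟨ht.1.le, ht.2.le⟩
      refine ⟨_, (h1.rpow_const (p := -α) (Or.inl hp.ne')).fun_neg, ?_⟩
      have e1 : u t ^ (1 + α) * u t ^ (-α - 1) = 1 := by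
        rw [← Real.rpow_add hp, show 1 + α + (-α - 1) = 0 by ring, Real.rpow_zero]
      have e2 : 0 ≤ α * u t ^ (-α - 1) := by positivity
      calc -(u' * -α * u t ^ (-α - 1)) = u' * (α * u t ^ (-α - 1)) := by ring
        _ ≤ -r * u t ^ (1 + α) * (α * u t ^ (-α - 1)) := mul_le_mul_of_nonneg_right h2 e2
        _ = -(r * α) * (u t ^ (1 + α) * u t ^ (-α - 1)) := by ring
        _ = _ := by rw [e1, mul_one]
  have h2 : 0 < u a ^ (-α) := Real.rpow_pos_of_pos (hpos' a ⟨le_rfl, hab⟩) _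
  have h3 : r * α * (b - a) ≤ u b ^ (-α) := by linarith
  calc u b ^ α * (r * α * (b - a)) ≤ u b ^ α * u b ^ (-α) :=
        mul_le_mul_of_nonneg_left h3 (by positivity)
    _ = 1 := by rw [← Real.rpow_add h0]; simp

end RealLemmas

/-! ### Finite-time entry into the region $|\psi|^2/2\le\xi$ -/

section Excess
variable {n k : ℕ} {C : Matrix (Fin k) (Fin n) ℝ} {A₀ Gd : Matrix (Fin n) (Fin n) ℝ} {ν : ℝ}
  {N : ℕ} {Lt : Matrix (Fin k) (Fin k) ℝ} {L : Matrix (Fin n) (Fin k) ℝ} {γ : ℝ}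

/-- The excess of `|ψ|² / 2` over `ξ`. -/
def excess (x : ErrIdx n k → ℝ) : ℝ := (psiPart x ⬝ᵥ psiPart x) / 2 - xiPart x

theorem continuous_excess : Continuous (excess (n := n) (k := k)) :=
  ((continuous_psiPart.dotProduct continuous_psiPart).div_const 2).sub continuous_xiPart

theorem xiPart_nonneg_of_excess {x : ErrIdx n k → ℝ} (hx : excess x ≤ 0) : 0 ≤ xiPart x := by
  have := dotProduct_self_nonneg' (psiPart x)
  unfold excess at hx
  linarith

namespace IsGradedPair
variable (h : IsGradedPair C A₀ Gd ν N)
include h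

/-- The term $|\psi^\top\dot\psi|$ in $\dot\xi$ outweighs $\psi^\top\dot\psi$, leaving only the
signed power. Continuity of the $\psi$- and $\xi$-components makes the derivative classical. -/
theorem hasDerivAt_excess {x : ℝ → ErrIdx n k → ℝ} {a b : ℝ}
    (hx : IsFilippovSolution (errorField C A₀ Gd Lt L ν γ) (Set.Ioo a b) x) {t : ℝ}
    (ht : t ∈ Set.Ioo a b) (he : 0 < excess (x t)) :
    ∃ e', HasDerivAt (fun t => excess (x t)) e' t ∧ e' ≤ -γ * excess (x t) ^ (1 + ν / 2) := by
  have h1 : HasDerivAt (fun t => psiPart (x t))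
      (psiPart (errorField C A₀ Gd Lt L ν γ (x t))) t := by
    refine hasDerivAt_pi.2 fun i => ?_
    exact hx.hasDerivAt_comp (ContinuousLinearMap.proj (Sum.inl (Sum.inl i))) (fun s hs =>
      ((continuous_apply i).comp (h.continuous_psiPart_errorField Lt L γ)).continuousAt) ht
  have h2 : HasDerivAt (fun t => xiPart (x t))
      (xiPart (errorField C A₀ Gd Lt L ν γ (x t))) t :=
    hx.hasDerivAt_comp (ContinuousLinearMap.proj (Sum.inr 0)) (fun s hs =>
      (h.continuous_xiPart_errorField Lt L γ).continuousAt) ht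
  refine ⟨_, ((h1.dotProduct h1).div_const 2).sub h2, ?_⟩
  rw [xiPart_errorField', dotProduct_comm (psiPart (errorField C A₀ Gd Lt L ν γ (x t)))]
  have h3 : signedPow (xiPart (x t) - (psiPart (x t) ⬝ᵥ psiPart (x t)) / 2) (ν / 2 + 1) =
      -excess (x t) ^ (1 + ν / 2) := by
    have e : xiPart (x t) - (psiPart (x t) ⬝ᵥ psiPart (x t)) / 2 = -excess (x t) := by
      unfold excess; ring
    rw [e, signedPow, abs_neg, abs_of_pos he, Real.sign_of_neg (by linarith), add_comm]
    ring
  rw [h3]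
  have h4 := le_abs_self (psiPart (x t) ⬝ᵥ psiPart (errorField C A₀ Gd Lt L ν γ (x t)))
  linarith

variable (hν : ν < 0) (hγ : 0 < γ)
include hν hγ

omit hν hγ in
theorem excess_le {x : ErrIdx n k → ℝ} {q : ℝ} (hq : gauge4 C A₀ ν N x ≤ q) :
    excess x ≤ ((k : ℝ) / 2 + 1) * q ^ (1 / 2 : ℝ) := by
  have hq0 := (gauge4_nonneg x).trans hq
  have h1 := abs_xiCoord_le hq
  have h2 : ∀ i, psiPart x i * psiPart x i ≤ q ^ (1 / 2 : ℝ) := by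
    intro i
    have e1 := h.abs_augCoord_le (0, i) hq
    have e2 : augCoord C A₀ ((0 : Fin (N + 1)) : ℕ) i x = psiPart x i := by
      rw [augCoord_apply, ← barC_mulVec_zPart]; rfl
    rw [e2] at e1
    rw [← abs_mul_abs_self]
    refine (mul_le_mul e1 e1 (abs_nonneg _) (by positivity)).trans (le_of_eq ?_)
    rw [← Real.rpow_add_of_nonneg hq0 (by simp) (by simp)]
    congr 1
    simp
    norm_num
  have h3 : psiPart x ⬝ᵥ psiPart x ≤ k * q ^ (1 / 2 : ℝ) := by
    refine (Finset.sum_le_sum fun i _ => h2 i).trans (le_of_eq ?_)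
    simp
  have h4 := neg_le_abs (xiCoord x)
  rw [xiCoord_apply] at h1 h4
  unfold excess
  linarith

/-- While positive, the excess to the power $-\nu/2$ falls at a definite rate from a value at most
of order $q^{-\nu/4}$. It cannot become positive again, since after its last nonpositive time it
would be nonincreasing. -/
theorem exists_excess_nonpos : ∃ c : ℝ, 0 < c ∧ ∀ x : ℝ → ErrIdx n k → ℝ,
    IsFilippovSolution (errorField C A₀ Gd Lt L ν γ) (Set.Ici 0) x → ∀ q : ℝ, 0 < q →
    gauge4 C A₀ ν N (x 0) ≤ q → ∀ t, c * q ^ (-ν / 4) ≤ t → excess (x t) ≤ 0 := by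
  set d : ℝ := (k : ℝ) / 2 + 1 with hd
  have hd0 : 0 < d := by positivity
  have hα : 0 < -ν / 2 := by linarith
  refine ⟨d ^ (-ν / 2) / (γ * (-ν / 2)), by positivity, fun x hx q hq hxq t ht => ?_⟩
  have ht0 : 0 ≤ t := le_trans (by positivity) ht
  have hcont : ∀ s, 0 ≤ s → ∀ r, s ≤ r → ContinuousOn (fun t => excess (x t)) (Set.Icc s r) :=
    fun s hs r hsr => continuous_excess.comp_continuousOn
      ((hx.mono fun t ht => hs.trans ht.1).continuousOn hsr)
  have hex : ∃ s ∈ Set.Icc 0 t, excess (x s) ≤ 0 := by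
    by_contra hcon
    push Not at hcon
    have h1 := rpow_le_of_hasDerivAt_le (u := fun t => excess (x t)) (r := γ) (β := -ν / 2) ht0
      hα.le (hcont 0 le_rfl t ht0) hcon fun s hs => by
        obtain ⟨e', h1, h2⟩ := h.hasDerivAt_excess (hx.mono fun t ht => ht.1.le) hs
          (hcon s ⟨hs.1.le, hs.2.le⟩)
        refine ⟨e', h1, h2.trans (le_of_eq ?_)⟩
        congr 2; ring
    have h2 : 0 < excess (x t) ^ (-ν / 2) :=
      Real.rpow_pos_of_pos (hcon t ⟨ht0, le_rfl⟩) _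
    have h3 : excess (x 0) ^ (-ν / 2) ≤ d ^ (-ν / 2) * q ^ (-ν / 4) := by
      refine (Real.rpow_le_rpow (hcon 0 ⟨le_rfl, ht0⟩).le (h.excess_le hxq) hα.le).trans
        (le_of_eq ?_)
      rw [Real.mul_rpow hd0.le (by positivity), ← Real.rpow_mul hq.le]
      congr 2; ring
    rw [div_mul_eq_mul_div, div_le_iff₀ (by positivity)] at ht
    linarith
  obtain ⟨s, hs, hs0, hpos⟩ := exists_last_nonpos (hcont 0 le_rfl t ht0) hex
  have h1 := sub_le_of_hasDerivAt_le (f := fun t => excess (x t)) (r := 0) hs.2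
    (hcont s hs.1 t hs.2) fun r hr => by
      have hp := hpos r ⟨hr.1, hr.2.le⟩
      obtain ⟨e', h1, h2⟩ := h.hasDerivAt_excess (hx.mono fun t ht => hs.1.trans ht.1.le) hr hp
      refine ⟨e', h1, h2.trans ?_⟩
      have := Real.rpow_nonneg hp.le (1 + ν / 2)
      nlinarith
  linarith

end IsGradedPair
end Excess

/-! ### Finite-time stability of the error equation -/

section Stability
variable {n k : ℕ} {C : Matrix (Fin k) (Fin n) ℝ} {A₀ Gd : Matrix (Fin n) (Fin n) ℝ} {ν : ℝ}
  {N : ℕ} {Lt : Matrix (Fin k) (Fin k) ℝ} {L : Matrix (Fin n) (Fin k) ℝ} {γ : ℝ}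
  {W : (ErrIdx n k → ℝ) → ℝ} {c K D : ℝ}

namespace IsGradedPair
variable (h : IsGradedPair C A₀ Gd ν N)
include h

theorem eq_zero_of_augCoord {x : ErrIdx n k → ℝ} (hx : ∀ m ≤ N, ∀ i, augCoord C A₀ m i x = 0)
    (hξ : xiPart x = 0) : x = 0 := by
  have hz : zPart x = 0 := h.augRow_inj fun m hm => funext fun i => hx m hm i
  ext (i | i)
  · exact congrFun hz i
  · rw [Subsingleton.elim i 0]; exact hξ

/-- A solution on which `ξ` vanishes identically is zero. -/
theorem eq_zero_of_xiPart_eq_zero_on {x : ℝ → ErrIdx n k → ℝ} {a b : ℝ}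
    (hx : IsFilippovSolution (errorField C A₀ Gd Lt L ν γ) (Set.Ioo a b) x)
    (he : ∀ t ∈ Set.Ioo a b, excess (x t) ≤ 0) (hξ : ∀ t ∈ Set.Ioo a b, xiPart (x t) = 0)
    {t : ℝ} (ht : t ∈ Set.Ioo a b) : x t = 0 := by
  have hψ : ∀ s ∈ Set.Ioo a b, psiPart (x s) = 0 := by
    intro s hs
    have h1 := he s hs
    have h2 := dotProduct_self_nonneg' (psiPart (x s))
    unfold excess at h1
    rw [hξ s hs] at h1
    exact dotProduct_self_eq_zero.1 (le_antisymm (by linarith) h2)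
  -- Differentiating the vanishing row $m$ yields the row $m+1$, because $\psi=0$ removes the
  -- injection. For $m<N$ the velocity of row $m$ is continuous, so Filippov solutions satisfy the
  -- equation classically there.
  have hrow : ∀ m ≤ N, ∀ s ∈ Set.Ioo a b, ∀ i, augCoord C A₀ m i (x s) = 0 := by
    intro m
    induction m with
    | zero =>
      intro _ s hs i
      have : augCoord C A₀ 0 i (x s) = psiPart (x s) i := by
        rw [augCoord_apply, ← barC_mulVec_zPart]; rfl
      rw [this, hψ s hs]; rfl
    | succ m ih =>
      intro hm s hs i
      have hw := h.weight_pos (m + 1) hm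
      push_cast at hw
      have h1 := hx.hasDerivAt_comp (augCoord C A₀ m i)
        (fun r _ => h.continuousAt_augRow Lt L γ i (Or.inl hw)) hs
      have h2 : HasDerivAt (fun r => augCoord C A₀ m i (x r)) 0 s := by
        refine (hasDerivAt_const s (0 : ℝ)).congr_of_eventuallyEq ?_
        filter_upwards [Ioo_mem_nhds hs.1 hs.2] with r hr
        exact ih (by omega) r hr i
      have h3 := h1.unique h2
      rw [augCoord_apply, h.augRow_errorField Lt L γ, hψ s hs, Matrix.mulVec_zero, smul_zero,
        add_zero] at h3
      exact h3
  exact h.eq_zero_of_augCoord (fun m hm i => hrow m hm t ht i) (hξ t ht)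

theorem exists_norm_lt_of_gauge4_lt (hν : ν < 0) {r : ℝ} (hr : 0 < r) :
    ∃ m : ℝ, 0 < m ∧ ∀ y : ErrIdx n k → ℝ, gauge4 C A₀ ν N y < m → ‖y‖ < r := by
  obtain ⟨R, hR⟩ := h.exists_norm_le_of_gauge4_le 1
  have hcQ : Continuous (gauge4 C A₀ ν N) := (h.contDiff_gauge4 hν).continuous
  have hS : IsCompact (Metric.closedBall (0 : ErrIdx n k → ℝ) R ∩ {y | r ≤ ‖y‖}) :=
    (isCompact_closedBall _ _).inter_right (isClosed_le continuous_const continuous_norm)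
  rcases (Metric.closedBall (0 : ErrIdx n k → ℝ) R ∩ {y | r ≤ ‖y‖}).eq_empty_or_nonempty
    with hem | hne
  · refine ⟨1, one_pos, fun y hy => not_le.1 fun hry => ?_⟩
    have : y ∈ Metric.closedBall (0 : ErrIdx n k → ℝ) R ∩ {y | r ≤ ‖y‖} :=
      ⟨by simpa using hR y hy.le, hry⟩
    rw [hem] at this
    exact this
  · obtain ⟨y₀, hy₀, hmin⟩ := hS.exists_isMinOn hne hcQ.continuousOn
    have hpos : 0 < gauge4 C A₀ ν N y₀ := by
      refine lt_of_le_of_ne (gauge4_nonneg _) fun h0 => ?_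
      have h1 : r ≤ ‖y₀‖ := hy₀.2
      rw [h.eq_zero_of_gauge4_eq_zero h0.symm, norm_zero] at h1
      exact absurd hr (not_lt.2 h1)
    refine ⟨min 1 (gauge4 C A₀ ν N y₀), lt_min one_pos hpos, fun y hy => not_le.1 fun hry => ?_⟩
    exact absurd (hy.trans_le (min_le_right _ _)) (not_lt.2
      (hmin ⟨by simpa using hR y (hy.trans_le (min_le_left _ _)).le, hry⟩))

end IsGradedPair

namespace IsScaledLyapunov
variable (hW : IsScaledLyapunov C A₀ Gd ν N Lt L γ W c K D)
include hW

theorem antitone {x : ℝ → ErrIdx n k → ℝ} {a b : ℝ} (hab : a ≤ b)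
    (hx : IsFilippovSolution (errorField C A₀ Gd Lt L ν γ) (Set.Icc a b) x)
    (he : ∀ t ∈ Set.Icc a b, excess (x t) ≤ 0) (hξ : ∀ t ∈ Set.Icc a b, 0 < xiPart (x t)) :
    W (x b) ≤ W (x a) := by
  have h1 := sub_le_of_hasDerivAt_le (f := fun t => W (x t)) (r := 0) hab
    (hW.continuousOn.comp (hx.continuousOn hab) hξ) fun t ht => by
      obtain ⟨W', ξ', e1, -, e2, -⟩ := hW.decay a b x (hx.mono Set.Ioo_subset_Icc_self)
        (fun s hs => ⟨hξ s (Set.Ioo_subset_Icc_self hs),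
          sub_nonpos.1 (he s (Set.Ioo_subset_Icc_self hs))⟩) t ht
      refine ⟨W', e1, e2.trans ?_⟩
      have e3 := Real.rpow_nonneg (hξ t (Set.Ioo_subset_Icc_self ht)).le (ν / 2)
      have e4 := hW.nonneg (x t)
      have e5 := hW.rate_pos
      have : 0 ≤ c * xiPart (x t) ^ (ν / 2) * W (x t) := by positivity
      linarith
  linarith

/-- When `ξ` reaches zero, so does the whole state. -/
theorem eq_zero_of_xiPart_tendsto (h : IsGradedPair C A₀ Gd ν N) {x : ℝ → ErrIdx n k → ℝ}
    {a b : ℝ} (hab : a < b)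
    (hx : IsFilippovSolution (errorField C A₀ Gd Lt L ν γ) (Set.Icc a b) x)
    (he : ∀ t ∈ Set.Icc a b, excess (x t) ≤ 0) (hξ : ∀ t ∈ Set.Ico a b, 0 < xiPart (x t))
    (hb : xiPart (x b) = 0) : x b = 0 := by
  have hcont : Tendsto x (𝓝[<] b) (𝓝 (x b)) := by
    have h1 := hx.continuousOn hab.le b ⟨hab.le, le_rfl⟩
    refine h1.tendsto.mono_left ?_
    rw [← nhdsWithin_Ico_eq_nhdsLT hab]
    exact nhdsWithin_mono _ Set.Ico_subset_Icc_self
  refine h.eq_zero_of_augCoord (fun m hm i => ?_) hb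
  have hw := h.weight_pos m hm
  have h1 : Tendsto (fun t => augCoord C A₀ m i (x t) ^ 2) (𝓝[<] b)
      (𝓝 (augCoord C A₀ m i (x b) ^ 2)) :=
    (((augCoord C A₀ m i).continuous.tendsto _).comp hcont).pow 2
  -- $W$ does not increase on the approach, so each squared row is bounded by a constant times a
  -- positive power of $\xi$, which tends to zero.
  have h2 : Tendsto (fun t => D * W (x a) * xiPart (x t) ^ (1 + ν * (m : ℝ))) (𝓝[<] b)
      (𝓝 (D * W (x a) * xiPart (x b) ^ (1 + ν * (m : ℝ)))) :=
    (((continuous_xiPart.tendsto _).comp hcont).rpow_const (Or.inr hw.le)).const_mul _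
  rw [hb, Real.zero_rpow hw.ne', mul_zero] at h2
  have h3 := le_of_tendsto_of_tendsto h1 h2 (by
    rw [EventuallyLE, ← nhdsWithin_Ico_eq_nhdsLT hab]
    filter_upwards [self_mem_nhdsWithin] with t ht
    have hsub : Set.Icc a t ⊆ Set.Icc a b := Set.Icc_subset_Icc_right ht.2.le
    have e1 := hW.antitone ht.1 (hx.mono hsub) (fun s hs => he s (hsub hs))
      fun s hs => hξ s ⟨hs.1, hs.2.trans_lt ht.2⟩
    have e2 := hW.sq_le (x t) (hξ t ht) m hm i
    have e3 := hW.bound_pos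
    have e4 := Real.rpow_nonneg (hξ t ht).le (1 + ν * (m : ℝ))
    exact e2.trans (mul_le_mul_of_nonneg_right (mul_le_mul_of_nonneg_left e1 e3.le) e4))
  exact pow_eq_zero_iff (two_ne_zero) |>.1 (le_antisymm h3 (sq_nonneg _))

/-- If the state at `b` were nonzero, it would be nonzero just before. There $\xi$ either vanishes
identically, which forces the zero state, or is positive somewhere, and then the state vanishes at
the next zero of $\xi$. -/
theorem eq_zero_of_xiPart_eq_zero (h : IsGradedPair C A₀ Gd ν N) {x : ℝ → ErrIdx n k → ℝ}
    {a b : ℝ} (hab : a < b)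
    (hx : IsFilippovSolution (errorField C A₀ Gd Lt L ν γ) (Set.Icc a b) x)
    (he : ∀ t ∈ Set.Icc a b, excess (x t) ≤ 0) (hb : xiPart (x b) = 0) : x b = 0 := by
  by_contra hne
  have hcont := hx.continuousOn hab.le
  have hev : ∀ᶠ t in 𝓝[<] b, x t ≠ 0 ∧ t ∈ Set.Ico a b := by
    rw [← nhdsWithin_Ico_eq_nhdsLT hab]
    refine Eventually.and ?_ self_mem_nhdsWithin
    exact ((hcont b ⟨hab.le, le_rfl⟩).mono Set.Ico_subset_Icc_self).eventually_ne hne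
  obtain ⟨l, hl, hlb⟩ := (mem_nhdsLT_iff_exists_Ioo_subset' hab).1 hev
  have hmem : ∀ t ∈ Set.Ioo l b, x t ≠ 0 ∧ t ∈ Set.Ico a b := fun t ht => hlb ht
  have hsub : Set.Ioo l b ⊆ Set.Icc a b := fun t ht => Set.Ico_subset_Icc_self (hmem t ht).2
  have hex : ∃ s ∈ Set.Ioo l b, 0 < xiPart (x s) := by
    by_contra hcon
    push Not at hcon
    have hmid : (l + b) / 2 ∈ Set.Ioo l b := by
      have : l < b := hl
      constructor <;> linarith
    refine (hmem _ hmid).1 (h.eq_zero_of_xiPart_eq_zero_on (hx.mono hsub)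
      (fun t ht => he t (hsub ht)) (fun t ht => ?_) hmid)
    exact le_antisymm (hcon t ht) (xiPart_nonneg_of_excess (he t (hsub ht)))
  obtain ⟨s, hs, hspos⟩ := hex
  have hsub' : Set.Icc s b ⊆ Set.Icc a b := Set.Icc_subset_Icc_left (hsub hs).1
  obtain ⟨r, hr, hr0, hrpos⟩ := exists_first_nonpos
    (continuous_xiPart.comp_continuousOn (hcont.mono hsub')) ⟨b, ⟨hs.2.le, le_rfl⟩, hb.le⟩
  have hsr : s < r := by
    refine lt_of_le_of_ne hr.1 fun hcon => ?_
    rw [← hcon] at hr0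
    exact absurd hspos (not_lt.2 hr0)
  have hr0' : xiPart (x r) = 0 := le_antisymm hr0 (xiPart_nonneg_of_excess (he r (hsub' hr)))
  have hsubr : Set.Icc s r ⊆ Set.Icc a b := (Set.Icc_subset_Icc_right hr.2).trans hsub'
  have hxr := hW.eq_zero_of_xiPart_tendsto h hsr (hx.mono hsubr) (fun t ht => he t (hsubr ht))
    hrpos hr0'
  rcases hr.2.eq_or_lt with hrb | hrb
  · exact hne (hrb ▸ hxr)
  · exact (hmem r ⟨hs.1.trans hsr, hrb⟩).1 hxr

variable (h : IsGradedPair C A₀ Gd ν N) (hν : ν < 0) (hγ : 0 < γ)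
include h hν hγ

/-- The decay of `W` on an interval on which the gauge is bounded. -/
theorem rpow_mul_le {x : ℝ → ErrIdx n k → ℝ} {a b B : ℝ} (hab : a ≤ b) (hB : 0 < B)
    (hx : IsFilippovSolution (errorField C A₀ Gd Lt L ν γ) (Set.Icc a b) x)
    (he : ∀ t ∈ Set.Icc a b, excess (x t) ≤ 0) (hξ : ∀ t ∈ Set.Icc a b, 0 < xiPart (x t))
    (hQ : ∀ t ∈ Set.Icc a b, gauge4 C A₀ ν N (x t) ^ (-ν / 4) ≤ B) :
    W (x b) ^ (-ν / 2) * (c * (D ^ (ν / 2) * B⁻¹) * (-ν / 2) * (b - a)) ≤ 1 := by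
  have hc := hW.rate_pos
  have hD := hW.bound_pos
  refine rpow_mul_le_one_of_hasDerivAt_le (u := fun t => W (x t)) hab (by linarith)
    (hW.continuousOn.comp (hx.continuousOn hab) hξ) (fun t _ => hW.nonneg _) (by positivity)
    fun t ht => ?_
  have ht' := Set.Ioo_subset_Icc_self ht
  obtain ⟨W', ξ', e1, -, e2, -⟩ := hW.decay a b x (hx.mono Set.Ioo_subset_Icc_self)
    (fun s hs => ⟨hξ s (Set.Ioo_subset_Icc_self hs),
      sub_nonpos.1 (he s (Set.Ioo_subset_Icc_self hs))⟩) t ht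
  refine ⟨W', e1, e2.trans ?_⟩
  have hξt := hξ t ht'
  have hWt := hW.nonneg (x t)
  rcases hWt.eq_or_lt with h0 | h0
  · rw [← h0, Real.zero_rpow (by linarith)]; simp
  have e3 := hW.mul_le (x t) hξt
  have hQt := gauge4_nonneg (C := C) (A₀ := A₀) (ν := ν) (N := N) (x t)
  have e4 : (D * gauge4 C A₀ ν N (x t) ^ (1 / 2 : ℝ)) ^ (-ν / 2) ≤ D ^ (-ν / 2) * B := by
    rw [Real.mul_rpow hD.le (by positivity), ← Real.rpow_mul hQt]
    refine mul_le_mul_of_nonneg_left ((le_of_eq ?_).trans (hQ t ht')) (by positivity)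
    congr 1; ring
  have e5 := Real.rpow_le_rpow (by positivity) e3 (z := -ν / 2) (by linarith)
  rw [Real.mul_rpow hWt hξt.le] at e5
  have e6 : D ^ (ν / 2) * D ^ (-ν / 2) = 1 := by
    rw [← Real.rpow_add hD, show ν / 2 + -ν / 2 = 0 by ring, Real.rpow_zero]
  have e7 : xiPart (x t) ^ (-ν / 2) * xiPart (x t) ^ (ν / 2) = 1 := by
    rw [← Real.rpow_add hξt, show -ν / 2 + ν / 2 = 0 by ring, Real.rpow_zero]
  -- Large $W$ forces small $\xi$ by $W\xi\le DQ^{1/2}$, and for $\nu<0$ small $\xi$ accelerates the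
  -- decay. The resulting superlinear rate gives a bound on $W$ independent of its initial value.
  have e8 : D ^ (ν / 2) * B⁻¹ * W (x t) ^ (-ν / 2) ≤ xiPart (x t) ^ (ν / 2) := by
    have := e5.trans e4
    calc D ^ (ν / 2) * B⁻¹ * W (x t) ^ (-ν / 2) = D ^ (ν / 2) * B⁻¹ *
          (W (x t) ^ (-ν / 2) * xiPart (x t) ^ (-ν / 2)) * xiPart (x t) ^ (ν / 2) := by
          rw [mul_assoc _ _ (xiPart (x t) ^ (ν / 2)), mul_assoc (W (x t) ^ (-ν / 2)), e7, mul_one]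
      _ ≤ D ^ (ν / 2) * B⁻¹ * (D ^ (-ν / 2) * B) * xiPart (x t) ^ (ν / 2) := by gcongr
      _ = (D ^ (ν / 2) * D ^ (-ν / 2)) * (B⁻¹ * B) * xiPart (x t) ^ (ν / 2) := by ring
      _ = _ := by rw [e6, inv_mul_cancel₀ hB.ne']; ring
  have e9 : W (x t) ^ (1 + -ν / 2) = W (x t) ^ (-ν / 2) * W (x t) := by
    rw [Real.rpow_add h0, Real.rpow_one, mul_comm]
  rw [e9]
  have e10 := mul_le_mul_of_nonneg_right (mul_le_mul_of_nonneg_left e8 hc.le) hWt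
  linarith

/-- A bound for the length of an interval on which `ξ` is positive, in terms of `W`. -/
theorem mul_le_rpow {x : ℝ → ErrIdx n k → ℝ} {a b : ℝ} (hab : a ≤ b)
    (hx : IsFilippovSolution (errorField C A₀ Gd Lt L ν γ) (Set.Icc a b) x)
    (he : ∀ t ∈ Set.Icc a b, excess (x t) ≤ 0) (hξ : ∀ t ∈ Set.Icc a b, 0 < xiPart (x t)) :
    γ * (-ν / 2) * (b - a) ≤ (xiPart (x a) * Real.exp (K / c * W (x a))) ^ (-ν / 2) := by
  have hc := hW.rate_pos
  have hK := hW.gain_pos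
  have hWc : ContinuousOn (fun t => W (x t)) (Set.Icc a b) :=
    hW.continuousOn.comp (hx.continuousOn hab) hξ
  have hξc : ContinuousOn (fun t => xiPart (x t)) (Set.Icc a b) :=
    continuous_xiPart.comp_continuousOn (hx.continuousOn hab)
  -- The factor $e^{KW/c}$ is chosen so that the decay of $W$ cancels the growth term
  -- $K\xi^{1+\nu/2}W$ of $\dot\xi$ and leaves the pure damping $-\gamma\xi^{1+\nu/2}$.
  have h1 := rpow_le_of_hasDerivAt_le (u := fun t => xiPart (x t) * Real.exp (K / c * W (x t)))
    (r := γ) (β := -ν / 2) hab (by linarith) (hξc.mul (hWc.const_smul (K / c)).rexp)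
    (fun t ht => mul_pos (hξ t ht) (Real.exp_pos _)) fun t ht => by
      obtain ⟨W', ξ', e1, e2, e3, e4⟩ := hW.decay a b x (hx.mono Set.Ioo_subset_Icc_self)
        (fun s hs => ⟨hξ s (Set.Ioo_subset_Icc_self hs),
          sub_nonpos.1 (he s (Set.Ioo_subset_Icc_self hs))⟩) t ht
      refine ⟨_, e2.mul (e1.const_mul (K / c)).exp, ?_⟩
      have hξt := hξ t (Set.Ioo_subset_Icc_self ht)
      have hWt := hW.nonneg (x t)
      set w := W (x t)
      set y := xiPart (x t)
      have hy : y ^ (1 + ν / 2) = y * y ^ (ν / 2) := by rw [Real.rpow_add hξt, Real.rpow_one]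
      have e5 : y * (K / c * W') ≤ -(K * y ^ (1 + ν / 2) * w) := by
        have := mul_le_mul_of_nonneg_left e3 (by positivity : 0 ≤ y * (K / c))
        rw [hy]
        calc _ = y * (K / c) * W' := by ring
          _ ≤ _ := this
          _ = _ := by field_simp
      have e6 : Real.exp (K / c * w) ^ (1 - -ν / 2) ≤ Real.exp (K / c * w) := by
        rw [← Real.exp_mul]
        refine Real.exp_le_exp.2 ?_
        have : 0 ≤ K / c * w := by positivity
        nlinarith
      have e7 : 0 < Real.exp (K / c * w) := Real.exp_pos _
      have e8 : 0 ≤ y ^ (1 + ν / 2) := by positivity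
      rw [Real.mul_rpow hξt.le e7.le, show y ^ (1 - -ν / 2) = y ^ (1 + ν / 2) by congr 1; ring]
      calc ξ' * Real.exp (K / c * w) + y * (Real.exp (K / c * w) * (K / c * W'))
          = (ξ' + y * (K / c * W')) * Real.exp (K / c * w) := by ring
        _ ≤ (-γ * y ^ (1 + ν / 2)) * Real.exp (K / c * w) :=
          mul_le_mul_of_nonneg_right (by linarith) e7.le
        _ ≤ -γ * (y ^ (1 + ν / 2) * Real.exp (K / c * w) ^ (1 - -ν / 2)) := by
          have := mul_le_mul_of_nonneg_left e6 (mul_nonneg hγ.le e8)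
          linarith
  have h2 : 0 ≤ (xiPart (x b) * Real.exp (K / c * W (x b))) ^ (-ν / 2) :=
    Real.rpow_nonneg (mul_nonneg (hξ b ⟨hab, le_rfl⟩).le (Real.exp_pos _).le) _
  linarith

/-- The component `ξ` cannot stay positive for a long time. -/
theorem exists_not_pos : ∃ T : ℝ, 0 < T ∧ ∀ (a b : ℝ) (x : ℝ → ErrIdx n k → ℝ) (q : ℝ), 0 < q →
    IsFilippovSolution (errorField C A₀ Gd Lt L ν γ) (Set.Icc a b) x →
    (∀ t ∈ Set.Icc a b, excess (x t) ≤ 0) → gauge4 C A₀ ν N (x a) ≤ q →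
    T * q ^ (-ν / 4) ≤ b - a → ∃ t ∈ Set.Ioc a b, xiPart (x t) ≤ 0 := by
  obtain ⟨M, hM, hgrow⟩ := h.exists_gauge4_growth hν Lt L γ
  have hc := hW.rate_pos
  have hK := hW.gain_pos
  have hD := hW.bound_pos
  have hα : 0 < -ν / 2 := by linarith
  set B : ℝ := 1 + 2 * M with hB
  have hB0 : 0 < B := by positivity
  set d : ℝ := c * (D ^ (ν / 2) * B⁻¹) * (-ν / 2) with hd
  have hd0 : 0 < d := by positivity
  set W₁ : ℝ := (1 / d) ^ (1 / (-ν / 2)) with hW₁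
  have hW₁0 : 0 < W₁ := by positivity
  -- In units of $r=q^{-\nu/4}$: one unit to leave the left end, where $\xi$ may vanish, one to
  -- bring $W$ below `W₁`, and the rest to exhaust $\xi e^{KW/c}$; the summand $1$ makes the
  -- contradiction strict. $B=1+2M$ bounds $Q^{-\nu/4}/r$ over the first two units.
  refine ⟨2 + (B * Real.exp (K / c * W₁) ^ (-ν / 2) + 1) / (γ * (-ν / 2)), by positivity,
    fun a b x q hq hx he hxq hT => ?_⟩
  by_contra hcon
  push Not at hcon
  set r : ℝ := q ^ (-ν / 4) with hr
  have hr0 : 0 < r := Real.rpow_pos_of_pos hq _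
  have hT' : 2 * r + (B * Real.exp (K / c * W₁) ^ (-ν / 2) + 1) / (γ * (-ν / 2)) * r ≤ b - a := by
    rw [← add_mul]; exact hT
  have hT0 : 0 < (B * Real.exp (K / c * W₁) ^ (-ν / 2) + 1) / (γ * (-ν / 2)) * r := by positivity
  set a₁ := a + r with ha₁
  set a₂ := a + 2 * r with ha₂
  have h12 : Set.Icc a₁ a₂ ⊆ Set.Icc a b := Set.Icc_subset_Icc (by linarith) (by linarith)
  have h2b : Set.Icc a₂ b ⊆ Set.Icc a b := Set.Icc_subset_Icc (by linarith) le_rfl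
  have hQ : ∀ t ∈ Set.Icc a a₂, gauge4 C A₀ ν N (x t) ^ (-ν / 4) ≤ B * r := by
    intro t ht
    have e1 := hgrow a t ht.1 x
      (hx.mono (Set.Icc_subset_Icc_right (ht.2.trans (by linarith))))
    have e2 : gauge4 C A₀ ν N (x a) ^ (-ν / 4) ≤ r :=
      Real.rpow_le_rpow (gauge4_nonneg _) hxq (by linarith)
    have e3 : M * (t - a) ≤ M * (2 * r) :=
      mul_le_mul_of_nonneg_left (by linarith [ht.2]) hM.le
    rw [hB]; linarith
  have hW2 : W (x a₂) ≤ W₁ := by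
    have e1 := hW.rpow_mul_le h hν hγ (a := a₁) (b := a₂) (B := B * r) (by linarith)
      (by positivity) (hx.mono h12) (fun t ht => he t (h12 ht))
      (fun t ht => hcon t ⟨by linarith [ht.1], (h12 ht).2⟩)
      (fun t ht => hQ t ⟨by linarith [ht.1], ht.2⟩)
    have e2 : c * (D ^ (ν / 2) * (B * r)⁻¹) * (-ν / 2) * (a₂ - a₁) = d := by
      rw [hd, ha₁, ha₂]
      field_simp
      ring
    rw [e2, ← le_div_iff₀ hd0] at e1
    have e3 := Real.rpow_le_rpow (Real.rpow_nonneg (hW.nonneg _) _) e1 (z := 1 / (-ν / 2))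
      (by positivity)
    rwa [← Real.rpow_mul (hW.nonneg _), mul_one_div_cancel hα.ne', Real.rpow_one] at e3
  have e1 := hW.mul_le_rpow h hν hγ (a := a₂) (b := b) (by linarith) (hx.mono h2b)
    (fun t ht => he t (h2b ht)) (fun t ht => hcon t ⟨by linarith [ht.1], ht.2⟩)
  have hξ2 : 0 ≤ xiPart (x a₂) := (hcon a₂ ⟨by linarith, by linarith⟩).le
  have e2 : xiPart (x a₂) ^ (-ν / 2) ≤ B * r := by
    have e3 := abs_xiCoord_le (C := C) (A₀ := A₀) (ν := ν) (N := N) (x := x a₂) le_rfl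
    rw [xiCoord_apply, abs_of_nonneg hξ2] at e3
    refine (Real.rpow_le_rpow hξ2 e3 hα.le).trans ((le_of_eq ?_).trans
      (hQ a₂ ⟨by linarith, le_rfl⟩))
    rw [← Real.rpow_mul (gauge4_nonneg _)]
    congr 1; ring
  have e3 : Real.exp (K / c * W (x a₂)) ^ (-ν / 2) ≤ Real.exp (K / c * W₁) ^ (-ν / 2) :=
    Real.rpow_le_rpow (Real.exp_pos _).le (Real.exp_le_exp.2 (by gcongr)) hα.le
  rw [Real.mul_rpow hξ2 (Real.exp_pos _).le] at e1
  have e4 := mul_le_mul e2 e3 (by positivity) (by positivity)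
  have e5 : (B * Real.exp (K / c * W₁) ^ (-ν / 2) + 1) / (γ * (-ν / 2)) * r ≤ b - a₂ := by
    linarith
  rw [div_mul_eq_mul_div, div_le_iff₀ (by positivity)] at e5
  linarith

theorem exists_settling : ∃ T : ℝ, 0 < T ∧ ∀ (x : ℝ → ErrIdx n k → ℝ),
    IsFilippovSolution (errorField C A₀ Gd Lt L ν γ) (Set.Ici 0) x → ∀ q : ℝ, 0 < q →
    gauge4 C A₀ ν N (x 0) ≤ q → ∀ t, T * q ^ (-ν / 4) ≤ t → x t = 0 := by
  obtain ⟨M, hM, hgrow⟩ := h.exists_gauge4_growth hν Lt L γ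
  obtain ⟨T₁, hT₁, hexc⟩ := h.exists_excess_nonpos (Lt := Lt) (L := L) hν hγ
  obtain ⟨T₂, hT₂, hpos⟩ := hW.exists_not_pos h hν hγ
  have hκ : 0 < -ν / 4 := by linarith
  have hinv : ∀ y : ℝ, 0 ≤ y → (y ^ (1 / (-ν / 4))) ^ (-ν / 4) = y := fun y hy => by
    rw [← Real.rpow_mul hy, one_div_mul_cancel hκ.ne', Real.rpow_one]
  -- `T₁` is the time to reach nonpositive excess. Meanwhile $Q^{-\nu/4}$ grows at most by the
  -- factor $1+MT_1$ relative to $q^{-\nu/4}$, and `T₂` is applied to this enlarged scale.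
  refine ⟨T₁ + T₂ * (1 + M * T₁), by positivity, fun x hx q hq hxq t ht => ?_⟩
  set r : ℝ := q ^ (-ν / 4) with hr
  have hr0 : 0 < r := Real.rpow_pos_of_pos hq _
  set t₁ := T₁ * r with ht₁
  have ht₁0 : 0 < t₁ := by positivity
  have ht' : t₁ + T₂ * ((1 + M * T₁) * r) ≤ t := by linarith
  have htt : t₁ < t := lt_of_lt_of_le (lt_add_of_pos_right _ (by positivity)) ht'
  have hx1 : IsFilippovSolution (errorField C A₀ Gd Lt L ν γ) (Set.Icc t₁ t) x :=
    hx.mono fun s hs => ht₁0.le.trans hs.1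
  have he : ∀ s ∈ Set.Icc t₁ t, excess (x s) ≤ 0 := fun s hs => hexc x hx q hq hxq s hs.1
  have hcont := hx1.continuousOn htt.le
  have hzero : ∀ s ∈ Set.Ioc t₁ t, xiPart (x s) ≤ 0 → x s = 0 := fun s hs hs0 => by
    have hsub : Set.Icc t₁ s ⊆ Set.Icc t₁ t := Set.Icc_subset_Icc_right hs.2
    exact hW.eq_zero_of_xiPart_eq_zero h hs.1 (hx1.mono hsub) (fun r hr => he r (hsub hr))
      (le_antisymm hs0 (xiPart_nonneg_of_excess (he s (Set.Ioc_subset_Icc_self hs))))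
  have hQ1 : gauge4 C A₀ ν N (x t₁) ≤ ((1 + M * T₁) * r) ^ (1 / (-ν / 4)) := by
    have e1 := hgrow 0 t₁ ht₁0.le x (hx.mono fun s hs => hs.1)
    have e2 : gauge4 C A₀ ν N (x 0) ^ (-ν / 4) ≤ r :=
      Real.rpow_le_rpow (gauge4_nonneg _) hxq hκ.le
    have e3 : gauge4 C A₀ ν N (x t₁) ^ (-ν / 4) ≤ (1 + M * T₁) * r := by
      rw [ht₁] at e1 ⊢; linarith
    have e4 := Real.rpow_le_rpow (Real.rpow_nonneg (gauge4_nonneg _) _) e3 (z := 1 / (-ν / 4))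
      (by positivity)
    rwa [← Real.rpow_mul (gauge4_nonneg _), mul_one_div_cancel hκ.ne', Real.rpow_one] at e4
  obtain ⟨s₀, hs₀, hs₀0⟩ := hpos t₁ t x _ (by positivity) hx1 he hQ1
    (by rw [hinv _ (by positivity)]; linarith)
  obtain ⟨s, hs, hs0, hspos⟩ := exists_last_nonpos
    (continuous_xiPart.comp_continuousOn (hcont.mono (Set.Icc_subset_Icc_left hs₀.1.le)))
    ⟨s₀, ⟨le_rfl, hs₀.2⟩, hs₀0⟩
  have hs' : s ∈ Set.Ioc t₁ t := ⟨hs₀.1.trans_le hs.1, hs.2⟩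
  have hxs := hzero s hs' hs0
  rcases hs.2.eq_or_lt with hst | hst
  · rw [← hst]; exact hxs
  have hsub : Set.Icc s t ⊆ Set.Icc t₁ t := Set.Icc_subset_Icc_left hs'.1.le
  -- At the last zero `s` of $\xi$ the state is zero, so every positive $q$ bounds the gauge.
  -- Choosing $q$ so that the permitted time of positivity is exactly $t-s$ contradicts $\xi>0$ on
  -- $(s,t]$.
  have hq' : 0 < (t - s) / T₂ := div_pos (by linarith) hT₂
  obtain ⟨r, hr, hr0⟩ := hpos s t x (((t - s) / T₂) ^ (1 / (-ν / 4)))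
    (Real.rpow_pos_of_pos hq' _) (hx1.mono hsub) (fun r hr => he r (hsub hr))
    (by rw [hxs, h.gauge4_zero]; positivity)
    (by rw [hinv _ hq'.le, mul_div_cancel₀ _ hT₂.ne'])
  exact absurd (hspos r hr) (not_lt.2 hr0)

theorem isGloballyFiniteTimeStable :
    IsGloballyFiniteTimeStable (errorField C A₀ Gd Lt L ν γ) := by
  obtain ⟨M, hM, hgrow⟩ := h.exists_gauge4_growth hν Lt L γ
  obtain ⟨T, hT, hset⟩ := hW.exists_settling h hν hγ
  have hκ : 0 < -ν / 4 := by linarith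
  have hcQ : Continuous (gauge4 C A₀ ν N) := (h.contDiff_gauge4 hν).continuous
  refine ⟨h.exists_solution hν Lt L γ, fun b _ x hx => h.exists_extension hν Lt L γ hx,
    fun r hr => ?_, fun x => T * gauge4 C A₀ ν N x ^ (-ν / 4), fun R => ?_,
    fun x hx t ht0 ht => ?_⟩
  · obtain ⟨m, hm, hsmall⟩ := h.exists_norm_lt_of_gauge4_lt hν hr
    -- Before the settling time $Tq^{-\nu/4}$ the quantity $Q^{-\nu/4}$ is at most
    -- $(1+MT)q^{-\nu/4}$; this `q` makes that half of $m^{-\nu/4}$. Afterwards the state is zero.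
    set q : ℝ := (m ^ (-ν / 4) / (2 * (1 + M * T))) ^ (1 / (-ν / 4)) with hq
    have hmT : 0 < m ^ (-ν / 4) / (2 * (1 + M * T)) := by positivity
    have hq0 : 0 < q := Real.rpow_pos_of_pos hmT _
    have hqκ : (1 + M * T) * q ^ (-ν / 4) < m ^ (-ν / 4) := by
      rw [hq, ← Real.rpow_mul hmT.le, one_div_mul_cancel hκ.ne', Real.rpow_one]
      have e1 : (1 + M * T) * (m ^ (-ν / 4) / (2 * (1 + M * T))) = m ^ (-ν / 4) / 2 := by
        field_simp
      rw [e1]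
      exact half_lt_self (by positivity)
    have hev : ∀ᶠ y in 𝓝 (0 : ErrIdx n k → ℝ), gauge4 C A₀ ν N y < q :=
      hcQ.continuousAt.eventually_lt_const (by rwa [h.gauge4_zero])
    obtain ⟨δ, hδ, hball⟩ := Metric.eventually_nhds_iff_ball.1 hev
    refine ⟨δ, hδ, fun x hx hx0 t ht => ?_⟩
    have hxq := (hball (x 0) (by simpa using hx0)).le
    rcases le_total (T * q ^ (-ν / 4)) t with hTt | hTt
    · rw [hset x hx q hq0 hxq t hTt, norm_zero]
      exact hr
    · refine hsmall _ ?_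
      have e1 := hgrow 0 t ht x (hx.mono fun s hs => hs.1)
      have e2 : gauge4 C A₀ ν N (x 0) ^ (-ν / 4) ≤ q ^ (-ν / 4) :=
        Real.rpow_le_rpow (gauge4_nonneg _) hxq hκ.le
      have e3 := mul_le_mul_of_nonneg_left hTt hM.le
      exact (Real.rpow_lt_rpow_iff (gauge4_nonneg _) hm.le hκ).1 (by linarith)
  · obtain ⟨M', hM'⟩ := (isCompact_closedBall (0 : ErrIdx n k → ℝ) R).exists_bound_of_continuousOn
      (hcQ.rpow_const (p := -ν / 4) fun _ => Or.inr hκ.le).continuousOn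
    refine ⟨T * M', fun x hx => mul_le_mul_of_nonneg_left ?_ hT.le⟩
    exact (le_abs_self _).trans (hM' x (by simpa using hx))
  · rcases ht0.eq_or_lt with h0 | h0
    · subst h0
      have e1 : gauge4 C A₀ ν N (x 0) ^ (-ν / 4) ≤ 0 := nonpos_of_mul_nonpos_right ht hT
      have e2 := le_antisymm e1 (Real.rpow_nonneg (gauge4_nonneg _) _)
      exact h.eq_zero_of_gauge4_eq_zero
        ((Real.rpow_eq_zero (gauge4_nonneg _) hκ.ne').1 e2)
    -- Reading $q$ off the time `t` instead of the initial gauge keeps it positive even when the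
    -- initial state is zero.
    · have hq : 0 < t / T := by positivity
      refine hset x hx ((t / T) ^ (1 / (-ν / 4))) (Real.rpow_pos_of_pos hq _) ?_ t ?_
      · have e1 : gauge4 C A₀ ν N (x 0) ^ (-ν / 4) ≤ t / T := by
          rw [le_div_iff₀ hT]; linarith
        have e4 := Real.rpow_le_rpow (Real.rpow_nonneg (gauge4_nonneg _) _) e1
          (z := 1 / (-ν / 4)) (by positivity)
        rwa [← Real.rpow_mul (gauge4_nonneg _), mul_one_div_cancel hκ.ne', Real.rpow_one] at e4
      · rw [← Real.rpow_mul hq.le, one_div_mul_cancel hκ.ne', Real.rpow_one,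
          mul_div_cancel₀ _ hT.ne']

end IsScaledLyapunov
end Stability

end

theorem theorem3 {n k : ℕ} (hn : 0 < n)
    (A : Matrix (Fin n) (Fin n) ℝ) (C : Matrix (Fin k) (Fin n) ℝ)
    (hobs : IsObservablePair A C)
    (N : ℕ) (hN : IsLeast {j : ℕ | (obsMatrix A C j).rank = n} N)
    (G₀ : Matrix (Fin n) (Fin n) ℝ) (Y₀ : Matrix (Fin n) (Fin k) ℝ)
    (hG₀ : A * G₀ - G₀ * A + Y₀ * C = A) (hCG₀ : C * G₀ = 0)
    (L₀ : Matrix (Fin n) (Fin k) ℝ) (hL₀ : L₀ = -((1 + G₀)⁻¹ * Y₀))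
    (A₀ : Matrix (Fin n) (Fin n) ℝ) (hA₀ : A₀ = A + L₀ * C)
    (ν : ℝ) (hν : -(1 / ((N : ℝ) + 1)) ≤ ν)
    (Gd : Matrix (Fin n) (Fin n) ℝ) (hGd : Gd = 1 + ν • (G₀ + 1))
    (γ : ℝ) (hγ : 0 < γ) :
    (∀ ρ : ℝ, 0 < ρ →
      ∃ (P : Matrix (Fin k ⊕ Fin n) (Fin k ⊕ Fin n) ℝ) (Y : Matrix (Fin k ⊕ Fin n) (Fin k) ℝ),
        SolvesLMI C A₀ Gd ρ P Y) ∧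
    (∀ (Lt : Matrix (Fin k) (Fin k) ℝ) (L : Matrix (Fin n) (Fin k) ℝ),
      IsLinearDilation (dSigma (k := k) Gd) ∧
      IsHomogeneousField (dSigma Gd) ν (errorField C A₀ Gd Lt L ν γ)) ∧
    (∀ (Lt : Matrix (Fin k) (Fin k) ℝ) (L : Matrix (Fin n) (Fin k) ℝ),
      (-(1 / ((N : ℝ) + 1)) < ν → Continuous (errorField C A₀ Gd Lt L ν γ)) ∧
      (ν = -(1 / ((N : ℝ) + 1)) → IsPiecewiseContinuous (errorField C A₀ Gd Lt L ν γ))) ∧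
    (ν < 0 →
      ∀ (ρ : ℝ), γ / 2 < ρ →
      ∀ (P : Matrix (Fin k ⊕ Fin n) (Fin k ⊕ Fin n) ℝ) (Y : Matrix (Fin k ⊕ Fin n) (Fin k) ℝ),
        SolvesLMI C A₀ Gd ρ P Y →
      ∀ (Lt : Matrix (Fin k) (Fin k) ℝ) (L : Matrix (Fin n) (Fin k) ℝ),
        fromRows Lt L = P⁻¹ * Y →
        IsGloballyFiniteTimeStable (errorField C A₀ Gd Lt L ν γ)) := by
  subst hL₀ hA₀ hGd
  have h := isGradedPair_of_observable hn hN.1 hG₀ hCG₀ hν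
  refine ⟨fun ρ _ => h.exists_solvesLMI ρ, fun Lt L => ⟨h.isLinearDilation_dSigma,
    h.isHomogeneousField Lt L γ⟩, fun Lt L => ⟨fun hν' => ?_, fun _ =>
    h.isPiecewiseContinuous Lt L γ⟩, fun hν0 ρ hρ P Y hP Lt L hL => ?_⟩
  · refine continuous_iff_continuousAt.2 fun x => h.continuousAt_errorField Lt L γ (Or.inl ?_)
    have hN1 : (0 : ℝ) < N + 1 := by positivity
    rw [neg_lt, lt_div_iff₀ hN1] at hν'
    linarith
  · have hPdet : IsUnit P.det := (solvesLMI_iff.1 hP).2.2.isUnit.map Matrix.detMonoidHom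
    obtain ⟨W, c, K, D, hW⟩ := h.exists_lyapunov hν0 hγ hρ hP (Lt := Lt) (L := L)
      (by rw [hL]; exact Matrix.mul_nonsing_inv_cancel_left P Y hPdet)
    exact hW.isGloballyFiniteTimeStable h hν0 hγ
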